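/- Let $2\le k\le n$ be integers, let $|R|$ denote the Lebesgue measure of $R\subset\mathbb{R}^n$, and let $\mathbb{G}^n=(0,1)^n$. For $x\in\mathbb{R}^n$ let $\mathbf{I}_n^k(x)$ be the family of all open $n$-dimensional intervals $(a_1,b_1)\times\dots\times(a_n,b_n)$ that contain $x$ and whose edge lengths $b_i-a_i$ take at most $k$ different values. For a rotation $\gamma$ of $\mathbb{R}^n$ about the origin let $\mathbf{I}_n^k(\gamma)(x)=\{x+\gamma(I-x): I\in \mathbf{I}_n^k(x)\}$. Let $L(\mathbb{G}^n)$ be the class of Lebesgue measurable $f:\mathbb{R}^n\to\mathbb{R}$ with $\{f\ne0\}\subset\mathbb{G}^n$ and $\int|f|<\infty$, and let $L(\ln^+L)^{k-1}(\mathbb{G}^n)$ be the class of Lebesgue measurable $f:\mathbb{R}^n\to\mathbb{R}$ with $\{f\ne0\}\subset\mathbb{G}^n$ and $\int|f|(\ln^+|f|)^{k-1}<\infty$. Let $S$ be the class of all $f\in L(\mathbb{G}^n)$ such that for every rotation $\gamma$ $$\limsup_{R\in \mathbf{I}_n^k(\gamma)(x),\ \operatorname{diam}R\to0}\ \frac1{|R|}\int_R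 f=+\infty\quad\text{for almost every }x\in\mathbb{G}^n$$ (the exceptional null set may depend on $\gamma$). Then: 1) For every $f\in L(\mathbb{G}^n)\setminus L(\ln^+L)^{k-1}(\mathbb{G}^n)$ there exists an invertible measure preserving mapping $\omega:\mathbb{R}^n\to\mathbb{R}^n$ such that $\{x:\omega(x)\ne x\}\subset\mathbb{G}^n$ and $|f|\circ\omega\in S$. 2) Let $\psi:[0,\infty)\to[0,\infty)$ be a convex function with $\psi(0)=0$, not identically zero, such that for some $c,\tau>0$ one has $\psi(2t)\le c\,\psi(t)$ for all $t>\tau$, and such that $\lim_{h\to\infty}\frac{\psi(h)}{h(\ln h)^{k-1}}=0$. Let $\psi(L)(\mathbb{G}^n)$ be the Orlicz space of all Lebesgue measurable $f:\mathbb{R}^n\to\mathbb{R}$ with $\{f\neq 0\}\subset\mathbb{G}^n$ and $\int\psi(|f|)<\infty$, with the Luxemburg norm $\|f\|=\inf\{c>0:\int\psi(|f|/c)\le1\}$. Then $\psi(L)(\mathbb{G}^n)\setminus S$ is of the first category (meagre) in $\psi(L)(\mathbb{G}^n)$. -/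

import Mathlib

open MeasureTheory Filter Topology Set
open scoped ENNReal

namespace DiffBases

/-- The space `ℝⁿ` with its Euclidean structure and Lebesgue measure. -/
abbrev RSpace (n : ℕ) : Type := EuclideanSpace ℝ (Fin n)

/-- The open unit cube `(0,1)ⁿ`. -/
def unitCube (n : ℕ) : Set (RSpace n) := {x | ∀ i, x i ∈ Ioo (0 : ℝ) 1}

/-- The class `Φ(L)(A)` of measurable functions `f : ℝⁿ → ℝ` that vanish off `A` and satisfy
`∫_{f ≠ 0} Φ(|f|) < ∞`. For Lebesgue measure, `AEMeasurable` is the same as Lebesgue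
measurability of `f`. -/
def phiClass {n : ℕ} (Φ : ℝ → ℝ) (A : Set (RSpace n)) : Set (RSpace n → ℝ) :=
  {f | AEMeasurable f volume ∧ {x | f x ≠ 0} ⊆ A ∧
    ∫⁻ x in {x | f x ≠ 0}, ENNReal.ofReal (Φ |f x|) < ∞}

/-- The class `L(𝔾ⁿ)` of summable functions that vanish off the unit cube. -/
def classL (n : ℕ) : Set (RSpace n → ℝ) := phiClass (fun t => t) (unitCube n)

/-- The class `L (ln⁺ L)^p (𝔾ⁿ)`. -/
def classLLog (n p : ℕ) : Set (RSpace n → ℝ) :=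
  phiClass (fun t => t * (max (Real.log t) 0) ^ p) (unitCube n)

/-- The basis `I_n^k`: to `x` it assigns all open axis-parallel `n`-dimensional intervals that
contain `x` and whose edge lengths take at most `k` different values. -/
def intervalBasis (n k : ℕ) : RSpace n → Set (Set (RSpace n)) := fun x =>
  {R | x ∈ R ∧ ∃ a b : Fin n → ℝ, (∀ i, a i < b i) ∧
    (Set.range fun i => b i - a i).ncard ≤ k ∧ R = {y | ∀ i, y i ∈ Ioo (a i) (b i)}}

/-- The rotations of `ℝⁿ` (about the origin): linear isometries of determinant one. -/
def rotations (n : ℕ) : Set (RSpace n ≃ₗᵢ[ℝ] RSpace n) :=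
  {γ | LinearMap.det (γ.toLinearEquiv : RSpace n →ₗ[ℝ] RSpace n) = 1}

/-- The `γ`-rotated basis: `B(γ)(x) = {x + γ(R - x) : R ∈ B(x)}`. -/
def rotate {n : ℕ} (B : RSpace n → Set (Set (RSpace n))) (γ : RSpace n ≃ₗᵢ[ℝ] RSpace n) :
    RSpace n → Set (Set (RSpace n)) := fun x =>
  {S | ∃ R ∈ B x, S = (fun y => x + γ (y - x)) '' R}

/-- The family `Δ(B)` of all rotations of a basis `B`. -/
def rotatedFamily {n : ℕ} (B : RSpace n → Set (Set (RSpace n))) :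
    Set (RSpace n → Set (Set (RSpace n))) :=
  {B' | ∃ γ ∈ rotations n, B' = rotate B γ}

/-- The upper derivative at `x`, with respect to the basis `B`, of the integral of `f`: the upper
limit of the means of `f` over `R ∈ B x` as the diameter of `R` tends to zero. -/
noncomputable def upperDeriv {n : ℕ} (B : RSpace n → Set (Set (RSpace n))) (f : RSpace n → ℝ)
    (x : RSpace n) : EReal :=
  limsup (fun R : Set (RSpace n) => ((⨍ y in R, f y : ℝ) : EReal))
    (comap (fun R : Set (RSpace n) => Metric.ediam R) (𝓝 0) ⊓ 𝓟 (B x))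

/-- The class `S_Λ` of all `f ∈ L(𝔾ⁿ)` such that, for every basis `B ∈ Λ`, the upper derivative of
the integral of `f` with respect to `B` is `+∞` almost everywhere on the unit cube. -/
def divergenceClass {n : ℕ} (Λ : Set (RSpace n → Set (Set (RSpace n)))) : Set (RSpace n → ℝ) :=
  {f | f ∈ classL n ∧ ∀ B ∈ Λ, ∀ᵐ x ∂(volume.restrict (unitCube n)), upperDeriv B f x = ⊤}

/-- The `Δ₂`-condition at infinity. -/
def DeltaTwo (ψ : ℝ → ℝ) : Prop := ∃ c > 0, ∃ τ > 0, ∀ t > τ, ψ (2 * t) ≤ c * ψ t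

/-- A Young function, generating an Orlicz space: `ψ : [0,∞) → [0,∞)` convex, zero at zero and not
identically zero (hence continuous and nondecreasing). It may vanish near zero, as `t ln⁺ t` does.
Values on `(-∞,0)` are irrelevant. -/
structure YoungFunction where
  /-- the underlying function -/
  toFun : ℝ → ℝ
  convexOn : ConvexOn ℝ (Ici 0) toFun
  map_zero : toFun 0 = 0
  nonneg : ∀ t, 0 ≤ t → 0 ≤ toFun t
  exists_pos : ∃ t, 0 < t ∧ 0 < toFun t

instance : CoeFun YoungFunction (fun _ => ℝ → ℝ) := ⟨YoungFunction.toFun⟩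

/-- The Luxemburg norm `‖f‖ = inf {c > 0 : ∫ ψ(|f|/c) ≤ 1}`, infinite if there is no such `c`. -/
noncomputable def luxemburgNorm {n : ℕ} (ψ : YoungFunction) (f : RSpace n → ℝ) : ℝ≥0∞ :=
  ⨅ (c : ℝ) (_ : 0 < c ∧ ∫⁻ x, ENNReal.ofReal (ψ (|f x| / c)) ≤ 1), ENNReal.ofReal c

/-- The Orlicz space `ψ(L)(𝔾ⁿ)`, as a space of functions. -/
def OrliczSpace (n : ℕ) (ψ : YoungFunction) : Type :=
  {f : RSpace n → ℝ // f ∈ phiClass ψ (unitCube n)}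

theorem YoungFunction.monotoneOn (ψ : YoungFunction) : MonotoneOn ψ (Ici 0) := by
  intro s hs t ht hst
  rcases (mem_Ici.1 ht).eq_or_lt with h0 | ht0
  · have : s = t := le_antisymm hst (h0 ▸ mem_Ici.1 hs)
    rw [this]
  · have hs0 : 0 ≤ s := hs
    have h1 : s / t ≤ 1 := by rw [div_le_one ht0]; exact hst
    have h := ψ.convexOn.2 (mem_Ici.2 (le_refl (0 : ℝ))) ht (sub_nonneg.2 h1)
      (div_nonneg hs0 ht0.le) (by ring)
    simp only [smul_eq_mul, mul_zero, zero_add, ψ.map_zero] at h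
    rw [div_mul_cancel₀ _ ht0.ne'] at h
    exact h.trans (mul_le_of_le_one_left (ψ.nonneg t ht0.le) h1)

theorem YoungFunction.aemeasurable {n : ℕ} (ψ : YoungFunction) {u : RSpace n → ℝ}
    (hu : AEMeasurable u volume) (c : ℝ) (hc : 0 < c) :
    AEMeasurable (fun x => ENNReal.ofReal (ψ (|u x| / c))) volume := by
  have hm : Monotone (fun t : ℝ => ψ (max t 0)) := fun s t hst =>
    ψ.monotoneOn (mem_Ici.2 (le_max_right _ _)) (mem_Ici.2 (le_max_right _ _)) (max_le_max_right 0 hst)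
  have h : AEMeasurable (fun x => |u x| / c) volume := by fun_prop
  have h2 := (hm.measurable.comp_aemeasurable h).ennreal_ofReal
  refine h2.congr (Eventually.of_forall fun x => ?_)
  have : 0 ≤ |u x| / c := by positivity
  simp only [Function.comp, max_eq_left this]

theorem luxemburgNorm_add_le {n : ℕ} (ψ : YoungFunction) {u v : RSpace n → ℝ}
    (hu : AEMeasurable u volume) :
    luxemburgNorm ψ (fun x => u x + v x) ≤ luxemburgNorm ψ u + luxemburgNorm ψ v := by
  unfold luxemburgNorm
  refine ENNReal.le_of_forall_pos_le_add fun ε hε hfin => ?_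
  have hε2 : (0 : ℝ≥0∞) < (ε : ℝ≥0∞) / 2 := by
    exact ENNReal.div_pos (by exact_mod_cast hε.ne') (by simp)
  have h1 := ENNReal.lt_add_right (ENNReal.add_lt_top.1 hfin).1.ne hε2.ne'
  have h2 := ENNReal.lt_add_right (ENNReal.add_lt_top.1 hfin).2.ne hε2.ne'
  simp only [iInf_lt_iff] at h1 h2
  obtain ⟨a, ⟨ha, hIa⟩, hae⟩ := h1
  obtain ⟨b, ⟨hb, hIb⟩, hbe⟩ := h2
  have hab : 0 < a + b := by positivity
  have key : ∫⁻ x, ENNReal.ofReal (ψ (|u x + v x| / (a + b))) ≤ 1 := by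
    have hpt : ∀ x, ENNReal.ofReal (ψ (|u x + v x| / (a + b))) ≤
        ENNReal.ofReal (a / (a + b)) * ENNReal.ofReal (ψ (|u x| / a)) +
        ENNReal.ofReal (b / (a + b)) * ENNReal.ofReal (ψ (|v x| / b)) := by
      intro x
      have hψ := ψ.nonneg
      have hu0 : 0 ≤ |u x| / a := by positivity
      have hv0 : 0 ≤ |v x| / b := by positivity
      rw [← ENNReal.ofReal_mul (by positivity), ← ENNReal.ofReal_mul (by positivity),
        ← ENNReal.ofReal_add (mul_nonneg (by positivity) (hψ _ hu0))
          (mul_nonneg (by positivity) (hψ _ hv0))]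
      refine ENNReal.ofReal_le_ofReal ?_
      have hc := ψ.convexOn.2 (mem_Ici.2 hu0) (mem_Ici.2 hv0) 
        (div_nonneg ha.le hab.le) (div_nonneg hb.le hab.le) (by field_simp)
      simp only [smul_eq_mul] at hc
      have he : a / (a + b) * (|u x| / a) + b / (a + b) * (|v x| / b) =
          (|u x| + |v x|) / (a + b) := by field_simp
      rw [he] at hc
      refine le_trans (ψ.monotoneOn (mem_Ici.2 (by positivity)) (mem_Ici.2 (by positivity)) ?_) hc
      gcongr
      exact abs_add_le _ _
    calc ∫⁻ x, ENNReal.ofReal (ψ (|u x + v x| / (a + b)))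
        ≤ ∫⁻ x, (ENNReal.ofReal (a / (a + b)) * ENNReal.ofReal (ψ (|u x| / a)) +
            ENNReal.ofReal (b / (a + b)) * ENNReal.ofReal (ψ (|v x| / b))) := lintegral_mono hpt
      _ = ENNReal.ofReal (a / (a + b)) * (∫⁻ x, ENNReal.ofReal (ψ (|u x| / a))) +
            ENNReal.ofReal (b / (a + b)) * ∫⁻ x, ENNReal.ofReal (ψ (|v x| / b)) := by
          rw [lintegral_add_left' ((ψ.aemeasurable hu a ha).const_mul _),
            lintegral_const_mul' _ _ ENNReal.ofReal_ne_top,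
            lintegral_const_mul' _ _ ENNReal.ofReal_ne_top]
      _ ≤ ENNReal.ofReal (a / (a + b)) * 1 + ENNReal.ofReal (b / (a + b)) * 1 := by gcongr
      _ = 1 := by
          rw [mul_one, mul_one, ← ENNReal.ofReal_add (by positivity) (by positivity), ← add_div,
            div_self hab.ne', ENNReal.ofReal_one]
  refine (iInf₂_le (a + b) ⟨hab, key⟩).trans ?_
  rw [ENNReal.ofReal_add ha.le hb.le]
  refine (add_le_add hae.le hbe.le).trans (le_of_eq ?_)
  rw [add_add_add_comm, ENNReal.add_halves]

/-- The topology of `ψ(L)(𝔾ⁿ)` is the one of the Luxemburg distance `‖f - g‖`. Functions that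
agree almost everywhere are at distance zero. -/
noncomputable instance (n : ℕ) (ψ : YoungFunction) : PseudoEMetricSpace (OrliczSpace n ψ) where
  edist f g := luxemburgNorm ψ (fun x => f.1 x - g.1 x)
  edist_self f := by
    refine le_antisymm (ENNReal.le_of_forall_pos_le_add fun ε hε _ => ?_) bot_le
    refine (iInf₂_le (ε : ℝ) ⟨by exact_mod_cast hε, ?_⟩).trans ?_
    · simp
    · simp [ψ.map_zero]
  edist_comm f g := by simp only [luxemburgNorm, abs_sub_comm]
  edist_triangle f g h := by
    have := luxemburgNorm_add_le ψ (u := fun x => f.1 x - g.1 x) (v := fun x => g.1 x - h.1 x)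
      (f.2.1.sub g.2.1)
    simpa using this

end DiffBases

open DiffBases

/-!
Both statements rest on one geometric fact and one independence principle.

*Hyperbolic cross.* Put a unit ball at the origin and write `d = n - k + 1`. The intervals centred
there with edges about `2 ^ (d pᵢ)` in `k - 1` directions and `2 ^ (K - ∑ pᵢ)` in the remaining `d`
ones contain the ball, have at most `k` different edge lengths and measure about `2 ^ (d K)`; their
union contains the set `hyperbolicCross n k K` of measure about `K ^ (k - 1) 2 ^ (d K)`. So a height
`h = 2 ^ (d K)` on the ball produces means of order one on a set larger than the ball by the factor
`h (ln h) ^ (k - 1)`. A ball looks the same from every direction: for a rotated basis this holds with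
the rotated cross, and the function does not have to know the rotation (`exists_rotated_interval`).

*Independence.* Place such balls of radius `θ s` at the points of the lattice `s ℤⁿ`; the copies of
the rotated cross around them have density `a = θ ^ n |E|`. If `s` is small enough with respect to a
set `U`, they cover almost exactly the proportion `a` of `U`. This follows from Fubini's theorem: the
average over all translates of the periodic set is exact, and `U` is nearly invariant under
translations by one period (`volume_mul_le_periodize`). Since rotations preserve Lebesgue measure,
the moduli of translation continuity of the earlier stages do not depend on the rotation
(`exists_translate_periodize_rotatedCopy_le`), so one sequence of scales serves all rotations, and
stages with `∑ aᵢ = ∞` cover almost every point infinitely often, for each rotation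
(`exists_scales_covering`, `ae_frequently_mem_of_covering`).

For the first statement, the balls of the `j`-th level are given total measure comparable to that of
the dyadic layer `{2 ^ (d j) ≤ |f| < 2 ^ (d (j + 1))}`. That `f` is not in the Zygmund class says that
the corresponding densities have infinite sum, even for the crosses of index `j - l`, which yield
means of order `2 ^ (d l)` (`not_summable_layer`, `exists_spread_sets`). A measure-preserving
automorphism that carries almost all of the balls into the layers exists by matching quantile
functions (`exists_rearrangement`).

For the second statement, bounded functions are dense by the `Δ₂`-condition, and the addition of
`h 1_W` for a finite union `W` of stages with the same index `K` makes the means large off a set of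
small measure, uniformly in the rotation. By the growth condition on `ψ` this costs little in the
Luxemburg norm when `K` is large, and it persists in a neighbourhood, so that the functions with large
means contain a dense `G_δ` (`exists_spread_open`, `dense_interior_largeMeans`).
-/

namespace DiffBases

/-! ### Translates of sets of finite measure -/

/-- Translation is continuous in measure, in the one-sided forms that are needed below. -/
theorem tendsto_measure_translate_diff {n : ℕ} {E : Set (RSpace n)} (hE : MeasurableSet E)
    (hEf : volume E ≠ ∞) {ε : ℝ≥0∞} (hε : 0 < ε) :
    ∃ δ > 0, ∀ t : RSpace n, ‖t‖ < δ →
      volume {x | x - t ∈ E ∧ x ∉ E} ≤ ε ∧ volume {x | x ∈ E ∧ x - t ∉ E} ≤ ε := by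
  let F : RSpace n → C(RSpace n, RSpace n) := fun t => ⟨fun x => x - t, by fun_prop⟩
  have hF : Continuous F := by
    refine ContinuousMap.continuous_of_continuous_uncurry _ ?_
    change Continuous fun p : RSpace n × RSpace n => p.2 - p.1
    fun_prop
  have hmp : ∀ t, MeasurePreserving (F t) volume volume := fun t =>
    measurePreserving_sub_right volume t
  have h := tendsto_measure_symmDiff_preimage_nhds_zero (s := E) (hF.tendsto 0)
    (Eventually.of_forall hmp) (hmp 0) hE.nullMeasurableSet hEf
  have h2 := (ENNReal.tendsto_nhds_zero.1 h) ε hε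
  obtain ⟨δ, hδ, hb⟩ := Metric.eventually_nhds_iff.1 h2
  refine ⟨δ, hδ, fun t ht => ?_⟩
  have h3 := hb (y := t) (by simpa using ht)
  constructor
  · refine (measure_mono ?_).trans h3
    rintro x ⟨h1, h2⟩
    left
    exact ⟨h1, by simpa [F] using h2⟩
  · refine (measure_mono ?_).trans h3
    rintro x ⟨h1, h2⟩
    right
    exact ⟨by simpa [F] using h1, h2⟩

/-! ### Periodic sets -/

/-- The lattice point `s z`, for `z ∈ ℤⁿ`. -/
noncomputable def latticePoint {n : ℕ} (s : ℝ) (z : Fin n → ℤ) : RSpace n :=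
  WithLp.toLp 2 fun i => s * z i

/-- The half-open cube with centre at the origin and edge length `s`. -/
def cell (n : ℕ) (s : ℝ) : Set (RSpace n) := {x | ∀ i, x i ∈ Ico (-(s / 2)) (s / 2)}

/-- The union of the translates of `K` by the lattice `sℤⁿ`. -/
def periodize {n : ℕ} (s : ℝ) (K : Set (RSpace n)) : Set (RSpace n) :=
  {x | ∃ z : Fin n → ℤ, x - latticePoint s z ∈ K}

theorem measurableSet_cell (n : ℕ) (s : ℝ) : MeasurableSet (cell n s) := by
  have : cell n s = ⋂ i, (fun x : RSpace n => x i) ⁻¹' Ico (-(s / 2)) (s / 2) := by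
    ext x; simp [cell]
  rw [this]
  exact MeasurableSet.iInter fun i => (by fun_prop : Measurable fun x : RSpace n => x i) measurableSet_Ico

theorem volume_coordBox {n : ℕ} (I : Fin n → Set ℝ) :
    volume {x : RSpace n | ∀ i, x i ∈ I i} = ∏ i, volume (I i) := by
  have h := (EuclideanSpace.volume_preserving_symm_measurableEquiv_toLp (Fin n)).measure_preimage_equiv
    (univ.pi I)
  rw [← volume_pi_pi, ← h]
  congr 1
  ext x
  simp

theorem volume_cell (n : ℕ) {s : ℝ} : volume (cell n s) = ENNReal.ofReal s ^ n := by
  have := volume_coordBox (n := n) fun _ => Ico (-(s / 2)) (s / 2)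
  rw [cell, this]
  simp

theorem periodize_eq_iUnion {n : ℕ} (s : ℝ) (K : Set (RSpace n)) :
    periodize s K = ⋃ z : Fin n → ℤ, (fun x => x - latticePoint s z) ⁻¹' K := by
  ext x; simp [periodize]

theorem measurableSet_periodize {n : ℕ} (s : ℝ) {K : Set (RSpace n)} (hK : MeasurableSet K) :
    MeasurableSet (periodize s K) := by
  rw [periodize_eq_iUnion]
  exact MeasurableSet.iUnion fun z => (measurable_sub_const _) hK

theorem existsUnique_sub_latticePoint_mem_cell {n : ℕ} {s : ℝ} (hs : 0 < s) (x : RSpace n) :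
    ∃! z : Fin n → ℤ, x - latticePoint s z ∈ cell n s := by
  have key : ∀ z : Fin n → ℤ, x - latticePoint s z ∈ cell n s ↔ ∀ i, z i = ⌊x i / s + 1 / 2⌋ := by
    intro z
    simp only [cell, mem_ofPred_eq, mem_Ico, latticePoint, PiLp.sub_apply]
    refine forall_congr' fun i => ?_
    rw [eq_comm, Int.floor_eq_iff]
    have e : x i = x i / s * s := by field_simp
    constructor
    · rintro ⟨h1, h2⟩
      constructor
      · by_contra! h
        have := mul_lt_mul_of_pos_right h hs
        nlinarith
      · by_contra! h
        have := mul_le_mul_of_nonneg_right h hs.le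
        nlinarith
    · rintro ⟨h1, h2⟩
      have a1 := mul_le_mul_of_nonneg_right h1 hs.le
      have a2 := mul_lt_mul_of_pos_right h2 hs
      constructor <;> nlinarith
  refine ⟨fun i => ⌊x i / s + 1 / 2⌋, (key _).2 fun i => rfl, fun z hz => funext ((key z).1 hz)⟩

theorem pairwise_disjoint_translates {n : ℕ} {s : ℝ} (hs : 0 < s) {K : Set (RSpace n)}
    (hK : K ⊆ cell n s) :
    Pairwise (Function.onFun Disjoint fun z : Fin n → ℤ => (fun x => x - latticePoint s z) ⁻¹' K) := by
  intro z w hzw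
  refine Set.disjoint_left.2 fun x hx hx' => hzw ?_
  exact (existsUnique_sub_latticePoint_mem_cell hs x).unique (hK hx) (hK hx')

theorem lintegral_eq_tsum_cell {n : ℕ} {s : ℝ} (hs : 0 < s) {f : RSpace n → ℝ≥0∞}
    (hf : Measurable f) :
    ∫⁻ x, f x = ∑' z : Fin n → ℤ, ∫⁻ t in cell n s, f (t + latticePoint s z) := by
  have hu : (⋃ z : Fin n → ℤ, (fun x : RSpace n => x - latticePoint s z) ⁻¹' cell n s) = univ := by
    refine eq_univ_of_forall fun x => mem_iUnion.2 ?_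
    exact (existsUnique_sub_latticePoint_mem_cell hs x).exists
  rw [← setLIntegral_univ, ← hu, lintegral_iUnion
    (fun z => (measurable_sub_const (latticePoint s z)) (measurableSet_cell n s))
    (pairwise_disjoint_translates hs subset_rfl)]
  refine tsum_congr fun z => ?_
  have := (measurePreserving_sub_right volume (latticePoint s z)).setLIntegral_comp_preimage
    (measurableSet_cell n s) (hf.comp (measurable_id.add_const (latticePoint s z)))
  simpa using this

/-- The average of `|U ∩ (t + periodize s K)|` over the translations `t` of one period is
`|U| |K| / s ^ n`: every point of `U` is covered for the same proportion of all `t`. -/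
theorem lintegral_inter_translates {n : ℕ} {s : ℝ} (hs : 0 < s) {K U : Set (RSpace n)}
    (hK : MeasurableSet K) (hKs : K ⊆ cell n s) (hU : MeasurableSet U) :
    ∫⁻ t in cell n s, volume (U ∩ {x | x - t ∈ periodize s K}) = volume U * volume K := by
  have h1 : ∀ t : RSpace n, volume (U ∩ {x | x - t ∈ periodize s K}) =
      ∑' z : Fin n → ℤ, ∫⁻ y in K, U.indicator 1 (t + latticePoint s z + y) := by
    intro t
    have e : U ∩ {x | x - t ∈ periodize s K} =
        ⋃ z : Fin n → ℤ, (fun x => x - (t + latticePoint s z)) ⁻¹' (K ∩ {y | t + latticePoint s z + y ∈ U}) := by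
      ext x
      simp only [periodize, mem_inter_iff, mem_ofPred_eq, mem_iUnion, mem_preimage]
      constructor
      · rintro ⟨hx, z, hz⟩
        exact ⟨z, by rwa [← sub_sub], by simpa using hx⟩
      · rintro ⟨z, hz, hx⟩
        exact ⟨by simpa using hx, z, by rwa [sub_sub]⟩
    have hm : ∀ z : Fin n → ℤ, MeasurableSet (K ∩ {y | t + latticePoint s z + y ∈ U}) := fun z =>
      hK.inter ((measurable_const_add _) hU)
    rw [e, measure_iUnion]
    · refine tsum_congr fun z => ?_
      rw [(measurePreserving_sub_right volume (t + latticePoint s z)).measure_preimage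
        (hm z).nullMeasurableSet]
      have : (fun y => U.indicator (1 : RSpace n → ℝ≥0∞) (t + latticePoint s z + y)) =
          ({y | t + latticePoint s z + y ∈ U}).indicator 1 := by
        ext y; simp [indicator]
      have hmU : MeasurableSet {y : RSpace n | t + latticePoint s z + y ∈ U} :=
        (measurable_const_add _) hU
      rw [this, lintegral_indicator_one hmU, Measure.restrict_apply hmU, inter_comm]
    · intro z w hzw
      refine Set.disjoint_left.2 fun x hx hx' => hzw ?_
      refine (existsUnique_sub_latticePoint_mem_cell hs (x - t)).unique (hKs ?_) (hKs ?_)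
      · rw [sub_sub]; exact hx.1
      · rw [sub_sub]; exact hx'.1
    · exact fun z => (measurable_sub_const _) (hm z)
  have hmeas : Measurable (fun p : RSpace n × RSpace n =>
      U.indicator (1 : RSpace n → ℝ≥0∞) (p.1 + p.2)) :=
    (measurable_one.indicator hU).comp (measurable_fst.add measurable_snd)
  have hmz : ∀ z : Fin n → ℤ, Measurable (fun p : RSpace n × RSpace n =>
      U.indicator (1 : RSpace n → ℝ≥0∞) (p.1 + latticePoint s z + p.2)) := fun z =>
    hmeas.comp ((measurable_fst.add_const _).prodMk measurable_snd)
  simp_rw [h1]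
  rw [lintegral_tsum fun z => (Measurable.lintegral_prod_right' (hmz z)).aemeasurable]
  have h2 : ∀ z : Fin n → ℤ, ∫⁻ t in cell n s, ∫⁻ y in K, U.indicator 1 (t + latticePoint s z + y) =
      ∫⁻ y in K, ∫⁻ t in cell n s, U.indicator 1 (t + latticePoint s z + y) := fun z =>
    lintegral_lintegral_swap (hmz z).aemeasurable
  simp_rw [h2]
  rw [← lintegral_tsum fun z => (Measurable.lintegral_prod_left' (hmz z)).aemeasurable]
  have h3 : ∀ y : RSpace n, ∑' z : Fin n → ℤ, ∫⁻ t in cell n s, U.indicator (1 : RSpace n → ℝ≥0∞) (t + latticePoint s z + y)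
      = volume U := by
    intro y
    rw [← lintegral_eq_tsum_cell hs (f := fun x => U.indicator 1 (x + y))
      ((measurable_one.indicator hU).comp (measurable_add_const y)),
      lintegral_add_right_eq_self (fun x => U.indicator (1 : RSpace n → ℝ≥0∞) x) y,
      lintegral_indicator_one hU]
  simp_rw [h3]
  simp

/-- If `U` is almost invariant under translations by less than one period, then
`|U ∩ (t + periodize s K)|` is almost independent of `t`, hence at `t = 0` almost equal to its
average. This is the lower bound; `periodize_le_volume_mul` is the upper one. -/
theorem volume_mul_le_periodize {n : ℕ} {s : ℝ} (hs : 0 < s) {K U : Set (RSpace n)} {η : ℝ≥0∞}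
    (hK : MeasurableSet K) (hKs : K ⊆ cell n s) (hU : MeasurableSet U)
    (h : ∀ t ∈ cell n s, volume {x | x ∈ U ∧ x - t ∉ U} ≤ η) :
    volume U * volume K ≤ ENNReal.ofReal s ^ n * (volume (U ∩ periodize s K) + η) := by
  rw [← lintegral_inter_translates hs hK hKs hU, ← volume_cell, mul_comm, ← setLIntegral_const]
  refine setLIntegral_mono measurable_const fun t ht => ?_
  have e : volume (U ∩ periodize s K) = volume ((fun x => x - t) ⁻¹' (U ∩ periodize s K)) :=
    ((measurePreserving_sub_right volume t).measure_preimage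
      (hU.inter (measurableSet_periodize s hK)).nullMeasurableSet).symm
  rw [e]
  refine le_trans (measure_mono ?_) ((measure_union_le _ _).trans (add_le_add_right (h t ht) _))
  rintro x ⟨hx, hx'⟩
  by_cases hxt : x - t ∈ U
  · left; exact ⟨hxt, hx'⟩
  · right; exact ⟨hx, hxt⟩

/-- The upper bound that goes with `volume_mul_le_periodize`. -/
theorem periodize_le_volume_mul {n : ℕ} {s : ℝ} (hs : 0 < s) {K U : Set (RSpace n)} {η : ℝ≥0∞}
    (hK : MeasurableSet K) (hKs : K ⊆ cell n s) (hU : MeasurableSet U)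
    (h : ∀ t ∈ cell n s, volume {x | x - t ∈ U ∧ x ∉ U} ≤ η) :
    ENNReal.ofReal s ^ n * volume (U ∩ periodize s K) ≤
      volume U * volume K + ENNReal.ofReal s ^ n * η := by
  rw [← lintegral_inter_translates hs hK hKs hU, ← volume_cell, mul_comm, ← setLIntegral_const,
    mul_comm (volume _) η, ← setLIntegral_const (cell n s) η, ← lintegral_add_right _ measurable_const]
  refine lintegral_mono_ae ((ae_restrict_mem (measurableSet_cell n s)).mono fun t ht => ?_)
  have e : volume (U ∩ periodize s K) = volume ((fun x => x - t) ⁻¹' (U ∩ periodize s K)) :=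
    ((measurePreserving_sub_right volume t).measure_preimage
      (hU.inter (measurableSet_periodize s hK)).nullMeasurableSet).symm
  rw [e]
  refine le_trans (measure_mono ?_) ((measure_union_le _ _).trans (add_le_add_right (h t ht) _))
  rintro x ⟨hx, hx'⟩
  by_cases hxt : x ∈ U
  · left; exact ⟨hxt, hx'⟩
  · right; exact ⟨hx, hxt⟩

/-! ### Rotated copies and the choice of scales -/

/-- The set `r • γ(E)`, written as a preimage. For `r = 0` it is empty as soon as `0 ∉ E`. -/
def rotatedCopy {n : ℕ} (r : ℝ) (γ : RSpace n ≃ₗᵢ[ℝ] RSpace n) (E : Set (RSpace n)) :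
    Set (RSpace n) := {x | γ.symm (r⁻¹ • x) ∈ E}

theorem measurableSet_rotatedCopy {n : ℕ} (r : ℝ) (γ : RSpace n ≃ₗᵢ[ℝ] RSpace n)
    {E : Set (RSpace n)} (hE : MeasurableSet E) : MeasurableSet (rotatedCopy r γ E) :=
  (γ.symm.continuous.comp (continuous_const_smul r⁻¹)).measurable hE

theorem rotatedCopy_zero {n : ℕ} (γ : RSpace n ≃ₗᵢ[ℝ] RSpace n) {E : Set (RSpace n)}
    (h0 : (0 : RSpace n) ∉ E) : rotatedCopy 0 γ E = ∅ := by
  ext x; simp [rotatedCopy, h0]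

theorem volume_rotatedCopy {n : ℕ} {r : ℝ} (hr : 0 < r) (γ : RSpace n ≃ₗᵢ[ℝ] RSpace n)
    {E : Set (RSpace n)} (hE : MeasurableSet E) :
    volume (rotatedCopy r γ E) = ENNReal.ofReal r ^ n * volume E := by
  have e : rotatedCopy r γ E = (fun x => r⁻¹ • x) ⁻¹' (γ.symm ⁻¹' E) := rfl
  rw [e, Measure.addHaar_preimage_smul _ (inv_ne_zero hr.ne'),
    (γ.symm.measurePreserving).measure_preimage hE.nullMeasurableSet]
  simp only [finrank_euclideanSpace, Fintype.card_fin, inv_pow, inv_inv]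
  rw [abs_of_pos (by positivity), ENNReal.ofReal_pow hr.le]

theorem rotatedCopy_subset_cell {n : ℕ} {r s ρ : ℝ} (hr : 0 ≤ r)
    (γ : RSpace n ≃ₗᵢ[ℝ] RSpace n)
    {E : Set (RSpace n)} (h0 : (0 : RSpace n) ∉ E) (hE : E ⊆ Metric.ball 0 ρ) (hrs : r * ρ ≤ s / 2) :
    rotatedCopy r γ E ⊆ cell n s := by
  rcases hr.eq_or_lt with rfl | hr
  · rw [rotatedCopy_zero γ h0]; exact empty_subset _
  intro x hx
  have h1 : ‖γ.symm (r⁻¹ • x)‖ < ρ := by simpa using hE hx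
  rw [LinearIsometryEquiv.norm_map, norm_smul, norm_inv, Real.norm_of_nonneg hr.le,
    inv_mul_lt_iff₀ hr] at h1
  intro i
  have h2 := PiLp.norm_apply_le x i
  rw [Real.norm_eq_abs] at h2
  have h3 := abs_lt.1 (lt_of_le_of_lt h2 (h1.trans_le hrs))
  exact ⟨h3.1.le, h3.2⟩

theorem norm_le_of_mem_cell {n : ℕ} {s : ℝ} (hs : 0 < s) {t : RSpace n} (ht : t ∈ cell n s) :
    ‖t‖ ≤ n * s := by
  rw [EuclideanSpace.norm_eq]
  refine Real.sqrt_le_iff.2 ⟨by positivity, ?_⟩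
  calc ∑ i, ‖t i‖ ^ 2 ≤ ∑ _i : Fin n, s ^ 2 := by
        refine Finset.sum_le_sum fun i _ => ?_
        have := ht i
        rw [Real.norm_eq_abs]
        refine pow_le_pow_left₀ (abs_nonneg _) (abs_le.2 ⟨?_, ?_⟩) 2 <;> linarith [this.1, this.2]
    _ = n * s ^ 2 := by simp
    _ ≤ (n * s) ^ 2 := by
        rw [mul_pow]
        refine mul_le_mul_of_nonneg_right ?_ (by positivity)
        exact_mod_cast Nat.le_self_pow two_ne_zero n

theorem measurableSet_unitCube (n : ℕ) : MeasurableSet (unitCube n) := by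
  have : unitCube n = ⋂ i, (fun x : RSpace n => x i) ⁻¹' Ioo (0 : ℝ) 1 := by
    ext x; simp [unitCube]
  rw [this]
  exact MeasurableSet.iInter fun i => (by fun_prop : Measurable fun x : RSpace n => x i) measurableSet_Ioo

theorem volume_unitCube (n : ℕ) : volume (unitCube n) = 1 := by
  have := volume_coordBox (n := n) fun _ => Ioo (0 : ℝ) 1
  rw [unitCube, this]
  simp

theorem isOpen_unitCube (n : ℕ) : IsOpen (unitCube n) := by
  have : unitCube n = ⋂ i, (fun x : RSpace n => x i) ⁻¹' Ioo (0 : ℝ) 1 := by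
    ext x; simp [unitCube]
  rw [this]
  exact isOpen_iInter_of_finite fun i => isOpen_Ioo.preimage (by fun_prop)

/-- A rotated periodic set is changed little by small translations, uniformly in the rotation:
Lebesgue measure is rotation invariant, so each of the finitely many copies of `E` near the cube
contributes the measure of a translate of `E` minus `E`, for a translation of the same length. -/
theorem exists_translate_periodize_rotatedCopy_le {n : ℕ} {r s ρ : ℝ} (hr : 0 ≤ r) (hs : 0 < s)
    {E : Set (RSpace n)} (hEm : MeasurableSet E) (h0 : (0 : RSpace n) ∉ E)
    (hE : E ⊆ Metric.ball 0 ρ) (hrs : r * ρ ≤ s / 2) {ε : ℝ≥0∞} (hε : 0 < ε) :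
    ∃ δ > 0, ∀ t : RSpace n, ‖t‖ < δ → ∀ γ : RSpace n ≃ₗᵢ[ℝ] RSpace n,
      volume {x | x ∈ unitCube n ∧ x - t ∈ periodize s (rotatedCopy r γ E) ∧
        x ∉ periodize s (rotatedCopy r γ E)} ≤ ε := by
  rcases hr.eq_or_lt with rfl | hr
  · refine ⟨1, one_pos, fun t _ γ => ?_⟩
    simp [rotatedCopy_zero γ h0, periodize]
  have hEf : volume E ≠ ∞ := ((measure_mono hE).trans_lt measure_ball_lt_top).ne
  -- Only copies centred at `s z` with `|zᵢ| ≤ 2 / s + 1 / 2` can meet the cube after a translation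
  -- of length less than `1`.
  let B : ℤ := ⌈2 / s + 1 / 2⌉
  let Z : Finset (Fin n → ℤ) := Fintype.piFinset fun _ => Finset.Icc (-B) B
  obtain ⟨η, hη, hηε⟩ : ∃ η : ℝ≥0∞, 0 < η ∧ Z.card * (ENNReal.ofReal r ^ n * η) ≤ ε := by
    have hC : (Z.card : ℝ≥0∞) * ENNReal.ofReal r ^ n ≠ ∞ :=
      ENNReal.mul_ne_top (by simp) (by simp)
    refine ⟨ε / (Z.card * ENNReal.ofReal r ^ n), ENNReal.div_pos hε.ne' hC, ?_⟩
    rw [← mul_assoc]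
    exact ENNReal.mul_div_le
  obtain ⟨δ, hδ, h⟩ := tendsto_measure_translate_diff hEm hEf hη
  refine ⟨min 1 (r * δ), by positivity, fun t ht γ => ?_⟩
  have ht1 : ‖t‖ < 1 := ht.trans_le (min_le_left _ _)
  have ht2 : ‖γ.symm (r⁻¹ • t)‖ < δ := by
    rw [LinearIsometryEquiv.norm_map, norm_smul, norm_inv, Real.norm_of_nonneg hr.le,
      inv_mul_lt_iff₀ hr]
    exact ht.trans_le (min_le_right _ _)
  set D : Set (RSpace n) := {e | e - γ.symm (r⁻¹ • t) ∈ E ∧ e ∉ E} with hD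
  have hDm : MeasurableSet D := ((measurable_sub_const _) hEm).inter hEm.compl
  have hsub : {x | x ∈ unitCube n ∧ x - t ∈ periodize s (rotatedCopy r γ E) ∧
        x ∉ periodize s (rotatedCopy r γ E)} ⊆
      ⋃ z ∈ Z, (fun x => x - latticePoint s z) ⁻¹' rotatedCopy r γ D := by
    rintro x ⟨hxQ, ⟨z, hz⟩, hx⟩
    simp only [mem_iUnion, mem_preimage]
    refine ⟨z, ?_, ?_, ?_⟩
    · rw [Fintype.mem_piFinset]
      intro i
      have hc := rotatedCopy_subset_cell hr.le γ h0 hE hrs hz i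
      have hti : |t i| < 1 := by
        have := PiLp.norm_apply_le t i
        rw [Real.norm_eq_abs] at this
        linarith
      have hxi := hxQ i
      simp only [PiLp.sub_apply, latticePoint, mem_Ico] at hc
      rw [abs_lt] at hti
      have hb : |(z i : ℝ)| ≤ 2 / s + 1 / 2 := by
        have e : 2 / s + 1 / 2 = (2 + s / 2) / s := by field_simp
        rw [e, le_div_iff₀ hs, ← abs_of_pos hs, ← abs_mul, abs_of_pos hs, abs_le]
        constructor <;> linarith [hc.1, hc.2, hxi.1, hxi.2, hti.1, hti.2, mul_comm s (z i : ℝ)]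
      have hb2 : |(z i : ℝ)| ≤ B := hb.trans (Int.le_ceil _)
      rw [abs_le] at hb2
      rw [Finset.mem_Icc]
      exact ⟨by exact_mod_cast hb2.1, by exact_mod_cast hb2.2⟩
    · change γ.symm (r⁻¹ • (x - t - latticePoint s z)) ∈ E at hz
      rw [← map_sub, ← smul_sub, sub_right_comm]
      exact hz
    · exact fun h => hx ⟨z, h⟩
  calc _ ≤ volume (⋃ z ∈ Z, (fun x => x - latticePoint s z) ⁻¹' rotatedCopy r γ D) :=
        measure_mono hsub
    _ ≤ ∑ z ∈ Z, volume ((fun x => x - latticePoint s z) ⁻¹' rotatedCopy r γ D) :=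
        measure_biUnion_finset_le _ _
    _ = ∑ z ∈ Z, ENNReal.ofReal r ^ n * volume D := by
        refine Finset.sum_congr rfl fun z _ => ?_
        rw [(measurePreserving_sub_right volume (latticePoint s z)).measure_preimage
          (measurableSet_rotatedCopy r γ hDm).nullMeasurableSet, volume_rotatedCopy hr γ hDm]
    _ ≤ Z.card * (ENNReal.ofReal r ^ n * η) := by
        rw [Finset.sum_const, nsmul_eq_mul]
        gcongr
        exact (h _ ht2).1
    _ ≤ ε := hηε

/-- Scales can be chosen one after the other, each small enough with respect to the ones before:
`P i s m s'` is a condition on the scales `s` and `s'` of the stages `i < m`, and `P0 m s` one on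
the scale of the stage `m` alone. -/
theorem exists_seq_scales {P : ℕ → ℝ → ℕ → ℝ → Prop} {P0 : ℕ → ℝ → Prop}
    (h0 : ∀ m, ∀ᶠ s in 𝓝[>] 0, P0 m s)
    (h : ∀ i m s, 0 < s → ∀ᶠ s' in 𝓝[>] 0, P i s m s') :
    ∃ s : ℕ → ℝ, (∀ m, 0 < s m) ∧ (∀ m, P0 m (s m)) ∧ ∀ m, ∀ i < m, P i (s i) m (s m) := by
  have key : ∀ m (p : ∀ i < m, ℝ), ∃ s : ℝ, 0 < s ∧ P0 m s ∧
      ∀ i (hi : i < m), 0 < p i hi → P i (p i hi) m s := by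
    intro m p
    have h1 : ∀ᶠ s' in 𝓝[>] (0 : ℝ), ∀ i : Fin m, 0 < p i i.2 → P i (p i i.2) m s' := by
      refine eventually_all.2 fun i => ?_
      by_cases hp : 0 < p i i.2
      · exact (h i m _ hp).mono fun s hs _ => hs
      · exact Eventually.of_forall fun s hs => absurd hs hp
    obtain ⟨s, hs, hs0, hs1⟩ := ((eventually_mem_nhdsWithin).and ((h0 m).and h1)).exists
    exact ⟨s, hs, hs0, fun i hi => hs1 ⟨i, hi⟩⟩
  choose F hF using key
  let s : ℕ → ℝ := WellFounded.fix (measure id).wf fun m p => F m fun i hi => p i hi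
  have hs : ∀ m, s m = F m fun i _ => s i := fun m => WellFounded.fix_eq _ _ m
  have hpos : ∀ m, 0 < s m := fun m => by rw [hs m]; exact (hF m _).1
  refine ⟨s, hpos, fun m => ?_, fun m i hi => ?_⟩
  · rw [hs m]; exact (hF m _).2.1
  · have := (hF m fun i _ => s i).2.2 i hi (hpos i)
    rw [← hs m] at this
    exact this

/-- If the `m`-th step removes the proportion `a m` of what is left, up to an error `ε m`, then the
proportion left decays like `exp (-∑ a)`, up to the sum of the errors. -/
theorem covering_recursion {a v ε : ℕ → ℝ} {M : ℕ} (hv1 : v M ≤ 1) (hv0 : ∀ m, 0 ≤ v m)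
    (ha : ∀ m, 0 ≤ a m) (hε : ∀ m, 0 ≤ ε m)
    (h : ∀ m ≥ M, v (m + 1) ≤ v m - a m * v m + ε m) (M' : ℕ) (hM : M ≤ M') :
    v M' ≤ Real.exp (-∑ i ∈ Finset.Ico M M', a i) + ∑ i ∈ Finset.Ico M M', ε i := by
  induction M', hM using Nat.le_induction with
  | base => simpa using hv1
  | succ m hm ih =>
    rw [Finset.sum_Ico_succ_top hm, Finset.sum_Ico_succ_top hm, neg_add, Real.exp_add]
    have h1 : 1 - a m ≤ Real.exp (-a m) := by linarith [Real.add_one_le_exp (-a m)]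
    have h2 : Real.exp (-a m) ≤ 1 := Real.exp_le_one_iff.2 (by linarith [ha m])
    have hS : 0 ≤ ∑ i ∈ Finset.Ico M m, ε i := Finset.sum_nonneg fun i _ => hε i
    calc v (m + 1) ≤ (1 - a m) * v m + ε m := by linarith [h m hm]
      _ ≤ Real.exp (-a m) * v m + ε m := by
          gcongr
          exact hv0 m
      _ ≤ Real.exp (-a m) * (Real.exp (-∑ i ∈ Finset.Ico M m, a i) + ∑ i ∈ Finset.Ico M m, ε i)
          + ε m := by gcongr
      _ ≤ _ := by nlinarith [mul_le_mul_of_nonneg_right h2 hS]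

/-! ### Covering the cube by independent stages -/

theorem eventually_forall_mem_cell {n : ℕ} {p : RSpace n → Prop} {δ : ℝ} (hδ : 0 < δ)
    (h : ∀ t, ‖t‖ < δ → p t) : ∀ᶠ s in 𝓝[>] (0 : ℝ), ∀ t ∈ cell n s, p t := by
  have hpos : (0 : ℝ) < δ / (n + 1) := by positivity
  filter_upwards [Ioo_mem_nhdsGT hpos] with s hs t ht
  refine h t ((norm_le_of_mem_cell hs.1 ht).trans_lt ?_)
  have := (lt_div_iff₀ (by positivity)).1 hs.2
  nlinarith [hs.1]

/-- A stage of the construction: the copies of `θ s • γ(E)` centred at the points of the lattice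
`sℤⁿ`. -/
def stageSet {n : ℕ} (s θ : ℝ) (γ : RSpace n ≃ₗᵢ[ℝ] RSpace n) (E : Set (RSpace n)) :
    Set (RSpace n) := periodize s (rotatedCopy (θ * s) γ E)

theorem measurableSet_stageSet {n : ℕ} (s θ : ℝ) (γ : RSpace n ≃ₗᵢ[ℝ] RSpace n)
    {E : Set (RSpace n)} (hE : MeasurableSet E) : MeasurableSet (stageSet s θ γ E) :=
  measurableSet_periodize _ (measurableSet_rotatedCopy _ _ hE)

/-- A stage meets every set `U` that is nearly invariant under translations by less than one period
in about the expected proportion. -/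
theorem mul_volume_le_inter_stageSet {n : ℕ} {s θ ρ η : ℝ} (hs : 0 < s) (hθ : 0 ≤ θ) (hη : 0 ≤ η)
    (γ : RSpace n ≃ₗᵢ[ℝ] RSpace n) {E U : Set (RSpace n)} (hEm : MeasurableSet E)
    (h0 : (0 : RSpace n) ∉ E) (hE : E ⊆ Metric.ball 0 ρ) (hρ : θ * ρ ≤ 1 / 2)
    (hU : MeasurableSet U) (hUf : volume U ≠ ∞)
    (h : ∀ t ∈ cell n s, volume {x | x ∈ U ∧ x - t ∉ U} ≤ ENNReal.ofReal η) (hn : n ≠ 0) :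
    θ ^ n * volume.real E * volume.real U ≤ volume.real (U ∩ stageSet s θ γ E) + η := by
  rcases hθ.eq_or_lt with rfl | hθ
  · simp only [ne_eq, hn, not_false_eq_true, zero_pow, zero_mul]
    positivity
  have hr : 0 < θ * s := by positivity
  have hEf : volume E ≠ ∞ := ((measure_mono hE).trans_lt measure_ball_lt_top).ne
  have hK := measurableSet_rotatedCopy (θ * s) γ hEm
  have hKs : rotatedCopy (θ * s) γ E ⊆ cell n s :=
    rotatedCopy_subset_cell hr.le γ h0 hE (by nlinarith)
  have key := volume_mul_le_periodize hs hK hKs hU h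
  rw [volume_rotatedCopy hr γ hEm] at key
  have hPf : volume (U ∩ periodize s (rotatedCopy (θ * s) γ E)) ≠ ∞ :=
    ((measure_mono inter_subset_left).trans_lt hUf.lt_top).ne
  have key2 := ENNReal.toReal_mono (by finiteness) key
  rw [ENNReal.toReal_mul, ENNReal.toReal_mul, ENNReal.toReal_mul, ENNReal.toReal_add hPf (by finiteness),
    ENNReal.toReal_pow, ENNReal.toReal_pow, ENNReal.toReal_ofReal hr.le, ENNReal.toReal_ofReal hs.le,
    ENNReal.toReal_ofReal hη, mul_pow] at key2
  have hsn : 0 < s ^ n := by positivity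
  refine le_of_mul_le_mul_left ?_ hsn
  calc _ = (volume U).toReal * (θ ^ n * s ^ n * (volume E).toReal) := by
        simp only [Measure.real]; ring
    _ ≤ _ := key2

/-- Successive stages behave like independent events, uniformly in the rotation `γ`: if every scale
is small with respect to the preceding ones, the stages `M, …, M' - 1` leave uncovered at most the
proportion `exp (-∑ aᵢ)` of the unit cube, up to a small error, where `aᵢ` is the density of the
`i`-th stage. The second index of `E` allows for countably many choices of shapes that share the
scales. -/
theorem exists_scales_covering {n : ℕ} (hn : n ≠ 0) {θ ρ : ℕ → ℝ} {E : ℕ → ℕ → Set (RSpace n)}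
    (hθ : ∀ m, 0 ≤ θ m) (hEm : ∀ m l, MeasurableSet (E m l)) (h0 : ∀ m l, (0 : RSpace n) ∉ E m l)
    (hE : ∀ m l, E m l ⊆ Metric.ball 0 (ρ m)) (hρ : ∀ m, θ m * ρ m ≤ 1 / 2)
    {P : ℕ → ℝ → ℕ → ℝ → Prop} {P0 : ℕ → ℝ → Prop}
    (hP0 : ∀ m, ∀ᶠ s in 𝓝[>] 0, P0 m s)
    (hP : ∀ i m s, 0 < s → ∀ᶠ s' in 𝓝[>] 0, P i s m s') :
    ∃ s : ℕ → ℝ, (∀ m, 0 < s m) ∧ (∀ m, P0 m (s m)) ∧ (∀ m, ∀ i < m, P i (s i) m (s m)) ∧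
      ∀ (γ : RSpace n ≃ₗᵢ[ℝ] RSpace n) (l M M' : ℕ), l ≤ M → M ≤ M' →
        volume.real (unitCube n \ ⋃ i ∈ Ico M M', stageSet (s i) (θ i) γ (E i l)) ≤
          Real.exp (-∑ i ∈ Finset.Ico M M', θ i ^ n * volume.real (E i l)) + 4 * (1 / 2) ^ M := by
  set Q := unitCube n with hQ
  have hQm : MeasurableSet Q := measurableSet_unitCube n
  have hQ1 : volume Q = 1 := volume_unitCube n
  -- The uncovered set `U m` is the cube minus finitely many earlier stages. The conditions `C0`
  -- and `C` make it nearly invariant under translations by one period of the stage `m`.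
  let C0 : ℕ → ℝ → Prop := fun m s => ∀ t ∈ cell n s,
    volume {x | x ∈ Q ∧ x - t ∉ Q} ≤ ENNReal.ofReal ((1 / 2) ^ m)
  let C : ℕ → ℝ → ℕ → ℝ → Prop := fun i s m s' => ∀ l ∈ Finset.range (i + 1), ∀ t ∈ cell n s',
    ∀ γ : RSpace n ≃ₗᵢ[ℝ] RSpace n,
    volume {x | x ∈ Q ∧ x - t ∈ stageSet s (θ i) γ (E i l) ∧ x ∉ stageSet s (θ i) γ (E i l)} ≤
      ENNReal.ofReal ((1 / 4) ^ m)
  have hC0 : ∀ m, ∀ᶠ s in 𝓝[>] 0, C0 m s := by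
    intro m
    obtain ⟨δ, hδ, h⟩ := tendsto_measure_translate_diff hQm (by rw [hQ1]; simp)
      (ε := ENNReal.ofReal ((1 / 2) ^ m)) (by simp)
    exact eventually_forall_mem_cell hδ fun t ht => (h t ht).2
  have hC : ∀ i m s, 0 < s → ∀ᶠ s' in 𝓝[>] 0, C i s m s' := by
    intro i m s hs
    refine (Finset.eventually_all _).2 fun l _ => ?_
    obtain ⟨δ, hδ, h⟩ := exists_translate_periodize_rotatedCopy_le (r := θ i * s) (s := s)
      (mul_nonneg (hθ i) hs.le) hs (hEm i l) (h0 i l) (hE i l) (by nlinarith [hρ i])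
      (ε := ENNReal.ofReal ((1 / 4) ^ m)) (by simp)
    exact eventually_forall_mem_cell hδ h
  obtain ⟨s, hs, hs0, hs1⟩ := exists_seq_scales (fun m => (hP0 m).and (hC0 m))
    (fun i m s hs => (hP i m s hs).and (hC i m s hs))
  refine ⟨s, hs, fun m => (hs0 m).1, fun m i hi => (hs1 m i hi).1, fun γ l M M' hl hM => ?_⟩
  let A : ℕ → Set (RSpace n) := fun i => stageSet (s i) (θ i) γ (E i l)
  have hAm : ∀ i, MeasurableSet (A i) := fun i => measurableSet_stageSet _ _ _ (hEm i l)
  let U : ℕ → Set (RSpace n) := fun m => Q \ ⋃ i ∈ Ico M m, A i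
  have hUm : ∀ m, MeasurableSet (U m) := fun m =>
    hQm.diff (MeasurableSet.biUnion (to_countable _) fun i _ => hAm i)
  have hUf : ∀ m, volume (U m) ≠ ∞ := fun m =>
    ((measure_mono sdiff_subset).trans_lt (by rw [hQ1]; simp)).ne
  have hrec : ∀ m ≥ M, volume.real (U (m + 1)) ≤ volume.real (U m)
      - (θ m ^ n * volume.real (E m l)) * volume.real (U m) + 2 * (1 / 2) ^ m := by
    intro m hm
    have e : U (m + 1) = U m \ (U m ∩ A m) := by
      ext x
      simp only [U, Set.mem_sdiff, mem_iUnion, mem_Ico, mem_inter_iff, exists_prop, not_exists, not_and]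
      constructor
      · rintro ⟨h1, h2⟩
        exact ⟨⟨h1, fun i hi => h2 i ⟨hi.1, by omega⟩⟩, fun _ => h2 m ⟨hm, by omega⟩⟩
      · rintro ⟨⟨h1, h2⟩, h3⟩
        refine ⟨h1, fun i hi => ?_⟩
        rcases Nat.lt_succ_iff_lt_or_eq.1 hi.2 with h | rfl
        · exact h2 i ⟨hi.1, h⟩
        · exact h3 ⟨h1, h2⟩
    have h1 : ∀ t ∈ cell n (s m), volume {x | x ∈ U m ∧ x - t ∉ U m} ≤
        ENNReal.ofReal (2 * (1 / 2) ^ m) := by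
      intro t ht
      have hsub : {x | x ∈ U m ∧ x - t ∉ U m} ⊆ {x | x ∈ Q ∧ x - t ∉ Q} ∪
          ⋃ i ∈ Finset.Ico M m, {x | x ∈ Q ∧ x - t ∈ A i ∧ x ∉ A i} := by
        rintro x ⟨⟨hx, hx'⟩, hxt⟩
        by_cases hq : x - t ∈ Q
        · right
          have : x - t ∈ ⋃ i ∈ Ico M m, A i := by
            by_contra hcon
            exact hxt ⟨hq, hcon⟩
          simp only [mem_iUnion, exists_prop] at this hx' ⊢
          obtain ⟨i, hi, hi'⟩ := this
          exact ⟨i, by simpa using hi, hx, hi', fun hc => hx' ⟨i, hi, hc⟩⟩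
        · left; exact ⟨hx, hq⟩
      calc _ ≤ _ := measure_mono hsub
        _ ≤ volume {x | x ∈ Q ∧ x - t ∉ Q} +
            ∑ i ∈ Finset.Ico M m, volume {x | x ∈ Q ∧ x - t ∈ A i ∧ x ∉ A i} :=
          (measure_union_le _ _).trans (add_le_add_right (measure_biUnion_finset_le _ _) _)
        _ ≤ ENNReal.ofReal ((1 / 2) ^ m) + ∑ i ∈ Finset.Ico M m, ENNReal.ofReal ((1 / 4) ^ m) := by
          refine add_le_add ((hs0 m).2 t ht) (Finset.sum_le_sum fun i hi => ?_)
          rw [Finset.mem_Ico] at hi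
          exact (hs1 m i hi.2).2 l (by simp; omega) t ht γ
        _ ≤ ENNReal.ofReal (2 * (1 / 2) ^ m) := by
          rw [← ENNReal.ofReal_sum_of_nonneg (fun _ _ => by positivity),
            ← ENNReal.ofReal_add (by positivity) (Finset.sum_nonneg fun _ _ => by positivity)]
          refine ENNReal.ofReal_le_ofReal ?_
          rw [two_mul]
          gcongr
          rw [Finset.sum_const, Nat.card_Ico, nsmul_eq_mul]
          have h2 : ((m - M : ℕ) : ℝ) ≤ 2 ^ m := by
            exact_mod_cast (Nat.sub_le m M).trans Nat.lt_two_pow_self.le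
          calc ((m - M : ℕ) : ℝ) * (1 / 4) ^ m ≤ 2 ^ m * (1 / 4) ^ m := by gcongr
            _ = (1 / 2) ^ m := by rw [← mul_pow]; norm_num
    have h2 := mul_volume_le_inter_stageSet (hs m) (hθ m) (by positivity) γ (hEm m l) (h0 m l)
      (hE m l) (hρ m) (hUm m) (hUf m) h1 hn
    rw [e, measureReal_sdiff inter_subset_left ((hUm m).inter (hAm m)) (hUf m)]
    change _ ≤ volume.real (U m ∩ A m) + _ at h2
    linarith
  have := covering_recursion (v := fun m => volume.real (U m))
    (a := fun m => θ m ^ n * volume.real (E m l)) (ε := fun m => 2 * (1 / 2) ^ m) (M := M)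
    (by simp [U, Measure.real, hQ1]) (fun m => measureReal_nonneg)
    (fun m => mul_nonneg (pow_nonneg (hθ m) n) measureReal_nonneg) (fun m => by positivity) hrec M' hM
  refine this.trans (add_le_add_right ?_ _)
  rw [← Finset.mul_sum, geom_sum_Ico (by norm_num) hM]
  have : (0 : ℝ) ≤ (1 / 2) ^ M' := by positivity
  have e : ((1 / 2 : ℝ) ^ M' - (1 / 2) ^ M) / (1 / 2 - 1) = 2 * ((1 / 2) ^ M - (1 / 2) ^ M') := by ring
  rw [e]
  linarith

/-- The covering estimate turns divergence of `∑ aᵢ` into a Borel–Cantelli statement: almost every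
point of `Q` lies in infinitely many of the sets `A m`. -/
theorem ae_frequently_mem_of_covering {α : Type*} [MeasurableSpace α] {μ : Measure α} {Q : Set α}
    (hQ : μ Q ≠ ∞) {A : ℕ → Set α} {a : ℕ → ℝ} {l : ℕ}
    (h : ∀ M M', l ≤ M → M ≤ M' → μ.real (Q \ ⋃ i ∈ Ico M M', A i) ≤
      Real.exp (-∑ i ∈ Finset.Ico M M', a i) + 4 * (1 / 2) ^ M)
    (ha : ∀ M C, ∃ M' ≥ M, C ≤ ∑ i ∈ Finset.Ico M M', a i) :
    μ {x | x ∈ Q ∧ ¬ ∃ᶠ m in atTop, x ∈ A m} = 0 := by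
  have hsub : ∀ M M', {x | x ∈ Q ∧ ∀ m ≥ M, x ∉ A m} ⊆ Q \ ⋃ i ∈ Ico M M', A i := by
    rintro M M' x ⟨hx, hx'⟩
    refine ⟨hx, ?_⟩
    simp only [mem_iUnion, not_exists]
    exact fun i hi => hx' i hi.1
  have h1 : ∀ M ≥ l, μ.real {x | x ∈ Q ∧ ∀ m ≥ M, x ∉ A m} ≤ 4 * (1 / 2) ^ M := by
    intro M hM
    refine le_of_forall_pos_le_add fun ε hε => ?_
    obtain ⟨M', hM', hC⟩ := ha M (-Real.log ε)
    have h2 := measureReal_mono (hsub M M') ((measure_mono sdiff_subset).trans_lt hQ.lt_top).ne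
    have h3 : Real.exp (-∑ i ∈ Finset.Ico M M', a i) ≤ ε := by
      rw [← Real.le_log_iff_exp_le hε]; linarith
    linarith [h M M' hM hM']
  have h2 : ∀ M, μ {x | x ∈ Q ∧ ∀ m ≥ M, x ∉ A m} = 0 := by
    intro M
    have hf : ∀ M, μ {x | x ∈ Q ∧ ∀ m ≥ M, x ∉ A m} ≠ ∞ := fun M =>
      ((measure_mono fun x hx => hx.1).trans_lt hQ.lt_top).ne
    have hlim : Tendsto (fun N : ℕ => (4 : ℝ) * (1 / 2) ^ N) atTop (𝓝 0) := by
      simpa using (tendsto_pow_atTop_nhds_zero_of_lt_one (r := (1 / 2 : ℝ)) (by norm_num)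
        (by norm_num)).const_mul 4
    have h4 : μ.real {x | x ∈ Q ∧ ∀ m ≥ M, x ∉ A m} ≤ 0 := by
      refine ge_of_tendsto hlim ?_
      filter_upwards [eventually_ge_atTop (max l M)] with N hN
      refine (measureReal_mono ?_ (hf N)).trans (h1 N ((le_max_left _ _).trans hN))
      exact fun x hx => ⟨hx.1, fun m hm => hx.2 m (((le_max_right _ _).trans hN).trans hm)⟩
    exact (measureReal_eq_zero_iff (hf M)).1 (le_antisymm h4 measureReal_nonneg)
  refine measure_mono_null ?_ (measure_iUnion_null h2)
  rintro x ⟨hx, hx'⟩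
  rw [not_frequently, eventually_atTop] at hx'
  obtain ⟨M, hM⟩ := hx'
  exact mem_iUnion.2 ⟨M, hx, hM⟩

/-! ### The hyperbolic cross -/

/-- Upper half edge lengths of the interval with index `p`: `2 ^ (d pᵢ + 1)` in the first `k - 1`
directions and `2 ^ (K - ∑ pᵢ)` in the remaining `d = n - k + 1` ones. -/
def halfEdge (n k K : ℕ) (p : Fin n → ℕ) (i : Fin n) : ℝ :=
  if (i : ℕ) < k - 1 then 2 ^ ((n + 1 - k) * p i + 1) else 2 ^ (K - ∑ j, p j)

/-- The part of the centred interval with half edge lengths `halfEdge n k K p` where the first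
`k - 1` coordinates lie in the dyadic ranges `[2 ^ (d pᵢ), 2 ^ (d pᵢ + 1))` and the others are
nonnegative; for different admissible `p` these parts are disjoint. -/
def crossBox (n k K : ℕ) (p : Fin n → ℕ) : Set (RSpace n) :=
  {x | ∀ i : Fin n, x i ∈ if (i : ℕ) < k - 1 then Ico (2 ^ ((n + 1 - k) * p i) : ℝ) (2 ^ ((n + 1 - k) * p i + 1))
    else Ico (0 : ℝ) (2 ^ (K - ∑ j, p j))}

/-- The admissible indices: `pᵢ ≤ K / k` for the first `k - 1` directions, which keeps `∑ pᵢ ≤ K`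
(so the truncated subtraction `K - ∑ pᵢ` is a true one), and `pᵢ = 0` for the others. -/
def crossIndex (n k K : ℕ) : Finset (Fin n → ℕ) :=
  Fintype.piFinset fun i : Fin n => if (i : ℕ) < k - 1 then Finset.range (K / k + 1) else {0}

/-- A part of the hyperbolic cross: the points that lie, together with the unit ball, in an interval
with at most `k` different edge lengths and of measure about `2 ^ (d K)`, where `d = n - k + 1`. -/
def hyperbolicCross (n k K : ℕ) : Set (RSpace n) := ⋃ p ∈ crossIndex n k K, crossBox n k K p

/-- The radius of a ball that contains `hyperbolicCross n k K`. -/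
def crossRadius (n k K : ℕ) : ℝ := (n + 1) * (2 * (2 * 2 ^ ((n + 1 - k) * K + 1)))

section HyperbolicCross

variable {n k K : ℕ}

theorem card_free (hkn : k ≤ n) : (Finset.univ.filter fun i : Fin n => (i : ℕ) < k - 1).card = k - 1 := by
  rw [Fin.card_filter_val_lt]
  omega

theorem card_crossIndex (hkn : k ≤ n) : (crossIndex n k K).card = (K / k + 1) ^ (k - 1) := by
  rw [crossIndex, Fintype.card_piFinset]
  have : ∀ i : Fin n, (if (i : ℕ) < k - 1 then Finset.range (K / k + 1) else {0}).card =
      if (i : ℕ) < k - 1 then K / k + 1 else 1 := by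
    intro i; split_ifs <;> simp
  simp_rw [this]
  rw [Finset.prod_ite, Finset.prod_const, card_free hkn]
  simp

theorem crossIndex_apply_eq_zero {p : Fin n → ℕ} (hp : p ∈ crossIndex n k K) {i : Fin n}
    (hi : ¬ (i : ℕ) < k - 1) : p i = 0 := by
  have := Fintype.mem_piFinset.1 hp i
  simpa [hi] using this

theorem crossIndex_sum_eq {p : Fin n → ℕ} (hp : p ∈ crossIndex n k K) :
    ∑ j, p j = ∑ j ∈ Finset.univ.filter fun i : Fin n => (i : ℕ) < k - 1, p j := by
  symm
  refine Finset.sum_subset (Finset.subset_univ _) fun i _ hi => crossIndex_apply_eq_zero hp ?_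
  simpa using hi

theorem crossIndex_sum_le (hkn : k ≤ n) {p : Fin n → ℕ} (hp : p ∈ crossIndex n k K) :
    ∑ j, p j ≤ K := by
  rw [crossIndex_sum_eq hp]
  calc _ ≤ ∑ _j ∈ Finset.univ.filter fun i : Fin n => (i : ℕ) < k - 1, K / k := by
        refine Finset.sum_le_sum fun i hi => ?_
        have := Fintype.mem_piFinset.1 hp i
        simp only [Finset.mem_filter, Finset.mem_univ, true_and] at hi
        simp only [hi, if_true, Finset.mem_range] at this
        omega
    _ = (k - 1) * (K / k) := by rw [Finset.sum_const, card_free hkn, smul_eq_mul]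
    _ ≤ k * (K / k) := Nat.mul_le_mul_right _ (Nat.sub_le _ _)
    _ ≤ K := Nat.mul_div_le K k

theorem prod_free_mul_prod_rest (hk : 2 ≤ k) (hkn : k ≤ n) {p : Fin n → ℕ}
    (hp : p ∈ crossIndex n k K) :
    (∏ i : Fin n, if (i : ℕ) < k - 1 then (2 : ℝ) ^ ((n + 1 - k) * p i) else 2 ^ (K - ∑ j, p j)) =
      2 ^ ((n + 1 - k) * K) := by
  rw [Finset.prod_ite, Finset.prod_const, Finset.prod_pow_eq_pow_sum, ← Finset.mul_sum,
    ← crossIndex_sum_eq hp]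
  have hc : (Finset.univ.filter fun i : Fin n => ¬ (i : ℕ) < k - 1).card = n + 1 - k := by
    rw [Finset.filter_not, Finset.card_sdiff_of_subset (Finset.filter_subset _ _), card_free hkn]
    simp
    omega
  rw [hc, ← pow_mul, ← pow_add, mul_comm (K - _), ← mul_add, Nat.add_sub_cancel' (crossIndex_sum_le hkn hp)]

theorem prod_halfEdge (hk : 2 ≤ k) (hkn : k ≤ n) {p : Fin n → ℕ} (hp : p ∈ crossIndex n k K) :
    ∏ i, halfEdge n k K p i = 2 ^ (k - 1) * 2 ^ ((n + 1 - k) * K) := by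
  rw [← prod_free_mul_prod_rest hk hkn hp]
  have : ∀ i, halfEdge n k K p i = (if (i : ℕ) < k - 1 then 2 else 1) *
      if (i : ℕ) < k - 1 then (2 : ℝ) ^ ((n + 1 - k) * p i) else 2 ^ (K - ∑ j, p j) := by
    intro i; unfold halfEdge; split_ifs
    · rw [pow_succ, mul_comm]
    · simp
  simp_rw [this]
  rw [Finset.prod_mul_distrib]
  congr 1
  rw [Finset.prod_ite, Finset.prod_const, card_free hkn]
  simp

theorem volume_crossBox (hk : 2 ≤ k) (hkn : k ≤ n) {p : Fin n → ℕ} (hp : p ∈ crossIndex n k K) :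
    volume (crossBox n k K p) = ENNReal.ofReal (2 ^ ((n + 1 - k) * K)) := by
  rw [crossBox, volume_coordBox, ← prod_free_mul_prod_rest hk hkn hp,
    ENNReal.ofReal_prod_of_nonneg fun i _ => by split_ifs <;> positivity]
  refine Finset.prod_congr rfl fun i _ => ?_
  split_ifs
  · rw [Real.volume_Ico, pow_succ]; congr 1; ring
  · simp

theorem measurableSet_crossBox (p : Fin n → ℕ) : MeasurableSet (crossBox n k K p) := by
  rw [crossBox, ofPred_forall]
  refine MeasurableSet.iInter fun i => ?_
  have hm : Measurable fun x : RSpace n => x i := by fun_prop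
  split_ifs
  · exact hm measurableSet_Ico
  · exact hm measurableSet_Ico

theorem disjoint_crossBox (hkn : k ≤ n) {p q : Fin n → ℕ} (hp : p ∈ crossIndex n k K)
    (hq : q ∈ crossIndex n k K) (hpq : p ≠ q) : Disjoint (crossBox n k K p) (crossBox n k K q) := by
  obtain ⟨i, hi⟩ := Function.ne_iff.1 hpq
  have hik : (i : ℕ) < k - 1 := by
    by_contra h
    exact hi ((crossIndex_apply_eq_zero hp h).trans (crossIndex_apply_eq_zero hq h).symm)
  have hd : 1 ≤ n + 1 - k := by omega
  refine Set.disjoint_left.2 fun x hx hx' => ?_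
  have h1 := hx i
  have h2 := hx' i
  simp only [hik, if_true] at h1 h2
  have key : ∀ a b : ℕ, a < b → x i < 2 ^ ((n + 1 - k) * a + 1) → 2 ^ ((n + 1 - k) * b) ≤ x i → False := by
    intro a b hab h3 h4
    have : (2 : ℝ) ^ ((n + 1 - k) * a + 1) ≤ 2 ^ ((n + 1 - k) * b) := by
      refine pow_le_pow_right₀ one_le_two ?_
      calc (n + 1 - k) * a + 1 ≤ (n + 1 - k) * a + (n + 1 - k) := by omega
        _ = (n + 1 - k) * (a + 1) := by ring
        _ ≤ _ := Nat.mul_le_mul_left _ hab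
    linarith
  rcases lt_or_gt_of_ne hi with h | h
  · exact key _ _ h h1.2 h2.1
  · exact key _ _ h h2.2 h1.1

theorem measurableSet_hyperbolicCross : MeasurableSet (hyperbolicCross n k K) :=
  Finset.measurableSet_biUnion _ fun p _ => measurableSet_crossBox p

/-- The cross is larger than a single interval by the factor `K ^ (k - 1)`, up to a constant: this
is where the exponent of the logarithm comes from. -/
theorem volume_hyperbolicCross (hk : 2 ≤ k) (hkn : k ≤ n) :
    volume.real (hyperbolicCross n k K) = ((K / k + 1 : ℕ) : ℝ) ^ (k - 1) * 2 ^ ((n + 1 - k) * K) := by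
  have : volume (hyperbolicCross n k K) =
      ENNReal.ofReal (((K / k + 1 : ℕ) : ℝ) ^ (k - 1) * 2 ^ ((n + 1 - k) * K)) := by
    rw [hyperbolicCross, measure_biUnion_finset (fun p hp q hq hpq => disjoint_crossBox hkn hp hq hpq)
      fun p _ => measurableSet_crossBox p, Finset.sum_congr rfl fun p hp => volume_crossBox hk hkn hp,
      Finset.sum_const, card_crossIndex hkn, nsmul_eq_mul, ENNReal.ofReal_mul (by positivity)]
    congr 1
    rw [← Nat.cast_pow, ENNReal.ofReal_natCast]
  rw [Measure.real, this, ENNReal.toReal_ofReal (by positivity)]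

theorem zero_notMem_hyperbolicCross (hk : 2 ≤ k) (hkn : k ≤ n) :
    (0 : RSpace n) ∉ hyperbolicCross n k K := by
  simp only [hyperbolicCross, mem_iUnion, not_exists]
  intro p _ h
  have h1 := h ⟨0, by omega⟩
  have : (0 : ℕ) < k - 1 := by omega
  simp only [this, if_true, PiLp.zero_apply, mem_Ico] at h1
  exact absurd h1.1 (not_le.2 (by positivity))

theorem one_le_halfEdge (p : Fin n → ℕ) (i : Fin n) : 1 ≤ halfEdge n k K p i := by
  unfold halfEdge; split_ifs <;> exact one_le_pow₀ one_le_two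

theorem halfEdge_le (hkn : k ≤ n) {p : Fin n → ℕ} (hp : p ∈ crossIndex n k K) (i : Fin n) :
    halfEdge n k K p i ≤ 2 ^ ((n + 1 - k) * K + 1) := by
  have hd : 1 ≤ n + 1 - k := by omega
  unfold halfEdge
  split_ifs
  · refine pow_le_pow_right₀ one_le_two ?_
    have : p i ≤ K := (Finset.single_le_sum (fun _ _ => Nat.zero_le _) (Finset.mem_univ i)).trans
      (crossIndex_sum_le hkn hp)
    gcongr
  · refine pow_le_pow_right₀ one_le_two ?_
    nlinarith [Nat.sub_le K (∑ j, p j)]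

theorem crossBox_subset (p : Fin n → ℕ) :
    crossBox n k K p ⊆ {x | ∀ i, x i ∈ Ioo (-halfEdge n k K p i) (halfEdge n k K p i)} := by
  intro x hx i
  have h := hx i
  have h1 := one_le_halfEdge (k := k) (K := K) p i
  unfold halfEdge at h1 ⊢
  split_ifs at h h1 ⊢
  · refine ⟨?_, h.2⟩
    have : (0 : ℝ) < 2 ^ ((n + 1 - k) * p i) := by positivity
    linarith [h.1]
  · exact ⟨by linarith [h.1], h.2⟩

theorem hull_subset_ball (hkn : k ≤ n) {p : Fin n → ℕ} (hp : p ∈ crossIndex n k K) :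
    {x : RSpace n | ∀ i, x i ∈ Ioo (-halfEdge n k K p i) (halfEdge n k K p i)} ⊆
      Metric.ball 0 (crossRadius n k K) := by
  intro x hx
  have hc : x ∈ cell n (2 * (2 * 2 ^ ((n + 1 - k) * K + 1))) := by
    intro i
    have h1 := hx i
    have h2 := halfEdge_le hkn hp i
    have : (0 : ℝ) < 2 ^ ((n + 1 - k) * K + 1) := by positivity
    constructor <;> linarith [h1.1, h1.2]
  have := norm_le_of_mem_cell (by positivity) hc
  rw [mem_ball_zero_iff, crossRadius, add_mul]
  have : (0 : ℝ) < 2 ^ ((n + 1 - k) * K + 1) := by positivity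
  linarith

theorem hyperbolicCross_subset_ball (hkn : k ≤ n) :
    hyperbolicCross n k K ⊆ Metric.ball 0 (crossRadius n k K) :=
  iUnion₂_subset fun p hp => (crossBox_subset p).trans (hull_subset_ball hkn hp)

theorem crossRadius_mono {K K' : ℕ} (h : K ≤ K') : crossRadius n k K ≤ crossRadius n k K' := by
  unfold crossRadius
  gcongr
  · exact one_le_two

theorem one_le_crossRadius : 1 ≤ crossRadius n k K := by
  unfold crossRadius
  have h1 : (1 : ℝ) ≤ 2 ^ ((n + 1 - k) * K + 1) := one_le_pow₀ one_le_two
  have h2 : (0 : ℝ) ≤ n := n.cast_nonneg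
  nlinarith

theorem crossRadius_pos : 0 < crossRadius n k K := by
  unfold crossRadius; positivity

theorem ball_subset_hull (p : Fin n → ℕ) :
    Metric.ball 0 1 ⊆ {x : RSpace n | ∀ i, x i ∈ Ioo (-halfEdge n k K p i) (halfEdge n k K p i)} := by
  intro x hx i
  rw [mem_ball_zero_iff] at hx
  have h := PiLp.norm_apply_le x i
  rw [Real.norm_eq_abs] at h
  have h2 := abs_lt.1 (h.trans_lt hx)
  have h1 := one_le_halfEdge (k := k) (K := K) p i
  exact ⟨by linarith, by linarith⟩

theorem measurableSet_hull (p : Fin n → ℕ) :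
    MeasurableSet {x : RSpace n | ∀ i, x i ∈ Ioo (-halfEdge n k K p i) (halfEdge n k K p i)} := by
  rw [ofPred_forall]
  exact MeasurableSet.iInter fun i =>
    (by fun_prop : Measurable fun x : RSpace n => x i) measurableSet_Ioo

theorem volume_hull (hk : 2 ≤ k) (hkn : k ≤ n) {p : Fin n → ℕ} (hp : p ∈ crossIndex n k K) :
    volume {x : RSpace n | ∀ i, x i ∈ Ioo (-halfEdge n k K p i) (halfEdge n k K p i)} =
      ENNReal.ofReal (2 ^ (n + (k - 1)) * 2 ^ ((n + 1 - k) * K)) := by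
  rw [volume_coordBox]
  simp_rw [Real.volume_Ioo]
  rw [← ENNReal.ofReal_prod_of_nonneg fun i _ => by linarith [one_le_halfEdge (k := k) (K := K) p i]]
  congr 1
  have : ∀ i, halfEdge n k K p i - -halfEdge n k K p i = 2 * halfEdge n k K p i := fun i => by ring
  simp_rw [this]
  rw [Finset.prod_mul_distrib, prod_halfEdge hk hkn hp, pow_add]
  simp [mul_assoc]

theorem ncard_range_edges (hk : 2 ≤ k) (hkn : k ≤ n) (p : Fin n → ℕ) (F : ℝ → ℝ) :
    (range fun i => F (halfEdge n k K p i)).ncard ≤ k := by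
  classical
  let T : Finset ℝ := insert (F (2 ^ (K - ∑ j, p j)))
    ((Finset.univ.filter fun i : Fin n => (i : ℕ) < k - 1).image fun i => F (halfEdge n k K p i))
  have hsub : (range fun i => F (halfEdge n k K p i)) ⊆ (T : Set ℝ) := by
    rintro _ ⟨i, rfl⟩
    simp only [T, Finset.coe_insert, Finset.coe_image, Finset.coe_filter, Finset.mem_univ, true_and]
    by_cases hi : (i : ℕ) < k - 1
    · right; exact ⟨i, hi, rfl⟩
    · left; simp [halfEdge, hi]
  calc _ ≤ (T : Set ℝ).ncard := ncard_le_ncard hsub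
    _ = T.card := ncard_coe_finset T
    _ ≤ (k - 1) + 1 := (Finset.card_insert_le _ _).trans
        (Nat.add_le_add_right (Finset.card_image_le.trans (card_free hkn).le) 1)
    _ = k := by omega

/-- Every point of a stage lies in a small rotated interval that contains one of the balls of
radius `θ s` about the lattice points, and is not much larger than it. -/
theorem exists_rotated_interval (hk : 2 ≤ k) (hkn : k ≤ n) {s θ : ℝ} (hs : 0 < s) (hθ : 0 ≤ θ)
    (hρ : θ * crossRadius n k K ≤ 1 / 2) (γ : RSpace n ≃ₗᵢ[ℝ] RSpace n) {x : RSpace n}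
    (hx : x ∈ stageSet s θ γ (hyperbolicCross n k K)) :
    0 < θ ∧ ∃ z, ∃ S ∈ rotate (intervalBasis n k) γ x,
      Metric.ball (latticePoint s z) (θ * s) ⊆ S ∧ S ⊆ Metric.ball x s ∧ MeasurableSet S ∧
      volume S = ENNReal.ofReal (θ * s) ^ n *
        ENNReal.ofReal (2 ^ (n + (k - 1)) * 2 ^ ((n + 1 - k) * K)) := by
  rcases hθ.eq_or_lt with rfl | hθ
  · -- A stage with `θ = 0` is empty, because the cross does not contain the origin.
    exfalso
    obtain ⟨z, hz⟩ := hx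
    rw [zero_mul, rotatedCopy_zero γ (zero_notMem_hyperbolicCross hk hkn)] at hz
    exact hz
  refine ⟨hθ, ?_⟩
  obtain ⟨z, hz⟩ := hx
  set r := θ * s with hrdef
  have hr : 0 < r := by positivity
  set c : RSpace n := latticePoint s z
  set e := γ.symm (r⁻¹ • (x - c)) with he
  have hz' : e ∈ hyperbolicCross n k K := hz
  simp only [hyperbolicCross, mem_iUnion, exists_prop] at hz'
  obtain ⟨p, hp, hep⟩ := hz'
  set H : Set (RSpace n) := {x | ∀ i, x i ∈ Ioo (-halfEdge n k K p i) (halfEdge n k K p i)} with hH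
  have heH : e ∈ H := crossBox_subset p hep
  have hHm : MeasurableSet H := measurableSet_hull p
  -- `S = c + r γ(H)`. In the coordinates of the basis at `x` it is the rotation about `x` of the
  -- interval `x - r e + r H`, which contains `x` since `e ∈ H`.
  let S : Set (RSpace n) := (fun y => y - c) ⁻¹' rotatedCopy r γ H
  have hSc : ∀ y ∈ S, dist y c < s / 2 := by
    intro y hy
    have h1 : ‖γ.symm (r⁻¹ • (y - c))‖ < crossRadius n k K := by
      simpa using hull_subset_ball hkn hp hy
    rw [LinearIsometryEquiv.norm_map, norm_smul, norm_inv, Real.norm_of_nonneg hr.le,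
      inv_mul_lt_iff₀ hr] at h1
    rw [dist_eq_norm]
    nlinarith
  have hxS : x ∈ S := heH
  refine ⟨z, S, ⟨{y | ∀ i, y i ∈ Ioo (x i - r * e i - r * halfEdge n k K p i)
    (x i - r * e i + r * halfEdge n k K p i)}, ⟨?_, _, _, fun i => ?_, ?_, rfl⟩, ?_⟩, ?_, ?_, ?_, ?_⟩
  · intro i
    have := heH i
    constructor <;> nlinarith [this.1, this.2]
  · have := one_le_halfEdge (k := k) (K := K) p i
    nlinarith
  · have h1 := ncard_range_edges (K := K) hk hkn p fun h => 2 * r * h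
    convert h1 using 5 with i
    ring
  · ext w
    have hw : ∀ y : RSpace n, (∀ i, y i ∈ Ioo (x i - r * e i - r * halfEdge n k K p i)
        (x i - r * e i + r * halfEdge n k K p i)) ↔ r⁻¹ • (y - x) + e ∈ H := by
      intro y
      refine forall_congr' fun i => ?_
      simp only [PiLp.add_apply, PiLp.smul_apply, PiLp.sub_apply, smul_eq_mul, mem_Ioo]
      have e1 : y i = x i + r * (r⁻¹ * (y i - x i)) := by field_simp; ring
      constructor
      · rintro ⟨h1, h2⟩
        constructor <;> refine lt_of_mul_lt_mul_left ?_ hr.le <;> nlinarith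
      · rintro ⟨h1, h2⟩
        constructor <;> nlinarith
    have hS : w ∈ S ↔ r⁻¹ • γ.symm (w - x) + e ∈ H := by
      change γ.symm (r⁻¹ • (w - c)) ∈ H ↔ _
      rw [he, ← map_smul, ← map_add, ← smul_add, sub_add_sub_cancel]
    rw [hS]
    constructor
    · intro h
      refine ⟨x + γ.symm (w - x), (hw _).2 ?_, by simp⟩
      simpa using h
    · rintro ⟨y, hy, rfl⟩
      simpa using (hw y).1 hy
  · intro y hy
    refine ball_subset_hull p ?_
    rw [Metric.mem_ball, dist_eq_norm] at hy
    rw [mem_ball_zero_iff, LinearIsometryEquiv.norm_map, norm_smul, norm_inv,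
      Real.norm_of_nonneg hr.le, inv_mul_lt_iff₀ hr, mul_one]
    exact hy
  · intro y hy
    have := dist_triangle_right y x c
    rw [Metric.mem_ball]
    linarith [hSc y hy, hSc x hxS]
  · exact (measurable_sub_const c) (measurableSet_rotatedCopy r γ hHm)
  · rw [(measurePreserving_sub_right volume c).measure_preimage
      (measurableSet_rotatedCopy r γ hHm).nullMeasurableSet, volume_rotatedCopy hr γ hHm,
      volume_hull hk hkn hp]

end HyperbolicCross

/-! ### Measure-preserving rearrangements -/

/-- A finite atomless measure `ν` on the line is the image of Lebesgue measure on `(0, ν(ℝ))` under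
the quantile function, which is injective. -/
theorem exists_quantile_real (ν : Measure ℝ) [IsFiniteMeasure ν] [NullSingletonClass ν] :
    ∃ q F : ℝ → ℝ, Measurable q ∧ Measurable F ∧ (∀ u ∈ Ioo 0 (ν.real univ), F (q u) = u) ∧
      (volume.restrict (Ioo 0 (ν.real univ))).map q = ν := by
  set a := ν.real univ with ha
  set c : ℝ → ℝ := fun t => ν.real (Iic t) with hc
  have hmono : Monotone c := fun s t h => measureReal_mono (Iic_subset_Iic.2 h)
  have hca : ∀ t, c t ≤ a := fun t => measureReal_mono (subset_univ _)
  have hcont : Continuous c := by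
    have h1 : Continuous fun t => ∫ _x in (0 : ℝ)..t, (1 : ℝ) ∂ν :=
      (integrable_const 1).continuous_primitive 0
    have h2 : c = fun t => c 0 + ∫ _x in (0 : ℝ)..t, (1 : ℝ) ∂ν := by
      ext t
      rw [← intervalIntegral.integral_Iic_sub_Iic (integrable_const _).integrableOn
        (integrable_const _).integrableOn]
      simp [hc]
    rw [h2]
    exact continuous_const.add h1
  have htop : Tendsto c atTop (𝓝 a) :=
    (ENNReal.tendsto_toReal (measure_ne_top ν univ)).comp (tendsto_measure_Iic_atTop ν)
  have hbot : Tendsto c atBot (𝓝 0) := by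
    have h1 : Tendsto (fun t => ν.real (Ici t)) atBot (𝓝 a) :=
      (ENNReal.tendsto_toReal (measure_ne_top ν univ)).comp (tendsto_measure_Ici_atBot ν)
    have h2 : c = fun t => a - ν.real (Ici t) := by
      ext t
      have e : ν.real (Iic t) = ν.real (Iio t) := measureReal_congr Iio_ae_eq_Iic.symm
      rw [hc]
      simp only
      rw [e, ← compl_Ici, measureReal_compl measurableSet_Ici]
    rw [h2]
    simpa using h1.const_sub a
  have hex : ∀ u, ∃ t, u ∈ Ioo 0 a → c t = u := by
    intro u
    by_cases hu : u ∈ Ioo 0 a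
    · obtain ⟨t1, ht1⟩ := (hbot.eventually (gt_mem_nhds hu.1)).exists
      obtain ⟨t2, ht2⟩ := (htop.eventually (lt_mem_nhds hu.2)).exists
      obtain ⟨t, ht⟩ := mem_range_of_exists_le_of_exists_ge hcont ⟨t1, ht1.le⟩ ⟨t2, ht2.le⟩
      exact ⟨t, fun _ => ht⟩
    · exact ⟨0, fun h => absurd h hu⟩
  choose q0 hq0 using hex
  classical
  let q : ℝ → ℝ := (Ioo 0 a).piecewise q0 0
  have hq : ∀ u ∈ Ioo 0 a, q u = q0 u := fun u hu => piecewise_eq_of_mem _ _ _ hu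
  have hle : ∀ u ∈ Ioo 0 a, ∀ t, u < c t → q u ≤ t := by
    intro u hu t ht
    rw [hq u hu]
    by_contra! h
    have := hmono h.le
    rw [hq0 u hu] at this
    linarith
  have hle' : ∀ u ∈ Ioo 0 a, ∀ t, q u ≤ t → u ≤ c t := by
    intro u hu t ht
    have := hmono ht
    rwa [hq u hu, hq0 u hu] at this
  have hqm : Measurable q := by
    refine measurable_of_Iic fun t => ?_
    have e : q ⁻¹' Iic t = (Ioo 0 a ∩ q ⁻¹' Iic t) ∪ ((Ioo 0 a)ᶜ ∩ {_u | (0 : ℝ) ≤ t}) := by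
      ext u
      by_cases hu : u ∈ Ioo 0 a
      · simp only [mem_union, mem_inter_iff, hu, true_and, mem_compl_iff, not_true, false_and, or_false]
      · have : q u = 0 := piecewise_eq_of_notMem _ _ _ hu
        simp only [mem_preimage, this, mem_Iic, mem_union, mem_inter_iff, hu, false_and,
          mem_compl_iff, not_false_eq_true, true_and, false_or]
        rfl
    rw [e]
    refine MeasurableSet.union (OrdConnected.measurableSet ?_)
      (measurableSet_Ioo.compl.inter (MeasurableSet.const _))
    refine ⟨fun x hx y hy z hz => ?_⟩
    have hz' : z ∈ Ioo 0 a := ⟨hx.1.1.trans_le hz.1, hz.2.trans_lt hy.1.2⟩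
    refine ⟨hz', ?_⟩
    rcases hz.2.eq_or_lt with rfl | h
    · exact hy.2
    · exact hle z hz' t (h.trans_le (hle' y hy.1 t hy.2))
  refine ⟨q, c, hqm, hmono.measurable, fun u hu => by rw [hq u hu, hq0 u hu], ?_⟩
  refine Measure.ext_of_Iic _ _ fun t => ?_
  rw [Measure.map_apply hqm measurableSet_Iic, Measure.restrict_apply (hqm measurableSet_Iic)]
  have h1 : Ioo 0 (c t) ⊆ q ⁻¹' Iic t ∩ Ioo 0 a := fun u hu =>
    ⟨hle u ⟨hu.1, hu.2.trans_le (hca t)⟩ t hu.2, hu.1, hu.2.trans_le (hca t)⟩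
  have h2 : q ⁻¹' Iic t ∩ Ioo 0 a ⊆ Ioc 0 (c t) := fun u hu => ⟨hu.2.1, hle' u hu.2 t hu.1⟩
  have h3 : ν (Iic t) = ENNReal.ofReal (c t) := (ofReal_measureReal).symm
  rw [h3]
  refine le_antisymm ((measure_mono h2).trans (by simp)) (le_trans (by simp) (measure_mono h1))

section StandardBorel

variable {α : Type*} [MeasurableSpace α] [StandardBorelSpace α] {μ : Measure α}

/-- The quantile function of a set of finite measure in an atomless standard Borel space, obtained
by transport along a Borel isomorphism with the line. -/
theorem exists_quantile (hα : ¬ Countable α) [NullSingletonClass μ] {A : Set α} (hA : μ A ≠ ∞) :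
    ∃ (q : ℝ → α) (F : α → ℝ), Measurable q ∧ Measurable F ∧
      (∀ u ∈ Ioo 0 (μ.real A), F (q u) = u) ∧
      (volume.restrict (Ioo 0 (μ.real A))).map q = μ.restrict A := by
  let e : α ≃ᵐ ℝ := PolishSpace.measurableEquivOfNotCountable hα (not_countable)
  have : IsFiniteMeasure (μ.restrict A) := ⟨by simpa using hA.lt_top⟩
  have : NullSingletonClass ((μ.restrict A).map e) := by
    refine ⟨fun x => ?_⟩
    rw [e.map_apply, ← e.image_symm, image_singleton, measure_singleton]
  obtain ⟨q, F, hq, hF, hFq, hmap⟩ := exists_quantile_real ((μ.restrict A).map e)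
  have ha : ((μ.restrict A).map e).real univ = μ.real A := by
    rw [Measure.real, e.map_apply]; simp [Measure.real]
  rw [ha] at hFq hmap
  refine ⟨e.symm ∘ q, F ∘ e, e.symm.measurable.comp hq, hF.comp e.measurable, fun u hu => ?_, ?_⟩
  · simpa using hFq u hu
  · rw [← Measure.map_map e.symm.measurable hq, hmap, e.map_symm_map]

/-- A set can be mapped injectively and measure-preservingly, off a null set, into any set of
larger finite measure. -/
theorem exists_injOn_measurePreserving (hα : ¬ Countable α) [NullSingletonClass μ] {A B : Set α}
    (hA : MeasurableSet A) (hB : MeasurableSet B) (hBf : μ B ≠ ∞) (hAB : μ A ≤ μ B) :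
    ∃ (φ : α → α) (A0 : Set α), Measurable φ ∧ MeasurableSet A0 ∧ A0 ⊆ A ∧ μ (A \ A0) = 0 ∧
      InjOn φ A0 ∧ MapsTo φ A0 B ∧ ∀ S, MeasurableSet S → μ (A0 ∩ φ ⁻¹' S) = μ (φ '' A0 ∩ S) := by
  have hAf : μ A ≠ ∞ := (hAB.trans_lt hBf.lt_top).ne
  obtain ⟨q, F, hq, hF, hFq, hmap⟩ := exists_quantile (μ := μ) hα hAf
  obtain ⟨q', F', hq', hF', hFq', hmap'⟩ := exists_quantile (μ := μ) hα hBf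
  have hab : μ.real A ≤ μ.real B := ENNReal.toReal_mono hBf hAB
  set a := μ.real A
  set b := μ.real B
  have hI : Ioo 0 a ⊆ Ioo 0 b := Ioo_subset_Ioo_right hab
  have hinj : InjOn q (Ioo 0 a) := fun u hu v hv h => by rw [← hFq u hu, ← hFq v hv, h]
  have hinj' : InjOn q' (Ioo 0 b) := fun u hu v hv h => by rw [← hFq' u hu, ← hFq' v hv, h]
  -- Match the quantiles of `A` with those of `B`.
  let φ := q' ∘ F
  have hφ : Measurable φ := hq'.comp hF
  have hφq : ∀ u ∈ Ioo 0 a, φ (q u) = q' u := fun u hu => by simp [φ, hFq u hu]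
  have hqI : MeasurableSet (q '' Ioo 0 a) := measurableSet_Ioo.image_of_measurable_injOn hq hinj
  have hmA : ∀ S, MeasurableSet S → μ (A ∩ S) = volume (Ioo 0 a ∩ q ⁻¹' S) := by
    intro S hS
    rw [inter_comm, ← Measure.restrict_apply hS, ← hmap, Measure.map_apply hq hS,
      Measure.restrict_apply (hq hS), inter_comm]
  have hmB : ∀ S, MeasurableSet S → μ (B ∩ S) = volume (Ioo 0 b ∩ q' ⁻¹' S) := by
    intro S hS
    rw [inter_comm, ← Measure.restrict_apply hS, ← hmap', Measure.map_apply hq' hS,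
      Measure.restrict_apply (hq' hS), inter_comm]
  have hBn : volume (Ioo 0 b ∩ q' ⁻¹' Bᶜ) = 0 := by rw [← hmB _ hB.compl]; simp
  let A0 : Set α := A ∩ (q '' Ioo 0 a ∩ φ ⁻¹' B)
  have hA0 : MeasurableSet A0 := hA.inter (hqI.inter (hφ hB))
  have hA0φ : InjOn φ A0 := by
    rintro _ ⟨-, ⟨u, hu, rfl⟩, -⟩ _ ⟨-, ⟨v, hv, rfl⟩, -⟩ h
    rw [hφq u hu, hφq v hv] at h
    rw [hinj' (hI hu) (hI hv) h]
  have hnull : μ (A \ A0) = 0 := by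
    have e : A \ A0 = A ∩ (q '' Ioo 0 a ∩ φ ⁻¹' B)ᶜ := by
      ext x; simp only [A0, Set.mem_sdiff, mem_inter_iff, mem_compl_iff]; tauto
    rw [e, hmA _ (hqI.inter (hφ hB)).compl]
    refine measure_mono_null ?_ hBn
    rintro u ⟨hu, hu'⟩
    refine ⟨hI hu, fun h => hu' ⟨mem_image_of_mem q hu, ?_⟩⟩
    rwa [mem_preimage, hφq u hu]
  refine ⟨φ, A0, hφ, hA0, inter_subset_left, hnull, hA0φ, fun x hx => hx.2.2, fun S hS => ?_⟩
  have hD : MeasurableSet (φ '' A0) := hA0.image_of_measurable_injOn hφ hA0φ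
  have hsub : φ '' A0 ⊆ B := by rintro _ ⟨x, hx, rfl⟩; exact hx.2.2
  have e1 : φ '' A0 ∩ S = B ∩ (φ '' A0 ∩ S) := by
    rw [← inter_assoc, inter_eq_right.2 hsub]
  have e2 : A0 ∩ φ ⁻¹' S = A ∩ (A0 ∩ φ ⁻¹' S) := by
    rw [← inter_assoc, inter_eq_right.2 (inter_subset_left : A0 ⊆ A)]
  rw [e1, e2, hmA _ (hA0.inter (hφ hS)), hmB _ (hD.inter hS)]
  congr 1
  ext u
  constructor
  · rintro ⟨hu, hu1, hu2⟩
    rw [mem_preimage, hφq u hu] at hu2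
    exact ⟨hI hu, ⟨q u, hu1, hφq u hu⟩, hu2⟩
  · rintro ⟨hu, ⟨x, hx, hxu⟩, hu2⟩
    obtain ⟨v, hv, rfl⟩ := hx.2.1
    rw [hφq v hv] at hxu
    obtain rfl := hinj' (hI hv) hu hxu
    exact ⟨hv, hx, by rw [mem_preimage, hφq v hv]; exact hu2⟩

/-- Measure-preserving injections with disjoint domains and disjoint ranges that exhaust `Q` up to
null sets extend to a measure-preserving automorphism that is the identity off `Q`. The two
leftover null sets are required to be uncountable, which makes them Borel isomorphic. -/
theorem exists_measurableEquiv_of_pieces {ι : Type*} [Countable ι] [Nonempty ι]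
    {Q Z : Set α} (hQ : MeasurableSet Q) (hZ : ¬ Z.Countable) (hZQ : Z ⊆ Q)
    {φ : ι → α → α} {A : ι → Set α} (hφ : ∀ i, Measurable (φ i)) (hA : ∀ i, MeasurableSet (A i))
    (hAQ : ∀ i, A i ⊆ Q \ Z) (hφQ : ∀ i, φ i '' A i ⊆ Q \ Z) (hinj : ∀ i, InjOn (φ i) (A i))
    (hd : Pairwise (Function.onFun Disjoint A))
    (hd' : Pairwise (Function.onFun Disjoint fun i => φ i '' A i))
    (hm : ∀ i S, MeasurableSet S → μ (A i ∩ φ i ⁻¹' S) = μ (φ i '' A i ∩ S))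
    (hfull : μ (Q \ ⋃ i, A i) = 0) (hfull' : μ (Q \ ⋃ i, φ i '' A i) = 0) :
    ∃ ω : α ≃ᵐ α, MeasurePreserving ω μ μ ∧ {x | ω x ≠ x} ⊆ Q ∧ ∀ i, EqOn ω (φ i) (A i) := by
  classical
  obtain ⟨Φ, hΦ, hΦA⟩ := exists_measurable_piecewise A hA φ hφ
    (fun i j hij x hx => absurd hx.2 (Set.disjoint_left.1 (hd hij) hx.1))
  set D := ⋃ i, A i with hD
  set D' := ⋃ i, φ i '' A i with hD'
  have himm : ∀ i, MeasurableSet (φ i '' A i) := fun i => (hA i).image_of_measurable_injOn (hφ i) (hinj i)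
  have hDm : MeasurableSet D := MeasurableSet.iUnion hA
  have hDm' : MeasurableSet D' := MeasurableSet.iUnion himm
  have hDQ : D ⊆ Q \ Z := iUnion_subset hAQ
  have hDQ' : D' ⊆ Q \ Z := iUnion_subset hφQ
  have hN : MeasurableSet (Q \ D) := hQ.diff hDm
  have hN' : MeasurableSet (Q \ D') := hQ.diff hDm'
  have : StandardBorelSpace (Q \ D : Set α) := hN.standardBorel
  have : StandardBorelSpace (Q \ D' : Set α) := hN'.standardBorel
  have hc : ¬ Countable (Q \ D : Set α) := fun h =>
    hZ ((countable_coe_iff.1 h).mono fun x hx => show x ∈ Q \ D from ⟨hZQ hx, fun h => (hDQ h).2 hx⟩)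
  have hc' : ¬ Countable (Q \ D' : Set α) := fun h =>
    hZ ((countable_coe_iff.1 h).mono fun x hx => show x ∈ Q \ D' from ⟨hZQ hx, fun h => (hDQ' h).2 hx⟩)
  let η : (Q \ D : Set α) ≃ᵐ (Q \ D' : Set α) := PolishSpace.measurableEquivOfNotCountable hc hc'
  let ω0 : α → α := fun x => if x ∈ D then Φ x else if h : x ∈ Q \ D then (η ⟨x, h⟩ : α) else x
  have hω0 : Measurable ω0 := by
    refine Measurable.ite hDm hΦ (Measurable.dite (s := Q \ D) (f := fun y => (η y : α))
      (g := fun y => (y : α)) ?_ ?_ hN)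
    · exact measurable_subtype_coe.comp η.measurable
    · exact measurable_subtype_coe
  have hωD : ∀ x ∈ D, ω0 x = Φ x := fun x hx => if_pos hx
  have hωA : ∀ i, EqOn ω0 (φ i) (A i) := fun i x hx => by
    rw [hωD x (mem_iUnion_of_mem i hx), hΦA i hx]
  have hωN : ∀ x (h : x ∈ Q \ D), ω0 x = η ⟨x, h⟩ := fun x h => by
    simp only [ω0, h.2, if_false, h, dif_pos]
  have hωQ : ∀ x ∉ Q, ω0 x = x := fun x h => by
    have h1 : x ∉ D := fun hx => h (hDQ hx).1
    have h2 : x ∉ Q \ D := fun hx => h hx.1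
    simp only [ω0, h1, if_false, h2, dif_neg, not_false_eq_true]
  have hmD : ∀ x ∈ D, ω0 x ∈ D' := by
    intro x hx
    obtain ⟨i, hi⟩ := mem_iUnion.1 hx
    rw [hωA i hi]
    exact mem_iUnion_of_mem i (mem_image_of_mem _ hi)
  have hmN : ∀ x ∈ Q \ D, ω0 x ∈ Q \ D' := fun x hx => by
    rw [hωN x hx]; exact (η ⟨x, hx⟩).2
  have hcase : ∀ x, x ∈ D ∨ x ∈ Q \ D ∨ x ∉ Q := fun x => by
    by_cases h1 : x ∈ D
    · exact Or.inl h1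
    · by_cases h2 : x ∈ Q
      · exact Or.inr (Or.inl ⟨h2, h1⟩)
      · exact Or.inr (Or.inr h2)
  have hωinj : Function.Injective ω0 := by
    intro x y hxy
    have hmq : ∀ x ∉ Q, ω0 x ∉ Q := fun x hx => by rwa [hωQ x hx]
    rcases hcase x with hx | hx | hx <;> rcases hcase y with hy | hy | hy
    · obtain ⟨i, hi⟩ := mem_iUnion.1 hx
      obtain ⟨j, hj⟩ := mem_iUnion.1 hy
      rw [hωA i hi, hωA j hj] at hxy
      have hij : i = j := by
        by_contra hne
        exact Set.disjoint_left.1 (hd' hne) (mem_image_of_mem _ hi) (hxy ▸ mem_image_of_mem _ hj)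
      subst hij
      exact hinj i hi hj hxy
    · exact absurd (hxy ▸ hmD x hx) (hmN y hy).2
    · exact absurd (hDQ' (hxy ▸ hmD x hx)).1 (hmq y hy)
    · exact absurd (hxy ▸ hmD y hy) (hmN x hx).2
    · rw [hωN x hx, hωN y hy] at hxy
      exact congrArg Subtype.val (η.injective (Subtype.ext hxy))
    · exact absurd (hxy ▸ (hmN x hx).1) (hmq y hy)
    · exact absurd (hDQ' (hxy ▸ hmD y hy)).1 (hmq x hx)
    · exact absurd (hxy ▸ (hmN y hy).1) (hmq x hx)
    · rwa [hωQ x hx, hωQ y hy] at hxy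
  have hωsurj : Function.Surjective ω0 := by
    intro y
    by_cases h1 : y ∈ D'
    · obtain ⟨i, x, hx, rfl⟩ := mem_iUnion.1 h1
      exact ⟨x, hωA i hx⟩
    · by_cases h2 : y ∈ Q
      · refine ⟨η.symm ⟨y, h2, h1⟩, ?_⟩
        rw [hωN _ (η.symm ⟨y, h2, h1⟩).2]
        simp
      · exact ⟨y, hωQ y h2⟩
  let ω : α ≃ᵐ α :=
    { Equiv.ofBijective ω0 ⟨hωinj, hωsurj⟩ with
      measurable_toFun := hω0
      measurable_invFun := by
        intro s hs
        rw [← Equiv.image_eq_preimage_symm]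
        exact hs.image_of_measurable_injOn hω0 hωinj.injOn }
  refine ⟨ω, ⟨hω0, ?_⟩, fun x hx => ?_, hωA⟩
  · ext S hS
    change μ.map ω0 S = μ S
    rw [Measure.map_apply hω0 hS]
    have split : ∀ T E : Set α, MeasurableSet E → E ⊆ Q → μ (Q \ E) = 0 →
        μ T = μ (T ∩ E) + μ (T ∩ Qᶜ) := by
      intro T E hE hEQ hE0
      rw [← measure_inter_add_sdiff T hE]
      congr 1
      refine le_antisymm ?_ (measure_mono fun x hx => ⟨hx.1, fun h => hx.2 (hEQ h)⟩)
      calc μ (T \ E) ≤ μ (T ∩ Qᶜ ∪ Q \ E) := by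
            refine measure_mono fun x hx => ?_
            by_cases h : x ∈ Q
            · exact Or.inr ⟨h, hx.2⟩
            · exact Or.inl ⟨hx.1, h⟩
        _ ≤ μ (T ∩ Qᶜ) + 0 := (measure_union_le _ _).trans (by rw [hE0])
        _ = _ := add_zero _
    rw [split S D' hDm' (fun x hx => (hDQ' hx).1) hfull',
      split (ω0 ⁻¹' S) D hDm (fun x hx => (hDQ hx).1) hfull]
    congr 1
    · rw [hD, hD', inter_iUnion, inter_iUnion, measure_iUnion, measure_iUnion]
      · refine tsum_congr fun i => ?_
        rw [inter_comm S, ← hm i S hS]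
        congr 1
        ext x
        constructor
        · rintro ⟨h1, h2⟩
          exact ⟨h2, by rw [mem_preimage, ← hωA i h2]; exact h1⟩
        · rintro ⟨h1, h2⟩
          exact ⟨by rw [mem_preimage, hωA i h1]; exact h2, h1⟩
      · exact fun i j hij => (hd' hij).mono inter_subset_right inter_subset_right
      · exact fun i => hS.inter (himm i)
      · exact fun i j hij => (hd hij).mono inter_subset_right inter_subset_right
      · exact fun i => (hω0 hS).inter (hA i)
    · congr 1
      ext x
      simp only [mem_inter_iff, mem_preimage, mem_compl_iff]
      constructor
      · rintro ⟨h1, h2⟩; rw [hωQ x h2] at h1; exact ⟨h1, h2⟩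
      · rintro ⟨h1, h2⟩; exact ⟨by rwa [hωQ x h2], h2⟩
  · by_contra hQx
    exact hx (hωQ x hQx)

/-- Given disjoint sets `G j ⊆ Q` and disjoint sets `F j ⊆ Q` with `μ (G j) ≤ μ (F j)`, some
measure-preserving automorphism maps almost all of each `G j` into `F j` and moves no point
off `Q`. -/
theorem exists_rearrangement [NullSingletonClass μ] {Q Z : Set α} (hQ : MeasurableSet Q) (hQf : μ Q ≠ ∞)
    (hZm : MeasurableSet Z) (hZ0 : μ Z = 0) (hZ : ¬ Z.Countable) (hZQ : Z ⊆ Q)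
    {G F : ℕ → Set α} (hG : ∀ j, MeasurableSet (G j)) (hF : ∀ j, MeasurableSet (F j))
    (hGQ : ∀ j, G j ⊆ Q) (hFQ : ∀ j, F j ⊆ Q) (hGd : Pairwise (Function.onFun Disjoint G))
    (hFd : Pairwise (Function.onFun Disjoint F)) (hGF : ∀ j, μ (G j) ≤ μ (F j)) :
    ∃ ω : α ≃ᵐ α, MeasurePreserving ω μ μ ∧ {x | ω x ≠ x} ⊆ Q ∧
      ∀ j, ∀ᵐ x ∂(μ.restrict (G j)), ω x ∈ F j := by
  have hα : ¬ Countable α := fun h => hZ (to_countable Z)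
  have hsub : ∀ S ⊆ Q, μ S ≠ ∞ := fun S hS => ((measure_mono hS).trans_lt hQf.lt_top).ne
  have hdiffZ : ∀ S, μ (S \ Z) = μ S := fun S => measure_sdiff_null hZ0
  have h1 : ∀ j, ∃ (φ : α → α) (A0 : Set α), Measurable φ ∧ MeasurableSet A0 ∧ A0 ⊆ G j \ Z ∧
      μ ((G j \ Z) \ A0) = 0 ∧ InjOn φ A0 ∧ MapsTo φ A0 (F j \ Z) ∧
      ∀ S, MeasurableSet S → μ (A0 ∩ φ ⁻¹' S) = μ (φ '' A0 ∩ S) := fun j =>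
    exists_injOn_measurePreserving hα ((hG j).diff hZm) ((hF j).diff hZm)
      (hsub _ (sdiff_subset.trans (hFQ j))) (by rw [hdiffZ, hdiffZ]; exact hGF j)
  choose φ A hφ hA hAG hA0 hinj hmaps hm using h1
  have him : ∀ j, MeasurableSet (φ j '' A j) := fun j => (hA j).image_of_measurable_injOn (hφ j) (hinj j)
  have hAd : Pairwise (Function.onFun Disjoint A) := fun i j hij =>
    (hGd hij).mono ((hAG i).trans sdiff_subset) ((hAG j).trans sdiff_subset)
  have hId : Pairwise (Function.onFun Disjoint fun j => φ j '' A j) := fun i j hij =>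
    (hFd hij).mono ((hmaps i).image_subset.trans sdiff_subset) ((hmaps j).image_subset.trans sdiff_subset)
  have hmeq : ∀ j, μ (φ j '' A j) = μ (A j) := fun j => by
    simpa using (hm j univ MeasurableSet.univ).symm
  have hUA : (⋃ j, A j) ⊆ Q \ Z := iUnion_subset fun j x hx => ⟨hGQ j (hAG j hx).1, (hAG j hx).2⟩
  have hUI : (⋃ j, φ j '' A j) ⊆ Q \ Z := iUnion_subset fun j => by
    rintro _ ⟨x, hx, rfl⟩
    exact ⟨hFQ j (hmaps j hx).1, (hmaps j hx).2⟩
  have hUm : μ (⋃ j, φ j '' A j) = μ (⋃ j, A j) := by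
    rw [measure_iUnion hId him, measure_iUnion hAd hA]
    exact tsum_congr hmeq
  -- The complements of the domains and of the images have the same measure, so one more injection
  -- exhausts `Q` up to null sets. The null set `Z` is kept aside to patch them.
  set R := (Q \ Z) \ ⋃ j, A j with hR
  set R' := (Q \ Z) \ ⋃ j, φ j '' A j with hR'
  have hRm : MeasurableSet R := (hQ.diff hZm).diff (MeasurableSet.iUnion hA)
  have hRm' : MeasurableSet R' := (hQ.diff hZm).diff (MeasurableSet.iUnion him)
  have hRR : μ R = μ R' := by
    rw [hR, hR', measure_sdiff hUA (MeasurableSet.iUnion hA).nullMeasurableSet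
        (hsub _ (hUA.trans sdiff_subset)),
      measure_sdiff hUI (MeasurableSet.iUnion him).nullMeasurableSet
        (hsub _ (hUI.trans sdiff_subset)), hUm]
  have hRQ : R ⊆ Q \ Z := sdiff_subset
  have hRQ' : R' ⊆ Q \ Z := sdiff_subset
  obtain ⟨φ0, A00, hφ0, hA00, hAR, hA000, hinj0, hmaps0, hm0⟩ :=
    exists_injOn_measurePreserving hα hRm hRm' (hsub _ (hRQ'.trans sdiff_subset)) hRR.le
  have him0 : MeasurableSet (φ0 '' A00) := hA00.image_of_measurable_injOn hφ0 hinj0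
  have hRn' : μ (R' \ φ0 '' A00) = 0 := by
    have e1 : μ (φ0 '' A00) = μ A00 := by simpa using (hm0 univ MeasurableSet.univ).symm
    have e2 : μ A00 = μ R := le_antisymm (measure_mono hAR) (by
      rw [← measure_sdiff_null hA000, sdiff_sdiff_right_self]
      exact measure_mono inter_subset_right)
    rw [measure_sdiff hmaps0.image_subset him0.nullMeasurableSet
      (hsub _ (hmaps0.image_subset.trans (hRQ'.trans sdiff_subset))), e1, e2, hRR, tsub_self]
  let φ' : Option ℕ → α → α := fun i => i.elim φ0 φ
  let A' : Option ℕ → Set α := fun i => i.elim A00 A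
  obtain ⟨ω, hω1, hω2, hω3⟩ := exists_measurableEquiv_of_pieces (μ := μ) (φ := φ') (A := A') hQ hZ hZQ
    (by rintro (_ | i); exacts [hφ0, hφ i]) (by rintro (_ | i); exacts [hA00, hA i])
    (by rintro (_ | i); exacts [hAR.trans hRQ, (subset_iUnion A i).trans hUA])
    (by
      rintro (_ | i)
      exacts [hmaps0.image_subset.trans hRQ', (subset_iUnion (fun j => φ j '' A j) i).trans hUI])
    (by rintro (_ | i); exacts [hinj0, hinj i])
    (by
      have hn : ∀ j, Disjoint A00 (A j) := fun j => Set.disjoint_left.2 fun x hx hx' =>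
        (hAR hx).2 (mem_iUnion_of_mem j hx')
      rintro (_ | i) (_ | j) hij
      exacts [absurd rfl hij, hn j, (hn i).symm, hAd fun h => hij (congrArg some h)])
    (by
      have hn : ∀ j, Disjoint (φ0 '' A00) (φ j '' A j) := fun j => Set.disjoint_left.2 fun x hx hx' =>
        (hmaps0.image_subset hx).2 (mem_iUnion_of_mem j hx')
      rintro (_ | i) (_ | j) hij
      exacts [absurd rfl hij, hn j, (hn i).symm, hId fun h => hij (congrArg some h)])
    (by rintro (_ | i); exacts [hm0, hm i])
    (by
      refine measure_mono_null (t := Z ∪ R \ A00) ?_ (measure_union_null hZ0 hA000)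
      rintro x ⟨hx, hx'⟩
      by_cases hxZ : x ∈ Z
      · exact Or.inl hxZ
      · refine Or.inr ⟨⟨⟨hx, hxZ⟩, fun h => ?_⟩, fun h => hx' (mem_iUnion_of_mem none h)⟩
        obtain ⟨j, hj⟩ := mem_iUnion.1 h
        exact hx' (mem_iUnion_of_mem (some j) hj))
    (by
      refine measure_mono_null (t := Z ∪ R' \ φ0 '' A00) ?_ (measure_union_null hZ0 hRn')
      rintro x ⟨hx, hx'⟩
      by_cases hxZ : x ∈ Z
      · exact Or.inl hxZ
      · refine Or.inr ⟨⟨⟨hx, hxZ⟩, fun h => ?_⟩, fun h => hx' (mem_iUnion_of_mem none h)⟩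
        obtain ⟨j, hj⟩ := mem_iUnion.1 h
        exact hx' (mem_iUnion_of_mem (some j) hj))
  refine ⟨ω, hω1, hω2, fun j => ?_⟩
  rw [ae_restrict_iff' (hG j), ae_iff]
  refine measure_mono_null (t := Z ∪ (G j \ Z) \ A j) ?_ (measure_union_null hZ0 (hA0 j))
  intro x hx
  simp only [mem_ofPred_eq, Classical.not_imp] at hx
  by_cases hxZ : x ∈ Z
  · exact Or.inl hxZ
  · refine Or.inr ⟨⟨hx.1, hxZ⟩, fun h => hx.2 ?_⟩
    rw [hω3 (some j) h]
    exact (hmaps j h).1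

end StandardBorel

/-! ### Evenly spread sets of prescribed measure -/

theorem volume_ball_eq {n : ℕ} (hn : n ≠ 0) (x : RSpace n) {r : ℝ} (hr : 0 ≤ r) :
    volume (Metric.ball x r) = ENNReal.ofReal r ^ n * volume (Metric.ball (0 : RSpace n) 1) := by
  have : Nontrivial (RSpace n) := Module.nontrivial_of_finrank_pos (R := ℝ)
    (by simpa using Nat.pos_of_ne_zero hn)
  rw [Measure.addHaar_ball _ _ hr, ENNReal.ofReal_pow hr]
  simp

theorem ofReal_ballVolume {n : ℕ} : ENNReal.ofReal (volume.real (Metric.ball (0 : RSpace n) 1)) =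
    volume (Metric.ball (0 : RSpace n) 1) := ofReal_measureReal measure_ball_lt_top.ne

theorem ballVolume_pos {n : ℕ} : 0 < volume.real (Metric.ball (0 : RSpace n) 1) :=
  ENNReal.toReal_pos (Metric.measure_ball_pos _ _ one_pos).ne' measure_ball_lt_top.ne

theorem ball_subset_cell {n : ℕ} {s θ : ℝ} (hs : 0 < s) (hθ : θ ≤ 1 / 2) :
    Metric.ball (0 : RSpace n) (θ * s) ⊆ cell n s := by
  intro x hx i
  rw [mem_ball_zero_iff] at hx
  have h := PiLp.norm_apply_le x i
  rw [Real.norm_eq_abs] at h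
  have h2 := abs_lt.1 (h.trans_lt hx)
  constructor <;> nlinarith

/-- A lattice of balls of density `θ ^ n` times the volume of the unit ball meets a set that is
nearly invariant under small translations in at most about the expected proportion. -/
theorem volume_inter_lattice_balls_le {n : ℕ} (hn : n ≠ 0) {s θ : ℝ} (hs : 0 < s) (hθ0 : 0 ≤ θ) (hθ : θ ≤ 1 / 2)
    {U : Set (RSpace n)} (hU : MeasurableSet U) {η : ℝ≥0∞}
    (h : ∀ t ∈ cell n s, volume {x | x - t ∈ U ∧ x ∉ U} ≤ η) :
    volume (U ∩ periodize s (Metric.ball 0 (θ * s))) ≤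
      ENNReal.ofReal (θ ^ n * volume.real (Metric.ball (0 : RSpace n) 1)) * volume U + η := by
  have h1 := periodize_le_volume_mul hs measurableSet_ball (ball_subset_cell hs hθ) hU h
  rw [volume_ball_eq hn _ (by positivity), ENNReal.ofReal_mul hθ0, mul_pow] at h1
  have hs0 : ENNReal.ofReal s ^ n ≠ 0 := by simp [hs]
  have hs1 : ENNReal.ofReal s ^ n ≠ ∞ := by simp
  rw [ENNReal.ofReal_mul (by positivity), ofReal_ballVolume, ENNReal.ofReal_pow hθ0]
  refine (ENNReal.mul_le_mul_iff_right hs0 hs1).1 (h1.trans (le_of_eq ?_))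
  ring

theorem isOpen_lattice_balls {n : ℕ} (s r : ℝ) :
    IsOpen (periodize s (Metric.ball (0 : RSpace n) r)) := by
  rw [periodize_eq_iUnion]
  exact isOpen_iUnion fun z => Metric.isOpen_ball.preimage (by fun_prop)

/-- `N` stages of equal density `θ ^ n κ` have total density `b`, with `θ` small if `N` is large. -/
theorem exists_sum_density {b ρ κ : ℝ} {n : ℕ} (hn : n ≠ 0) (hb : 0 ≤ b) (hρ : 0 < ρ) (hκ : 0 < κ) :
    ∃ (N : ℕ) (θ : ℝ), 0 ≤ θ ∧ N * (θ ^ n * κ) = b ∧ θ * ρ ≤ 1 / 2 := by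
  obtain ⟨N, hN⟩ := exists_nat_gt (b / κ * (2 * ρ) ^ n)
  have hN0 : (0 : ℝ) < N := lt_of_le_of_lt (by positivity) hN
  have hy : 0 ≤ b / κ / N := by positivity
  refine ⟨N, (b / κ / N) ^ ((n : ℝ)⁻¹), by positivity, ?_, ?_⟩
  · rw [Real.rpow_inv_natCast_pow hy hn]
    field_simp
  · have h1 : (b / κ / N) ^ ((n : ℝ)⁻¹) * (2 * ρ) ≤ 1 := by
      refine le_of_pow_le_pow_left₀ hn zero_le_one ?_
      rw [mul_pow, Real.rpow_inv_natCast_pow hy hn, one_pow, div_mul_eq_mul_div, div_le_one hN0]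
      exact hN.le
    linarith

theorem exists_le_sum_Ico_of_not_summable {a : ℕ → ℝ} (ha : ∀ m, 0 ≤ a m) (h : ¬ Summable a)
    (M : ℕ) (C : ℝ) : ∃ M' ≥ M, C ≤ ∑ i ∈ Finset.Ico M M', a i := by
  by_contra! hcon
  refine h (summable_of_sum_range_le (c := C + ∑ i ∈ Finset.range M, a i) ha fun N => ?_)
  have h1 := hcon (max M N) (le_max_left _ _)
  have h2 := Finset.sum_range_add_sum_Ico a (le_max_left M N)
  have h3 : ∑ i ∈ Finset.range N, a i ≤ ∑ i ∈ Finset.range (max M N), a i :=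
    Finset.sum_le_sum_of_subset_of_nonneg (Finset.range_mono (le_max_right _ _)) fun i _ _ => ha i
  linarith

/-- Spreads the mass `b j` of each level over stages of density `Θ j i ^ n κ`. All but finitely many
`Θ j i` are `0` for given `j`, so that `Θ j i ρ j ≤ 1 / 2` is possible; those stages are empty. -/
theorem exists_stage_densities {n : ℕ} (hn : n ≠ 0) {b ρ : ℕ → ℝ} {κ : ℝ} (hb : ∀ j, 0 ≤ b j)
    (hρ : ∀ j, 0 < ρ j) (hκ : 0 < κ) :
    ∃ Θ : ℕ → ℕ → ℝ, (∀ j i, 0 ≤ Θ j i) ∧ (∀ j i, Θ j i * ρ j ≤ 1 / 2) ∧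
      ∀ j, HasSum (fun i => Θ j i ^ n * κ) (b j) := by
  choose N θ hθ hsum hθρ using fun j => exists_sum_density hn (hb j) (hρ j) hκ
  refine ⟨fun j i => if i < N j then θ j else 0, fun j i => ?_, fun j i => ?_, fun j => ?_⟩
  · dsimp only
    split_ifs
    exacts [hθ j, le_rfl]
  · dsimp only
    split_ifs
    · exact hθρ j
    · norm_num
  · rw [← hsum j]
    have h := hasSum_sum_of_ne_finset_zero (L := SummationFilter.unconditional ℕ) (s := Finset.range (N j))
      (f := fun i => (if i < N j then θ j else 0) ^ n * κ) (fun i hi => by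
        have : ¬ i < N j := by simpa using hi
        simp [this, hn])
    convert h using 1
    rw [Finset.sum_congr rfl (g := fun _ => θ j ^ n * κ) fun i hi => by simp [Finset.mem_range.1 hi]]
    simp

theorem not_summable_unpair {n : ℕ} {b e : ℕ → ℝ} {κ : ℝ} (hκ : 0 < κ) {Θ : ℕ → ℕ → ℝ}
    (hsum : ∀ j, HasSum (fun i => Θ j i ^ n * κ) (b j)) (h : ¬ Summable fun j => b j * e j) :
    ¬ Summable fun m : ℕ => Θ m.unpair.1 m.unpair.2 ^ n * e m.unpair.1 := by
  intro hs
  apply h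
  have h1 : Summable fun p : ℕ × ℕ => Θ p.1 p.2 ^ n * e p.1 := by
    rw [← Nat.pairEquiv.symm.summable_iff]
    exact hs
  have h2 := h1.prod
  refine (h2.mul_left κ).congr fun j => ?_
  have h3 : HasSum (fun i => Θ j i ^ n * e j) (b j * (κ⁻¹ * e j)) := by
    refine ((hsum j).mul_right (κ⁻¹ * e j)).congr_fun fun i => ?_
    field_simp
  rw [h3.tsum_eq]
  field_simp

theorem tsum_ofReal_unpair {n : ℕ} {b : ℕ → ℝ} {κ : ℝ} (hκ : 0 < κ) {Θ : ℕ → ℕ → ℝ}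
    (hΘ : ∀ j i, 0 ≤ Θ j i) (hsum : ∀ j, HasSum (fun i => Θ j i ^ n * κ) (b j)) :
    ∑' m : ℕ, ENNReal.ofReal (Θ m.unpair.1 m.unpair.2 ^ n * κ) = ∑' j, ENNReal.ofReal (b j) := by
  have h0 : ∀ j i, 0 ≤ Θ j i ^ n * κ := fun j i => mul_nonneg (pow_nonneg (hΘ j i) n) hκ.le
  have h1 := Nat.pairEquiv.symm.tsum_eq fun p : ℕ × ℕ => ENNReal.ofReal (Θ p.1 p.2 ^ n * κ)
  change ∑' m : ℕ, ENNReal.ofReal (Θ m.unpair.1 m.unpair.2 ^ n * κ) = _ at h1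
  rw [h1, ENNReal.tsum_prod' (f := fun p : ℕ × ℕ => ENNReal.ofReal (Θ p.1 p.2 ^ n * κ))]
  refine tsum_congr fun j => ?_
  rw [← (hsum j).tsum_eq, ENNReal.ofReal_tsum_of_nonneg (h0 j) (hsum j).summable]

theorem volume_translate_diff_preimage_sub {n : ℕ} (c t : RSpace n) {E : Set (RSpace n)}
    (hE : MeasurableSet E) :
    volume {x | x - t ∈ (fun y => y - c) ⁻¹' E ∧ x ∉ (fun y => y - c) ⁻¹' E} =
      volume {x | x - t ∈ E ∧ x ∉ E} := by
  have hmeas : MeasurableSet {x | x - t ∈ E ∧ x ∉ E} := ((measurable_sub_const t) hE).inter hE.compl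
  rw [← (measurePreserving_sub_right volume c).measure_preimage hmeas.nullMeasurableSet]
  congr 1
  ext x
  change (x - t - c ∈ E ∧ x - c ∉ E) ↔ (x - c - t ∈ E ∧ x - c ∉ E)
  rw [sub_right_comm]

theorem tsum_ofReal_half_pow :
    ∑' m : ℕ, ENNReal.ofReal ((1 / 2) ^ (m + 3)) = ENNReal.ofReal (1 / 4) := by
  have h1 : HasSum (fun m : ℕ => ((1 : ℝ) / 2) ^ (m + 3)) (1 / 4) := by
    have := hasSum_geometric_two.mul_right ((1 / 2 : ℝ) ^ 3)
    have e : (fun i : ℕ => ((1 : ℝ) / 2) ^ i * (1 / 2) ^ 3) = fun i => (1 / 2) ^ (i + 3) :=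
      funext fun i => (pow_add _ _ _).symm
    rw [e] at this
    norm_num at this ⊢
    exact this
  rw [← ENNReal.ofReal_tsum_of_nonneg (fun _ => by positivity) h1.summable, h1.tsum_eq]

/-- If sets `W m'` have proportions in a ball that add up to at most `1 / 2`, their removal leaves
at least half of the ball. -/
theorem volume_ball_le_two_mul_diff {n : ℕ} {c : RSpace n} {r : ℝ} {W : ℕ → Set (RSpace n)} {m : ℕ}
    {α : ℕ → ℝ≥0∞}
    (h : ∀ m' > m, volume (Metric.ball c r ∩ W m') ≤ α m' * volume (Metric.ball c r))
    (hα : ∑' m', α m' ≤ ENNReal.ofReal (1 / 2)) :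
    volume (Metric.ball c r) ≤ 2 * volume (Metric.ball c r \ ⋃ m' ∈ Ioi m, W m') := by
  have hbad : volume (Metric.ball c r ∩ ⋃ m' ∈ Ioi m, W m') ≤
      ENNReal.ofReal (1 / 2) * volume (Metric.ball c r) := by
    rw [inter_iUnion₂]
    calc _ ≤ ∑' m' : Ioi m, volume (Metric.ball c r ∩ W m') :=
          measure_biUnion_le _ (to_countable _) _
      _ ≤ ∑' m' : Ioi m, α m' * volume (Metric.ball c r) :=
          ENNReal.tsum_le_tsum fun m' => h m' m'.2
      _ ≤ ∑' m' : ℕ, α m' * volume (Metric.ball c r) :=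
          ENNReal.tsum_comp_le_tsum_of_injective Subtype.val_injective
            fun m' : ℕ => α m' * volume (Metric.ball c r)
      _ ≤ _ := by
          rw [ENNReal.tsum_mul_right]
          gcongr
  have h1 := (measure_le_inter_add_sdiff volume (Metric.ball c r) (⋃ m' ∈ Ioi m, W m')).trans
    (add_le_add_left hbad _)
  have hfin : volume (Metric.ball c r) ≠ ∞ := measure_ball_lt_top.ne
  have hfin2 : volume (Metric.ball c r \ ⋃ m' ∈ Ioi m, W m') ≠ ∞ :=
    ((measure_mono sdiff_subset).trans_lt measure_ball_lt_top).ne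
  rw [← ENNReal.toReal_le_toReal (by finiteness) (by finiteness)] at h1 ⊢
  rw [ENNReal.toReal_add (by finiteness) (by finiteness), ENNReal.toReal_mul,
    ENNReal.toReal_ofReal (by norm_num)] at h1
  rw [ENNReal.toReal_mul, ENNReal.toReal_ofNat]
  linarith

/-- Sets `G j` of prescribed small measure, spread over the unit cube in small balls so evenly that,
for every rotation `γ` and every `l`, almost every point lies in arbitrarily small rotated intervals
in which some `G j` has density at least about `2 ^ (-d (j - l))`, where `d = n - k + 1`. -/
theorem exists_spread_sets {n k : ℕ} (hk : 2 ≤ k) (hkn : k ≤ n) {b : ℕ → ℝ} (hb : ∀ j, 0 ≤ b j)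
    (hb1 : ∑' j, ENNReal.ofReal (b j) ≤ 1)
    (hdiv : ∀ l, ¬ Summable fun j => b j *
      if l ≤ j then volume.real (hyperbolicCross n k (j - l)) else 0) :
    ∃ G : ℕ → Set (RSpace n), (∀ j, MeasurableSet (G j)) ∧ (∀ j, G j ⊆ unitCube n) ∧
      Pairwise (Function.onFun Disjoint G) ∧ (∀ j, volume (G j) ≤ ENNReal.ofReal (b j)) ∧
      ∃ κ > 0, ∀ (γ : RSpace n ≃ₗᵢ[ℝ] RSpace n) (l : ℕ),
        volume {x | x ∈ unitCube n ∧ ¬ ∀ ε > 0, ∃ j ≥ l, ∃ S ∈ rotate (intervalBasis n k) γ x,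
          S ⊆ Metric.ball x ε ∧ MeasurableSet S ∧ 0 < volume.real S ∧
          κ * volume.real S ≤ 2 ^ ((n + 1 - k) * (j - l)) * volume.real (G j ∩ S)} = 0 := by
  have hn : n ≠ 0 := by omega
  set Q := unitCube n with hQ
  have hQm : MeasurableSet Q := measurableSet_unitCube n
  have hQ1 : volume Q = 1 := volume_unitCube n
  set v : ℝ := volume.real (Metric.ball (0 : RSpace n) 1) with hv
  have hv0 : 0 < v := ballVolume_pos
  obtain ⟨Θ, hΘ0, hΘρ, hΘsum⟩ := exists_stage_densities (n := n) hn (b := fun j => b j / 4)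
    (ρ := crossRadius n k) (fun j => by linarith [hb j]) (fun j => crossRadius_pos) hv0
  -- The stages are numbered by pairs: the stage `m` is the `m.unpair.2`-th one of the level `J m`.
  let J : ℕ → ℕ := fun m => m.unpair.1
  let θ : ℕ → ℝ := fun m => Θ m.unpair.1 m.unpair.2
  have hθ0 : ∀ m, 0 ≤ θ m := fun m => hΘ0 _ _
  have hθρ : ∀ m, θ m * crossRadius n k (J m) ≤ 1 / 2 := fun m => hΘρ _ _
  have hθ2 : ∀ m, θ m ≤ 1 / 2 := by
    intro m
    exact (le_mul_of_one_le_right (hθ0 m) one_le_crossRadius).trans (hθρ m)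
  have htsum : ∑' m, ENNReal.ofReal (θ m ^ n * v) ≤ ENNReal.ofReal (1 / 4) := by
    rw [tsum_ofReal_unpair hv0 hΘ0 hΘsum]
    have : ∀ j, ENNReal.ofReal (b j / 4) = ENNReal.ofReal (1 / 4) * ENNReal.ofReal (b j) := fun j => by
      rw [← ENNReal.ofReal_mul (by norm_num)]; congr 1; ring
    simp_rw [this]
    rw [ENNReal.tsum_mul_left]
    exact mul_le_of_le_one_right' hb1
  -- Crosses whose index lags `l` behind the level: a height `2 ^ (d j)` on a set of relative
  -- density `2 ^ (-d (j - l))` gives means of order `2 ^ (d l)`.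
  let E : ℕ → ℕ → Set (RSpace n) := fun m l => if l ≤ J m then hyperbolicCross n k (J m - l) else ∅
  have hEm : ∀ m l, MeasurableSet (E m l) := fun m l => by
    simp only [E]; split_ifs
    exacts [measurableSet_hyperbolicCross, MeasurableSet.empty]
  have hE0 : ∀ m l, (0 : RSpace n) ∉ E m l := fun m l => by
    simp only [E]; split_ifs
    exacts [zero_notMem_hyperbolicCross hk hkn, notMem_empty _]
  have hEb : ∀ m l, E m l ⊆ Metric.ball 0 (crossRadius n k (J m)) := fun m l => by
    simp only [E]; split_ifs
    exacts [(hyperbolicCross_subset_ball hkn).trans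
      (Metric.ball_subset_ball (crossRadius_mono (Nat.sub_le _ _))), empty_subset _]
  let W : ℕ → ℝ → Set (RSpace n) := fun m s => periodize s (Metric.ball 0 (θ m * s))
  let P0 : ℕ → ℝ → Prop := fun m s => s ≤ (1 / 2) ^ m ∧
    volume (Q ∩ W m s) ≤ ENNReal.ofReal (2 * (θ m ^ n * v))
  let P : ℕ → ℝ → ℕ → ℝ → Prop := fun i s m s' => 0 < θ i → ∀ t ∈ cell n s',
    volume {x | x - t ∈ Metric.ball (0 : RSpace n) (θ i * s) ∧ x ∉ Metric.ball (0 : RSpace n) (θ i * s)} ≤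
      ENNReal.ofReal ((1 / 2) ^ (m + 3)) * volume (Metric.ball (0 : RSpace n) (θ i * s))
  have hP0 : ∀ m, ∀ᶠ s in 𝓝[>] 0, P0 m s := by
    intro m
    refine Eventually.and ?_ ?_
    · filter_upwards [Ioo_mem_nhdsGT (show (0 : ℝ) < (1 / 2) ^ m by positivity)] with s hs using hs.2.le
    · rcases (hθ0 m).eq_or_lt with h | h
      · refine Eventually.of_forall fun s => ?_
        simp only [W, ← h, zero_mul, Metric.ball_zero, periodize]
        simp
      obtain ⟨δ, hδ, hd⟩ := tendsto_measure_translate_diff hQm (by rw [hQ1]; simp)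
        (ε := ENNReal.ofReal (θ m ^ n * v)) (by simp; positivity)
      filter_upwards [eventually_forall_mem_cell hδ fun t ht => (hd t ht).1,
        self_mem_nhdsWithin] with s hs hs0
      refine (volume_inter_lattice_balls_le hn hs0 (hθ0 m) (hθ2 m) hQm hs).trans (le_of_eq ?_)
      rw [hQ1, mul_one, ← ENNReal.ofReal_add (by positivity) (by positivity)]
      congr 1; ring
  have hP : ∀ i m s, 0 < s → ∀ᶠ s' in 𝓝[>] 0, P i s m s' := by
    intro i m s hs
    by_cases h : 0 < θ i
    · obtain ⟨δ, hδ, hd⟩ := tendsto_measure_translate_diff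
        (E := Metric.ball (0 : RSpace n) (θ i * s)) measurableSet_ball measure_ball_lt_top.ne
        (ε := ENNReal.ofReal ((1 / 2) ^ (m + 3)) * volume (Metric.ball (0 : RSpace n) (θ i * s)))
        (ENNReal.mul_pos (by simp) (Metric.measure_ball_pos _ _ (by positivity)).ne')
      exact (eventually_forall_mem_cell hδ fun t ht => (hd t ht).1).mono fun s' h' _ => h'
    · exact Eventually.of_forall fun s' h' => absurd h' h
  obtain ⟨s, hs, hsP0, hsP, hcov⟩ := exists_scales_covering hn hθ0 hEm hE0 hEb hθρ hP0 hP
  have hWo : ∀ m, IsOpen (W m (s m)) := fun m => isOpen_lattice_balls _ _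
  -- Later stages take precedence; this costs each ball at most half of its measure.
  let H : ℕ → Set (RSpace n) := fun m => (W m (s m) ∩ Q) \ ⋃ m' ∈ Ioi m, W m' (s m')
  have hHm : ∀ m, MeasurableSet (H m) := fun m =>
    ((hWo m).measurableSet.inter hQm).diff
      (MeasurableSet.biUnion (to_countable _) fun i _ => (hWo i).measurableSet)
  have hHd : ∀ m m', m < m' → Disjoint (H m) (H m') := fun m m' h =>
    Set.disjoint_left.2 fun x hx hx' => hx.2 (mem_biUnion (mem_Ioi.2 h) hx'.1.1)
  have hHd' : Pairwise (Function.onFun Disjoint H) := fun m m' h => by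
    rcases lt_or_gt_of_ne h with h | h
    exacts [hHd _ _ h, (hHd _ _ h).symm]
  have hball : ∀ m z, 0 < θ m → Metric.ball (latticePoint (s m) z) (θ m * s m) ⊆ Q →
      volume (Metric.ball (latticePoint (s m) z) (θ m * s m)) ≤
        2 * volume (H m ∩ Metric.ball (latticePoint (s m) z) (θ m * s m)) := by
    intro m z hm hzQ
    set r := θ m * s m with hr
    have hr0 : 0 < r := mul_pos hm (hs m)
    set c : RSpace n := latticePoint (s m) z
    have hone : ∀ m' > m, volume (Metric.ball c r ∩ W m' (s m')) ≤
        (ENNReal.ofReal (θ m' ^ n * v) + ENNReal.ofReal ((1 / 2) ^ (m' + 3))) *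
          volume (Metric.ball c r) := by
      intro m' hm'
      rw [add_mul]
      refine volume_inter_lattice_balls_le hn (hs m') (hθ0 m') (hθ2 m') measurableSet_ball
        fun t ht => ?_
      have hc : Metric.ball c r = (fun y => y - c) ⁻¹' Metric.ball 0 r := by
        ext y
        rw [mem_preimage, mem_ball_zero_iff, ← dist_eq_norm, Metric.mem_ball]
      rw [volume_ball_eq hn c hr0.le, ← volume_ball_eq hn 0 hr0.le, hc,
        volume_translate_diff_preimage_sub c t measurableSet_ball]
      exact hsP m' m hm' hm t ht
    refine (volume_ball_le_two_mul_diff hone ?_).trans ?_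
    · rw [ENNReal.tsum_add, tsum_ofReal_half_pow]
      refine (add_le_add_left htsum _).trans (le_of_eq ?_)
      rw [← ENNReal.ofReal_add (by norm_num) (by norm_num)]
      norm_num
    · gcongr
      rintro x ⟨hx, hx'⟩
      refine ⟨⟨⟨⟨z, ?_⟩, hzQ hx⟩, hx'⟩, hx⟩
      rw [mem_ball_zero_iff, ← dist_eq_norm]
      exact hx
  refine ⟨fun j => ⋃ i, H (Nat.pair j i), fun j => MeasurableSet.iUnion fun i => hHm _,
    fun j => iUnion_subset fun i => sdiff_subset.trans inter_subset_right, ?_, fun j => ?_,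
    v / (2 * 2 ^ (n + (k - 1))), by positivity, fun γ l => ?_⟩
  · intro j j' hjj
    refine Set.disjoint_iUnion_left.2 fun i => Set.disjoint_iUnion_right.2 fun i' => hHd' ?_
    exact fun h => hjj (Nat.pair_eq_pair.1 h).1
  · have hnn : ∀ i, 0 ≤ 2 * (Θ j i ^ n * v) := fun i => by
      have := pow_nonneg (hΘ0 j i) n
      positivity
    have h2 := (hΘsum j).mul_left 2
    calc _ ≤ ∑' i, volume (H (Nat.pair j i)) := measure_iUnion_le _
      _ ≤ ∑' i, ENNReal.ofReal (2 * (Θ j i ^ n * v)) := by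
          refine ENNReal.tsum_le_tsum fun i => ?_
          have h1 := (hsP0 (Nat.pair j i)).2
          simp only [θ, Nat.unpair_pair] at h1
          refine le_trans (measure_mono ?_) h1
          exact fun x hx => ⟨hx.1.2, hx.1.1⟩
      _ = ENNReal.ofReal (2 * (b j / 4)) := by
          rw [← ENNReal.ofReal_tsum_of_nonneg hnn h2.summable, h2.tsum_eq]
      _ ≤ _ := ENNReal.ofReal_le_ofReal (by linarith [hb j])
  · have hns : ¬ Summable fun m => θ m ^ n * volume.real (E m l) := by
      have h1 : ¬ Summable fun j => b j / 4 *
          if l ≤ j then volume.real (hyperbolicCross n k (j - l)) else 0 := by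
        intro h
        refine hdiv l ((h.mul_left 4).congr fun j => ?_)
        ring
      have h2 := not_summable_unpair hv0 hΘsum h1
      convert h2 using 4 with m
      simp only [E, J]
      split_ifs
      · rfl
      · simp
    have hae := ae_frequently_mem_of_covering (μ := volume) (Q := Q) (by rw [hQ1]; simp)
      (A := fun i => stageSet (s i) (θ i) γ (E i l)) (l := l) (fun M M' hM hM' => hcov γ l M M' hM hM')
      (exists_le_sum_Ico_of_not_summable
        (fun m => mul_nonneg (pow_nonneg (hθ0 m) n) measureReal_nonneg) hns)
    refine measure_mono_null ?_ hae
    rintro x ⟨hxQ, hx⟩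
    refine ⟨hxQ, fun hfr => hx fun ε hε => ?_⟩
    obtain ⟨ε', hε', hεQ⟩ := Metric.isOpen_iff.1 (isOpen_unitCube n) x hxQ
    have hs0 : Tendsto s atTop (𝓝 0) := squeeze_zero (fun m => (hs m).le) (fun m => (hsP0 m).1)
      (tendsto_pow_atTop_nhds_zero_of_lt_one (by norm_num) (by norm_num))
    obtain ⟨m, hm, hmε⟩ := (hfr.and_eventually
      (hs0.eventually (gt_mem_nhds (lt_min hε hε')))).exists
    have hlJ : l ≤ J m := by
      by_contra hcon
      obtain ⟨z, hz⟩ := hm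
      simp only [E, hcon, if_false] at hz
      exact hz
    simp only [E, hlJ, if_true] at hm
    obtain ⟨hθm, z, S, hS, hbS, hSx, hSm, hSv⟩ := exists_rotated_interval hk hkn (hs m) (hθ0 m)
      ((mul_le_mul_of_nonneg_left (crossRadius_mono (Nat.sub_le _ _)) (hθ0 m)).trans (hθρ m)) γ hm
    have hr0 : 0 < θ m * s m := mul_pos hθm (hs m)
    have hSv' : volume.real S = (θ m * s m) ^ n *
        (2 ^ (n + (k - 1)) * 2 ^ ((n + 1 - k) * (J m - l))) := by
      rw [Measure.real, hSv, ENNReal.toReal_mul, ENNReal.toReal_pow, ENNReal.toReal_ofReal hr0.le,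
        ENNReal.toReal_ofReal (by positivity)]
    refine ⟨J m, hlJ, S, hS, hSx.trans (Metric.ball_subset_ball (hmε.le.trans (min_le_left _ _))),
      hSm, by rw [hSv']; positivity, ?_⟩
    have h1 := hball m z hθm (hbS.trans (hSx.trans
      ((Metric.ball_subset_ball (hmε.le.trans (min_le_right _ _))).trans hεQ)))
    rw [volume_ball_eq hn _ hr0.le] at h1
    have h2 : volume (H m ∩ Metric.ball (latticePoint (s m) z) (θ m * s m)) ≤
        volume ((⋃ i, H (Nat.pair (J m) i)) ∩ S) := by
      refine measure_mono (inter_subset_inter ?_ hbS)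
      have : Nat.pair (J m) m.unpair.2 = m := Nat.pair_unpair m
      intro y hy
      exact mem_iUnion_of_mem m.unpair.2 (by rwa [this])
    have hfin : volume ((⋃ i, H (Nat.pair (J m) i)) ∩ S) ≠ ∞ :=
      ((measure_mono (inter_subset_right.trans hSx)).trans_lt measure_ball_lt_top).ne
    have h3 := ENNReal.toReal_mono (by finiteness) (h1.trans (mul_le_mul_right h2 2))
    rw [ENNReal.toReal_mul, ENNReal.toReal_pow, ENNReal.toReal_ofReal hr0.le, ENNReal.toReal_mul,
      ENNReal.toReal_ofNat] at h3
    change _ * v ≤ 2 * volume.real ((⋃ i, H (Nat.pair (J m) i)) ∩ S) at h3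
    rw [hSv']
    have h4 : (0 : ℝ) < 2 ^ ((n + 1 - k) * (J m - l)) := by positivity
    calc v / (2 * 2 ^ (n + (k - 1))) * ((θ m * s m) ^ n *
          (2 ^ (n + (k - 1)) * 2 ^ ((n + 1 - k) * (J m - l))))
        = 2 ^ ((n + 1 - k) * (J m - l)) * ((θ m * s m) ^ n * v / 2) := by
          field_simp
      _ ≤ _ := by gcongr; linarith

/-! ### Rearranging functions outside the Zygmund class -/

/-- Arbitrarily small sets of `B x` with arbitrarily large means make the upper derivative infinite. -/
theorem upperDeriv_eq_top {n : ℕ} {B : RSpace n → Set (Set (RSpace n))} {f : RSpace n → ℝ}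
    {x : RSpace n} (h : ∀ C : ℝ, ∀ ε > 0, ∃ S ∈ B x, S ⊆ Metric.ball x ε ∧ C ≤ ⨍ y in S, f y) :
    upperDeriv B f x = ⊤ := by
  rw [EReal.eq_top_iff_forall_lt]
  intro C
  refine lt_of_lt_of_le (EReal.coe_lt_coe_iff.2 (lt_add_one C)) ?_
  refine le_limsup_of_frequently_le ?_
  rw [frequently_inf_principal, ((ENNReal.nhds_zero_basis).comap _).frequently_iff]
  intro ε hε
  obtain ⟨δ, hδ, hδε⟩ := ENNReal.lt_iff_exists_nnreal_btwn.1 hε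
  have hδ' : (0 : ℝ) < δ := by exact_mod_cast hδ
  obtain ⟨S, hS, hSx, hC⟩ := h (C + 1) (δ / 2) (by positivity)
  refine ⟨S, ?_, hS, EReal.coe_le_coe_iff.2 hC⟩
  refine lt_of_le_of_lt ?_ hδε
  refine (Metric.ediam_mono hSx).trans ?_
  refine Metric.ediam_le fun y hy z hz => ?_
  rw [edist_dist, ← ENNReal.ofReal_coe_nnreal]
  refine ENNReal.ofReal_le_ofReal ?_
  have := dist_triangle_right y z x
  rw [Metric.mem_ball] at hy hz
  linarith

theorem integrable_of_mem_classL {n : ℕ} {f : RSpace n → ℝ} (hf : f ∈ classL n) :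
    Integrable f := by
  refine ⟨hf.1.aestronglyMeasurable, ?_⟩
  refine lt_of_le_of_lt ?_ hf.2.2
  have e : (fun x => ENNReal.ofReal |f x|) = {x | f x ≠ 0}.indicator fun x => ENNReal.ofReal |f x| := by
    ext x
    by_cases h : f x = 0 <;> simp [h]
  calc ∫⁻ x, ‖f x‖ₑ = ∫⁻ x, {x | f x ≠ 0}.indicator (fun x => ENNReal.ofReal |f x|) x := by
        rw [← e]
        refine lintegral_congr fun x => ?_
        rw [← Real.norm_eq_abs, ofReal_norm]
    _ ≤ _ := lintegral_indicator_le _ _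

/-- The `j`-th dyadic layer `{2 ^ (d j) ≤ |f| < 2 ^ (d (j + 1))}`. -/
def layer {n : ℕ} (d : ℕ) (f : RSpace n → ℝ) (j : ℕ) : Set (RSpace n) :=
  {x | 2 ^ (d * j) ≤ |f x| ∧ |f x| < 2 ^ (d * (j + 1))}

theorem measurableSet_layer {n : ℕ} (d : ℕ) {f : RSpace n → ℝ} (hf : Measurable f) (j : ℕ) :
    MeasurableSet (layer d f j) :=
  (measurableSet_le measurable_const hf.abs).inter (measurableSet_lt hf.abs measurable_const)

theorem pairwise_disjoint_layer {n : ℕ} (d : ℕ) (f : RSpace n → ℝ) :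
    Pairwise (Function.onFun Disjoint (layer d f)) := by
  have key : ∀ i j, i < j → Disjoint (layer d f i) (layer d f j) := fun i j hij =>
    Set.disjoint_left.2 fun x hx hx' => by
      have : (2 : ℝ) ^ (d * (i + 1)) ≤ 2 ^ (d * j) :=
        pow_le_pow_right₀ one_le_two (Nat.mul_le_mul_left d hij)
      linarith [hx.2, hx'.1]
  intro i j hij
  rcases lt_or_gt_of_ne hij with h | h
  exacts [key i j h, (key j i h).symm]

theorem lintegral_le_tsum_layer {n d p : ℕ} (hd : d ≠ 0) (hp : p ≠ 0) {f : RSpace n → ℝ}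
    (hf : Measurable f) :
    ∫⁻ x, ENNReal.ofReal (|f x| * (max (Real.log |f x|) 0) ^ p) ≤
      ∑' j, ENNReal.ofReal (2 ^ (d * (j + 1)) * ((d * (j + 1) : ℕ) : ℝ) ^ p) * volume (layer d f j) := by
  have hpt : ∀ x, ENNReal.ofReal (|f x| * (max (Real.log |f x|) 0) ^ p) ≤
      ∑' j, (layer d f j).indicator
        (fun _ => ENNReal.ofReal (2 ^ (d * (j + 1)) * ((d * (j + 1) : ℕ) : ℝ) ^ p)) x := by
    intro x
    rcases lt_or_ge |f x| 1 with h | h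
    · have : max (Real.log |f x|) 0 = 0 := max_eq_right (Real.log_nonpos (abs_nonneg _) h.le)
      rw [this, zero_pow hp, mul_zero, ENNReal.ofReal_zero]
      exact zero_le
    · obtain ⟨j, hj1, hj2⟩ := exists_nat_pow_near h (one_lt_pow₀ (one_lt_two (α := ℝ)) hd)
      rw [← pow_mul] at hj1 hj2
      refine le_trans ?_ (ENNReal.le_tsum j)
      rw [indicator_of_mem (show x ∈ layer d f j from ⟨hj1, hj2⟩)]
      refine ENNReal.ofReal_le_ofReal ?_
      have hlog : max (Real.log |f x|) 0 ≤ ((d * (j + 1) : ℕ) : ℝ) := by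
        refine max_le ?_ (Nat.cast_nonneg _)
        have h1 := Real.log_le_log (by linarith) hj2.le
        rw [Real.log_pow] at h1
        refine h1.trans (mul_le_of_le_one_right (Nat.cast_nonneg _) ?_)
        linarith [Real.log_two_lt_d9]
      gcongr
  calc _ ≤ _ := lintegral_mono hpt
    _ = _ := by
      rw [lintegral_tsum fun j => (measurable_const.indicator (measurableSet_layer d hf j)).aemeasurable]
      refine tsum_congr fun j => ?_
      rw [lintegral_indicator_const (measurableSet_layer d hf j)]

/-- The failure of `L (ln⁺ L) ^ (k - 1)` integrability, expressed through the measures of the dyadic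
layers and of the hyperbolic crosses of any index lag `l`. -/
theorem not_summable_layer {n k : ℕ} (hk : 2 ≤ k) (hkn : k ≤ n) {f : RSpace n → ℝ} (hf : Measurable f)
    (hfin : ∀ j, volume (layer (n + 1 - k) f j) ≠ ∞)
    (hinf : ∫⁻ x, ENNReal.ofReal (|f x| * (max (Real.log |f x|) 0) ^ (k - 1)) = ∞) (l : ℕ) :
    ¬ Summable fun j => volume.real (layer (n + 1 - k) f j) *
      if l ≤ j then volume.real (hyperbolicCross n k (j - l)) else 0 := by
  set d := n + 1 - k with hd
  have hd0 : d ≠ 0 := by omega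
  intro hsum
  let c : ℕ → ℝ := fun j => 2 ^ (d * (j + 1)) * ((d * (j + 1) : ℕ) : ℝ) ^ (k - 1)
  have hc0 : ∀ j, 0 ≤ c j := fun j => by positivity
  have hc : ∀ i, c (i + l) ≤ 2 ^ (d * (l + 1)) * ((d * (k * (l + 1)) : ℕ) : ℝ) ^ (k - 1) *
      volume.real (hyperbolicCross n k i) := by
    intro i
    have h1 : d * (i + l + 1) ≤ d * (k * (l + 1)) * (i / k + 1) := by
      rw [mul_assoc]
      refine Nat.mul_le_mul_left d ?_
      have : i < k * (i / k + 1) := by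
        rw [mul_add, mul_one]
        exact Nat.lt_mul_div_succ i (by omega)
      nlinarith
    have h2 : ((d * (i + l + 1) : ℕ) : ℝ) ≤ ((d * (k * (l + 1)) : ℕ) : ℝ) * ((i / k + 1 : ℕ) : ℝ) := by
      exact_mod_cast h1
    calc c (i + l) = 2 ^ (d * (i + l + 1)) * ((d * (i + l + 1) : ℕ) : ℝ) ^ (k - 1) := rfl
      _ ≤ 2 ^ (d * (i + l + 1)) *
          (((d * (k * (l + 1)) : ℕ) : ℝ) * ((i / k + 1 : ℕ) : ℝ)) ^ (k - 1) := by gcongr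
      _ = _ := by
        rw [volume_hyperbolicCross hk hkn, mul_pow, ← hd]
        have : d * (i + l + 1) = d * (l + 1) + d * i := by ring
        rw [this, pow_add]
        ring
  have hs2 : Summable fun i => c (i + l) * volume.real (layer d f (i + l)) := by
    refine Summable.of_nonneg_of_le (fun i => mul_nonneg (hc0 _) measureReal_nonneg) (fun i => ?_)
      (((summable_nat_add_iff l).2 hsum).mul_left
        (2 ^ (d * (l + 1)) * ((d * (k * (l + 1)) : ℕ) : ℝ) ^ (k - 1)))
    rw [if_pos (Nat.le_add_left l i), Nat.add_sub_cancel]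
    calc _ ≤ _ := mul_le_mul_of_nonneg_right (hc i) measureReal_nonneg
      _ = _ := by ring
  have hs3 : Summable fun i => c i * volume.real (layer d f i) :=
    (summable_nat_add_iff (f := fun i => c i * volume.real (layer d f i)) l).1 hs2
  have h1 := lintegral_le_tsum_layer (p := k - 1) hd0 (by omega) hf
  rw [hinf] at h1
  have h2 : ∀ j, ENNReal.ofReal (2 ^ (d * (j + 1)) * ((d * (j + 1) : ℕ) : ℝ) ^ (k - 1)) *
      volume (layer d f j) = ENNReal.ofReal (c j * volume.real (layer d f j)) := fun j => by
    rw [ENNReal.ofReal_mul (hc0 j), ofReal_measureReal (hfin j)]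
  simp_rw [h2] at h1
  rw [← ENNReal.ofReal_tsum_of_nonneg (fun j => mul_nonneg (hc0 j) measureReal_nonneg) hs3] at h1
  exact absurd h1 (by simp)

/-- The section of the cube by a coordinate hyperplane. -/
theorem exists_uncountable_null_subset {n : ℕ} (hn : 2 ≤ n) :
    ∃ Z ⊆ unitCube n, MeasurableSet Z ∧ volume Z = 0 ∧ ¬ Z.Countable := by
  let I : Fin n → Set ℝ := fun i => if (i : ℕ) = 0 then {1 / 2} else Ioo 0 1
  refine ⟨{x | ∀ i, x i ∈ I i}, fun x hx i => ?_, ?_, ?_, fun hc => ?_⟩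
  · have := hx i
    simp only [I] at this
    split_ifs at this
    · rw [mem_singleton_iff.1 this]; norm_num
    · exact this
  · rw [ofPred_forall]
    refine MeasurableSet.iInter fun i => ?_
    have hm : Measurable fun x : RSpace n => x i := by fun_prop
    simp only [I]
    split_ifs
    exacts [hm (measurableSet_singleton _), hm measurableSet_Ioo]
  · rw [volume_coordBox]
    exact Finset.prod_eq_zero (Finset.mem_univ (⟨0, by omega⟩ : Fin n)) (by simp [I])
  · let φ : ℝ → RSpace n := fun t => WithLp.toLp 2 fun i => if (i : ℕ) = 0 then 1 / 2 else t
    have hφ : InjOn φ (Ioo 0 1) := fun s _ t _ h => by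
      have := congrArg (fun x : RSpace n => x ⟨1, by omega⟩) h
      simpa [φ] using this
    have himg : φ '' Ioo 0 1 ⊆ {x | ∀ i, x i ∈ I i} := by
      rintro _ ⟨t, ht, rfl⟩ i
      simp only [φ, I]
      split_ifs
      · rfl
      · exact ht
    have h1 : (Ioo (0 : ℝ) 1).Countable := countable_of_injective_of_countable_image hφ (hc.mono himg)
    have h2 := h1.measure_zero volume
    simp at h2

/-- Any summable function on the cube that is not in `L (ln⁺ L) ^ (k - 1)` can be rearranged so that
the means of its absolute value diverge for all rotations of the basis. -/
theorem exists_rearrangement_mem_divergenceClass {n k : ℕ} (hk : 2 ≤ k) (hkn : k ≤ n)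
    {f : RSpace n → ℝ} (hf : f ∈ classL n) (hf' : f ∉ classLLog n (k - 1)) :
    ∃ ω : RSpace n ≃ᵐ RSpace n, MeasurePreserving ω volume volume ∧ {x | ω x ≠ x} ⊆ unitCube n ∧
      (fun x => |f (ω x)|) ∈ divergenceClass (rotatedFamily (intervalBasis n k)) := by
  set Q := unitCube n with hQ
  set d := n + 1 - k with hd
  have hQm : MeasurableSet Q := measurableSet_unitCube n
  have hQ1 : volume Q = 1 := volume_unitCube n
  let h : RSpace n → ℝ := Q.indicator (hf.1.mk f)
  have hm : Measurable h := hf.1.measurable_mk.indicator hQm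
  have hfh : f =ᵐ[volume] h := by
    filter_upwards [hf.1.ae_eq_mk] with x hx
    by_cases hxQ : x ∈ Q
    · rw [hx, show h x = _ from indicator_of_mem hxQ _]
    · rw [show h x = 0 from indicator_of_notMem hxQ _]
      by_contra hne
      exact hxQ (hf.2.1 hne)
  have hlayer : ∀ j, layer d h j ⊆ Q := by
    intro j x hx
    by_contra hxQ
    have h1 := hx.1
    rw [show h x = 0 from indicator_of_notMem hxQ _, abs_zero] at h1
    exact absurd h1 (not_le.2 (by positivity))
  have hfin : ∀ j, volume (layer d h j) ≠ ∞ := fun j =>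
    ((measure_mono (hlayer j)).trans_lt (by rw [hQ1]; simp)).ne
  have hinf : ∫⁻ x, ENNReal.ofReal (|h x| * (max (Real.log |h x|) 0) ^ (k - 1)) = ∞ := by
    by_contra hne
    refine hf' ⟨hf.1, hf.2.1, ?_⟩
    calc _ ≤ ∫⁻ x, ENNReal.ofReal (|f x| * (max (Real.log |f x|) 0) ^ (k - 1)) :=
          setLIntegral_le_lintegral _ _
      _ = ∫⁻ x, ENNReal.ofReal (|h x| * (max (Real.log |h x|) 0) ^ (k - 1)) :=
          lintegral_congr_ae (hfh.mono fun x hx => by simp only [hx])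
      _ < ∞ := lt_top_iff_ne_top.2 hne
  have hlm := measurableSet_layer d hm
  have hld := pairwise_disjoint_layer d h
  obtain ⟨G, hGm, hGQ, hGd, hGb, κ, hκ, hG⟩ := exists_spread_sets hk hkn
    (b := fun j => volume.real (layer d h j)) (fun j => measureReal_nonneg)
    (by
      rw [tsum_congr fun j => ofReal_measureReal (hfin j), ← measure_iUnion hld hlm, ← hQ1]
      exact measure_mono (iUnion_subset hlayer))
    (not_summable_layer hk hkn hm hfin hinf)
  obtain ⟨Z, hZQ, hZm, hZ0, hZ⟩ := exists_uncountable_null_subset (hk.trans hkn)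
  have : Nontrivial (RSpace n) := Module.nontrivial_of_finrank_pos (R := ℝ) (by simp; omega)
  obtain ⟨ω, hω, hωQ, hωG⟩ := exists_rearrangement (μ := volume) hQm (by rw [hQ1]; simp) hZm hZ0 hZ hZQ
    hGm hlm hGQ hlayer hGd hld (fun j => (hGb j).trans_eq (ofReal_measureReal (hfin j)))
  have hfi := integrable_of_mem_classL hf
  have hgi : Integrable fun x => |f (ω x)| := (hω.integrable_comp_of_integrable hfi).abs
  refine ⟨ω, hω, hωQ, ⟨?_, ?_, ?_⟩, ?_⟩
  · exact hgi.aestronglyMeasurable.aemeasurable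
  · intro x hx
    by_contra hxQ
    have h1 : ω x = x := by
      by_contra hne
      exact hxQ (hωQ hne)
    refine hxQ (hf.2.1 ?_)
    simpa [h1] using hx
  · refine lt_of_le_of_lt (setLIntegral_le_lintegral _ _) ?_
    have := hgi.2
    rw [hasFiniteIntegral_iff_norm] at this
    simpa using this
  · rintro _ ⟨γ, -, rfl⟩
    rw [ae_restrict_iff' hQm, ae_iff]
    refine measure_mono_null ?_ (measure_iUnion_null fun l => hG γ l)
    intro x hx
    simp only [mem_ofPred_eq, Classical.not_imp] at hx
    by_contra hcon
    simp only [mem_iUnion, mem_ofPred_eq, not_exists, not_and, not_not] at hcon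
    refine hx.2 (upperDeriv_eq_top fun C ε hε => ?_)
    obtain ⟨l, hl⟩ := exists_nat_gt (C / κ)
    obtain ⟨j, hj, S, hS, hSε, hSm, hS0, hSG⟩ := hcon l hx.1 ε hε
    refine ⟨S, hS, hSε, ?_⟩
    have hGS : MeasurableSet (G j ∩ S) := (hGm j).inter hSm
    have hSf : volume S ≠ ∞ := ((measure_mono hSε).trans_lt measure_ball_lt_top).ne
    have hge : ∀ᵐ y ∂(volume.restrict (G j ∩ S)), (2 : ℝ) ^ (d * j) ≤ |f (ω y)| := by
      have h1 := ae_restrict_of_ae_restrict_of_subset (inter_subset_left : G j ∩ S ⊆ G j) (hωG j)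
      have h2 := ae_restrict_of_ae (s := G j ∩ S) (hω.quasiMeasurePreserving.ae hfh)
      filter_upwards [h1, h2] with y hy1 hy2
      rw [hy2]
      exact hy1.1
    have hint : 2 ^ (d * j) * volume.real (G j ∩ S) ≤ ∫ y in S, |f (ω y)| := by
      calc _ = ∫ _y in G j ∩ S, (2 : ℝ) ^ (d * j) := by
            rw [setIntegral_const, smul_eq_mul, mul_comm]
        _ ≤ ∫ y in G j ∩ S, |f (ω y)| := by
            refine setIntegral_mono_ae_restrict ?_ hgi.integrableOn hge
            exact integrableOn_const ((measure_mono inter_subset_right).trans_lt hSf.lt_top).ne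
        _ ≤ _ := setIntegral_mono_set hgi.integrableOn (Eventually.of_forall fun y => abs_nonneg _)
            (Eventually.of_forall fun y hy => hy.2)
    rw [setAverage_eq, smul_eq_mul, inv_mul_eq_div, le_div_iff₀ hS0]
    refine le_trans ?_ hint
    have hpow : (2 : ℝ) ^ (d * j) = 2 ^ (d * l) * 2 ^ (d * (j - l)) := by
      rw [← pow_add, ← mul_add, Nat.add_sub_cancel' hj]
    have hd1 : 1 ≤ d := by omega
    have hl2 : (l : ℝ) ≤ 2 ^ (d * l) := by
      have : l < 2 ^ (d * l) := Nat.lt_two_pow_self.trans_le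
        (Nat.pow_le_pow_right two_pos (Nat.le_mul_of_pos_left l hd1))
      exact_mod_cast this.le
    have hC : C ≤ 2 ^ (d * l) * κ := by
      rw [div_lt_iff₀ hκ] at hl
      nlinarith
    calc C * volume.real S ≤ 2 ^ (d * l) * κ * volume.real S := by gcongr
      _ = 2 ^ (d * l) * (κ * volume.real S) := by ring
      _ ≤ 2 ^ (d * l) * (2 ^ (d * (j - l)) * volume.real (G j ∩ S)) := by gcongr
      _ = _ := by rw [hpow]; ring

/-! ### Orlicz spaces and well-spread open sets -/

/-- A Young function dominates a linear function of positive slope up to a constant, by convexity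
and since it is not identically zero. -/
theorem YoungFunction.exists_linear_le (ψ : YoungFunction) :
    ∃ α > 0, ∃ β ≥ 0, ∀ t ≥ 0, α * t ≤ ψ t + β := by
  obtain ⟨t0, ht0, hψ0⟩ := ψ.exists_pos
  refine ⟨ψ t0 / t0, by positivity, ψ t0, hψ0.le, fun t ht => ?_⟩
  rcases le_or_gt t0 t with h | h
  · have htpos : 0 < t := ht0.trans_le h
    have h1 : t0 / t ≤ 1 := by rwa [div_le_one htpos]
    have h2 := ψ.convexOn.2 (mem_Ici.2 (le_refl (0 : ℝ))) (mem_Ici.2 ht) (sub_nonneg.2 h1)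
      (div_nonneg ht0.le ht) (by ring)
    simp only [smul_eq_mul, mul_zero, zero_add, ψ.map_zero] at h2
    rw [div_mul_cancel₀ _ htpos.ne'] at h2
    have h3 : ψ t0 / t0 * t ≤ ψ t := by
      calc ψ t0 / t0 * t ≤ (t0 / t * ψ t) / t0 * t := by gcongr
        _ = ψ t := by field_simp
    linarith
  · have h1 : ψ t0 / t0 * t ≤ ψ t0 := by
      rw [div_mul_eq_mul_div, div_le_iff₀ ht0]
      gcongr
    linarith [ψ.nonneg t ht]

theorem YoungFunction.ofReal_linear_le (ψ : YoungFunction) :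
    ∃ C ≥ (0 : ℝ), ∃ β ≥ (0 : ℝ), ∀ t ≥ 0,
      ENNReal.ofReal t ≤ ENNReal.ofReal C * (ENNReal.ofReal (ψ t) + ENNReal.ofReal β) := by
  obtain ⟨α, hα, β, hβ, h⟩ := ψ.exists_linear_le
  refine ⟨α⁻¹, by positivity, β, hβ, fun t ht => ?_⟩
  rw [← ENNReal.ofReal_add (ψ.nonneg t ht) hβ, ← ENNReal.ofReal_mul (by positivity)]
  refine ENNReal.ofReal_le_ofReal ?_
  rw [inv_mul_eq_div, le_div_iff₀ hα, mul_comm]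
  exact h t ht

theorem phiClass_subset_classL {n : ℕ} (ψ : YoungFunction) :
    phiClass ψ (unitCube n) ⊆ classL n := by
  obtain ⟨C, hC, β, hβ, h⟩ := ψ.ofReal_linear_le
  intro f hf
  refine ⟨hf.1, hf.2.1, ?_⟩
  have hv : volume {x | f x ≠ 0} < ∞ :=
    (measure_mono hf.2.1).trans_lt (by rw [volume_unitCube]; simp)
  have hlt := hf.2.2
  calc ∫⁻ x in {x | f x ≠ 0}, ENNReal.ofReal |f x|
      ≤ ∫⁻ x in {x | f x ≠ 0}, ENNReal.ofReal C * (ENNReal.ofReal (ψ |f x|) + ENNReal.ofReal β) :=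
        lintegral_mono fun x => h _ (abs_nonneg _)
    _ = ENNReal.ofReal C * ((∫⁻ x in {x | f x ≠ 0}, ENNReal.ofReal (ψ |f x|)) +
          ENNReal.ofReal β * volume {x | f x ≠ 0}) := by
        rw [lintegral_const_mul' _ _ ENNReal.ofReal_ne_top, lintegral_add_right _ measurable_const,
          setLIntegral_const]
    _ < ∞ := by finiteness

/-- The Luxemburg norm controls the `L¹` norm on the unit cube. -/
theorem exists_integral_abs_le_of_luxemburgNorm_lt {n : ℕ} (ψ : YoungFunction) :
    ∃ C ≥ (0 : ℝ), ∀ (u : RSpace n → ℝ) (δ : ℝ), Integrable u → (∀ x ∉ unitCube n, u x = 0) →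
      luxemburgNorm ψ u < ENNReal.ofReal δ → ∫ x, |u x| ≤ C * δ := by
  obtain ⟨C, hC, β, hβ, h⟩ := ψ.ofReal_linear_le
  refine ⟨C * (1 + β), by positivity, fun u δ hui huQ hu => ?_⟩
  simp only [luxemburgNorm, iInf_lt_iff] at hu
  obtain ⟨c, ⟨hc, hI⟩, hcδ⟩ := hu
  have hcδ' : c < δ := (ENNReal.ofReal_lt_ofReal_iff_of_nonneg hc.le).1 hcδ
  have h1 : ∫⁻ x, ENNReal.ofReal (|u x| / c) ≤ ENNReal.ofReal (C * (1 + β)) := by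
    calc ∫⁻ x, ENNReal.ofReal (|u x| / c) = ∫⁻ x in unitCube n, ENNReal.ofReal (|u x| / c) := by
          rw [setLIntegral_eq_of_support_subset]
          intro x hx
          by_contra hxQ
          exact hx (by simp [huQ x hxQ])
      _ ≤ ∫⁻ x in unitCube n,
            ENNReal.ofReal C * (ENNReal.ofReal (ψ (|u x| / c)) + ENNReal.ofReal β) :=
          lintegral_mono fun x => h _ (by positivity)
      _ = ENNReal.ofReal C * ((∫⁻ x in unitCube n, ENNReal.ofReal (ψ (|u x| / c))) +
            ENNReal.ofReal β * 1) := by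
          rw [lintegral_const_mul' _ _ ENNReal.ofReal_ne_top, lintegral_add_right _ measurable_const,
            setLIntegral_const, volume_unitCube]
      _ ≤ ENNReal.ofReal C * (1 + ENNReal.ofReal β * 1) := by
          gcongr
          exact (setLIntegral_le_lintegral _ _).trans hI
      _ = _ := by
          rw [mul_one, ← ENNReal.ofReal_one, ← ENNReal.ofReal_add zero_le_one hβ,
            ← ENNReal.ofReal_mul hC]
  have h2 : ∫ x, |u x| / c ≤ C * (1 + β) := by
    rw [integral_eq_lintegral_of_nonneg_ae (Eventually.of_forall fun x => by positivity)
      (hui.abs.div_const c).aestronglyMeasurable]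
    exact ENNReal.toReal_le_of_le_ofReal (by positivity) h1
  rw [integral_div, div_le_iff₀ hc] at h2
  exact h2.trans (by gcongr)

theorem luxemburgNorm_le {n : ℕ} {ψ : YoungFunction} {u : RSpace n → ℝ} {c : ℝ} (hc : 0 < c)
    (h : ∫⁻ x, ENNReal.ofReal (ψ (|u x| / c)) ≤ 1) : luxemburgNorm ψ u ≤ ENNReal.ofReal c :=
  iInf₂_le c ⟨hc, h⟩

/-- Under the `Δ₂`-condition, bounded functions are dense in the Orlicz space. -/
theorem exists_bounded_approx {n : ℕ} {ψ : YoungFunction} (hψ : DeltaTwo ψ) {f : RSpace n → ℝ}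
    (hf : f ∈ phiClass ψ (unitCube n)) {ε : ℝ} (hε : 0 < ε) :
    ∃ T ≥ 0, ∃ g : RSpace n → ℝ, AEMeasurable g volume ∧ (∀ x ∉ unitCube n, g x = 0) ∧
      (∀ x, |g x| ≤ T) ∧ luxemburgNorm ψ (fun x => f x - g x) ≤ ENNReal.ofReal ε := by
  obtain ⟨c, hc, τ, hτ, hΔ⟩ := hψ
  have hiter : ∀ (N : ℕ) (t : ℝ), τ < t → ψ (2 ^ N * t) ≤ c ^ N * ψ t := by
    intro N t ht
    induction N with
    | zero => simp
    | succ N ih =>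
      have h1 : τ < 2 ^ N * t :=
        ht.trans_le (le_mul_of_one_le_left (hτ.trans ht).le (one_le_pow₀ one_le_two))
      calc ψ (2 ^ (N + 1) * t) = ψ (2 * (2 ^ N * t)) := by congr 1; ring
        _ ≤ c * ψ (2 ^ N * t) := hΔ _ h1
        _ ≤ c * (c ^ N * ψ t) := by gcongr
        _ = _ := by ring
  obtain ⟨N, hN⟩ := pow_unbounded_of_one_lt ε⁻¹ (one_lt_two (α := ℝ))
  have hbd : ∀ t, τ < t → ψ (t / ε) ≤ c ^ N * ψ t := by
    intro t ht
    have ht0 : 0 < t := hτ.trans ht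
    refine (ψ.monotoneOn (mem_Ici.2 (by positivity)) (mem_Ici.2 (by positivity)) ?_).trans (hiter N t ht)
    rw [div_eq_inv_mul]
    gcongr
  let cut : ℕ → ℝ → ℝ := fun m t => if |t| ≤ m + τ then t else 0
  have hcut : ∀ m, Measurable (cut m) := fun m =>
    Measurable.ite (measurableSet_le measurable_id.abs measurable_const) measurable_id measurable_const
  let u : ℕ → RSpace n → ℝ := fun m x => f x - cut m (f x)
  have hu : ∀ m, AEMeasurable (u m) volume := fun m => hf.1.sub ((hcut m).comp_aemeasurable hf.1)
  have hlim : Tendsto (fun m => ∫⁻ x, ENNReal.ofReal (ψ (|u m x| / ε))) atTop (𝓝 (∫⁻ _x : RSpace n, 0)) := by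
    refine tendsto_lintegral_of_dominated_convergence'
      ({x | f x ≠ 0}.indicator fun x => ENNReal.ofReal (c ^ N) * ENNReal.ofReal (ψ |f x|))
      (fun m => ψ.aemeasurable (hu m) ε hε) (fun m => Eventually.of_forall fun x => ?_) ?_
      (Eventually.of_forall fun x => ?_)
    · by_cases hx : |f x| ≤ m + τ
      · simp [u, cut, hx, ψ.map_zero]
      · have hx' : τ < |f x| := by
          push Not at hx
          linarith [(Nat.cast_nonneg m : (0 : ℝ) ≤ m)]
        have hne : f x ≠ 0 := abs_pos.1 (hτ.trans hx')
        rw [indicator_of_mem (show x ∈ {x | f x ≠ 0} from hne), ← ENNReal.ofReal_mul (by positivity)]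
        simp only [u, cut, hx, if_false, sub_zero]
        exact ENNReal.ofReal_le_ofReal (hbd _ hx')
    · refine (lt_of_le_of_lt (lintegral_indicator_le _ _) ?_).ne
      rw [lintegral_const_mul' _ _ ENNReal.ofReal_ne_top]
      exact ENNReal.mul_lt_top ENNReal.ofReal_lt_top hf.2.2
    · refine tendsto_const_nhds.congr' ?_
      filter_upwards [eventually_ge_atTop ⌈|f x|⌉₊] with m hm
      have hx : |f x| ≤ m + τ := by
        have h1 : (⌈|f x|⌉₊ : ℝ) ≤ m := by exact_mod_cast hm
        linarith [Nat.le_ceil |f x|]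
      simp [u, cut, hx, ψ.map_zero]
  rw [lintegral_zero] at hlim
  obtain ⟨m, hm⟩ := (hlim.eventually (ge_mem_nhds (zero_lt_one (α := ℝ≥0∞)))).exists
  refine ⟨m + τ, by positivity, fun x => cut m (f x), (hcut m).comp_aemeasurable hf.1,
    fun x hx => ?_, fun x => ?_, luxemburgNorm_le hε hm⟩
  · have : f x = 0 := by
      by_contra hne
      exact hx (hf.2.1 hne)
    simp [cut, this]
  · simp only [cut]
    split_ifs with h
    · exact h
    · simp only [abs_zero]; positivity

/-- The growth condition on `ψ`, at the heights that belong to the hyperbolic crosses. -/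
theorem exists_mul_le_volume_hyperbolicCross {n k : ℕ} (hk : 2 ≤ k) (hkn : k ≤ n) {ψ : YoungFunction}
    (hψ : Tendsto (fun h : ℝ => ψ h / (h * Real.log h ^ (k - 1))) atTop (𝓝 0)) {H Λ : ℝ}
    (hH : 0 < H) (hΛ : 0 < Λ) :
    ∃ K : ℕ, ψ (H * 2 ^ ((n + 1 - k) * K)) * Λ ≤ volume.real (hyperbolicCross n k K) := by
  set d := n + 1 - k with hd
  have hd1 : 1 ≤ d := by omega
  set D : ℝ := |Real.log H| + d * k with hD
  have hD0 : 0 < D := by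
    have : (0 : ℝ) < d * k := by
      have : 0 < d * k := Nat.mul_pos (by omega) (by omega)
      exact_mod_cast this
    positivity
  have htend : Tendsto (fun K : ℕ => H * (2 : ℝ) ^ (d * K)) atTop atTop := by
    refine Tendsto.const_mul_atTop hH ?_
    have h1 := tendsto_pow_atTop_atTop_of_one_lt (one_lt_pow₀ (one_lt_two (α := ℝ)) (n := d) (by omega))
    exact h1.congr fun K => (pow_mul _ _ _).symm
  set ε : ℝ := (Λ * H * D ^ (k - 1))⁻¹ with hε
  have hε0 : 0 < ε := by positivity
  obtain ⟨K, hK1, hK2⟩ := ((htend.eventually (hψ.eventually (gt_mem_nhds hε0))).and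
    (htend.eventually (eventually_gt_atTop 1))).exists
  refine ⟨K, ?_⟩
  set h := H * (2 : ℝ) ^ (d * K) with hh
  have hlog0 : 0 < Real.log h := Real.log_pos hK2
  have h0 : 0 < h := by linarith
  have hlog : Real.log h ≤ D * ((K / k + 1 : ℕ) : ℝ) := by
    have h1 : (K : ℝ) ≤ k * ((K / k + 1 : ℕ) : ℝ) := by
      have : K < k * (K / k + 1) := Nat.lt_mul_div_succ K (by omega)
      exact_mod_cast this.le
    have h2 : (1 : ℝ) ≤ ((K / k + 1 : ℕ) : ℝ) := by exact_mod_cast Nat.le_add_left 1 _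
    have h3 : Real.log h ≤ |Real.log H| + d * K := by
      rw [hh, Real.log_mul hH.ne' (by positivity), Real.log_pow, Nat.cast_mul]
      refine add_le_add (le_abs_self _) (mul_le_of_le_one_right (by positivity) ?_)
      linarith [Real.log_two_lt_d9]
    calc Real.log h ≤ |Real.log H| + d * K := h3
      _ ≤ |Real.log H| * ((K / k + 1 : ℕ) : ℝ) + d * (k * ((K / k + 1 : ℕ) : ℝ)) := by
          gcongr
          exact le_mul_of_one_le_right (abs_nonneg _) h2
      _ = _ := by rw [hD]; ring
  have h4 : ψ h ≤ ε * (h * Real.log h ^ (k - 1)) := by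
    rw [← div_le_iff₀ (by positivity)]
    exact hK1.le
  rw [volume_hyperbolicCross hk hkn, ← hd]
  calc ψ h * Λ ≤ ε * (h * (D * ((K / k + 1 : ℕ) : ℝ)) ^ (k - 1)) * Λ := by
        refine mul_le_mul_of_nonneg_right (h4.trans ?_) hΛ.le
        gcongr
    _ = _ := by
        rw [mul_pow, hε, hh]
        field_simp

/-- A lattice-like open set `W` of small measure, such that, for every rotation, all points of the
cube but for a set of measure at most `p` lie in small rotated intervals, of measure bounded below,
in which `W` has density at least about `2 ^ (-d K)`, where `d = n - k + 1`. -/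
theorem exists_spread_open {n k : ℕ} (hk : 2 ≤ k) (hkn : k ≤ n) (K : ℕ) {δ p : ℝ} (hδ : 0 < δ)
    (hp : 0 < p) (hp1 : p ≤ 1) :
    ∃ W : Set (RSpace n), IsOpen W ∧
      volume.real (W ∩ unitCube n) ≤ 2 * volume.real (Metric.ball (0 : RSpace n) 1) *
        (1 - Real.log (p / 2)) / volume.real (hyperbolicCross n k K) ∧
      ∃ v > 0, ∀ γ : RSpace n ≃ₗᵢ[ℝ] RSpace n,
        volume {x | x ∈ unitCube n ∧ ¬ ∃ S ∈ rotate (intervalBasis n k) γ x,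
          S ⊆ Metric.ball x δ ∧ MeasurableSet S ∧ v ≤ volume.real S ∧
          volume.real (Metric.ball (0 : RSpace n) 1) / 2 ^ (n + (k - 1)) * volume.real S ≤
            2 ^ ((n + 1 - k) * K) * volume.real (W ∩ S)} ≤ ENNReal.ofReal p := by
  have hn : n ≠ 0 := by omega
  set Q := unitCube n with hQ
  have hQm : MeasurableSet Q := measurableSet_unitCube n
  have hQ1 : volume Q = 1 := volume_unitCube n
  set b : ℝ := volume.real (Metric.ball (0 : RSpace n) 1) with hb
  have hb0 : 0 < b := ballVolume_pos
  set E := hyperbolicCross n k K with hE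
  set ρ := crossRadius n k K with hρ
  have hρ0 : 0 < ρ := crossRadius_pos
  set θ : ℝ := (2 * ρ)⁻¹ with hθ
  have hθ0 : 0 < θ := by positivity
  have hθρ : θ * ρ = 1 / 2 := by rw [hθ]; field_simp
  have hθ2 : θ ≤ 1 / 2 := by
    rw [← hθρ]
    refine le_mul_of_one_le_right hθ0.le ?_
    exact one_le_crossRadius
  have hEv : 0 < volume.real E := by
    rw [hE, volume_hyperbolicCross hk hkn]; positivity
  set a := θ ^ n * volume.real E with ha
  have ha0 : 0 < a := by positivity
  have ha1 : a ≤ 1 := by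
    have h1 : volume E ≤ ENNReal.ofReal (2 * ρ) ^ n := by
      rw [← volume_cell]
      refine measure_mono ((hyperbolicCross_subset_ball hkn).trans ?_)
      have := ball_subset_cell (n := n) (s := 2 * ρ) (θ := 1 / 2) (by positivity) le_rfl
      rwa [show 1 / 2 * (2 * ρ) = ρ by ring] at this
    have h2 : volume.real E ≤ (2 * ρ) ^ n := by
      rw [← ENNReal.ofReal_pow (by positivity)] at h1
      exact ENNReal.toReal_le_of_le_ofReal (by positivity) h1
    rw [ha, hθ, inv_pow, inv_mul_le_iff₀ (by positivity), mul_one]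
    exact h2
  let P0 : ℕ → ℝ → Prop := fun m s => s ≤ δ ∧
    volume (Q ∩ periodize s (Metric.ball 0 (θ * s))) ≤ ENNReal.ofReal (2 * (θ ^ n * b))
  have hP0 : ∀ m, ∀ᶠ s in 𝓝[>] 0, P0 m s := by
    intro m
    refine Eventually.and ?_ ?_
    · filter_upwards [Ioo_mem_nhdsGT hδ] with s hs using hs.2.le
    · obtain ⟨δ', hδ', hd⟩ := tendsto_measure_translate_diff hQm (by rw [hQ1]; simp)
        (ε := ENNReal.ofReal (θ ^ n * b)) (by simp; positivity)
      filter_upwards [eventually_forall_mem_cell hδ' fun t ht => (hd t ht).1,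
        self_mem_nhdsWithin] with s hs hs0
      refine (volume_inter_lattice_balls_le hn hs0 hθ0.le hθ2 hQm hs).trans (le_of_eq ?_)
      rw [hQ1, mul_one, ← ENNReal.ofReal_add (by positivity) (by positivity)]
      congr 1; ring
  obtain ⟨s, hs, hsP0, -, hcov⟩ := exists_scales_covering hn (θ := fun _ => θ) (ρ := fun _ => ρ)
    (E := fun _ _ => E) (fun _ => hθ0.le) (fun _ _ => measurableSet_hyperbolicCross)
    (fun _ _ => zero_notMem_hyperbolicCross hk hkn) (fun _ _ => hyperbolicCross_subset_ball hkn)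
    (fun _ => hθρ.le) (P := fun _ _ _ _ => True) hP0 (fun _ _ _ _ => Eventually.of_forall fun _ => trivial)
  set L := -Real.log (p / 2) with hL
  have hL0 : 0 < L := by
    rw [hL, neg_pos]
    exact Real.log_neg (by positivity) (by linarith)
  obtain ⟨M, hM⟩ : ∃ M : ℕ, 4 * (1 / 2 : ℝ) ^ M ≤ p / 2 := by
    obtain ⟨M, hM⟩ := exists_pow_lt_of_lt_one (show 0 < p / 8 by positivity)
      (show (1 / 2 : ℝ) < 1 by norm_num)
    exact ⟨M, by linarith⟩
  -- `N` stages of density `a` with `N a` about `L` leave uncovered about `exp (-L) = p / 2`.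
  set N := ⌈L / a⌉₊ with hN
  have hN1 : L ≤ N * a := by
    rw [← div_le_iff₀ ha0]; exact Nat.le_ceil _
  have hN2 : N * a ≤ L + 1 := by
    have h1 : (N : ℝ) ≤ L / a + 1 := (Nat.ceil_lt_add_one (by positivity)).le
    calc N * a ≤ (L / a + 1) * a := by gcongr
      _ = L + a := by field_simp
      _ ≤ L + 1 := by linarith
  let I := Finset.Ico M (M + N)
  let W : Set (RSpace n) := ⋃ i ∈ I, periodize (s i) (Metric.ball 0 (θ * s i))
  refine ⟨W, isOpen_biUnion fun i _ => isOpen_lattice_balls _ _, ?_, ?_⟩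
  · have h1 : volume (W ∩ Q) ≤ ENNReal.ofReal (N * (2 * (θ ^ n * b))) := by
      rw [iUnion₂_inter]
      calc _ ≤ ∑ i ∈ I, volume (periodize (s i) (Metric.ball 0 (θ * s i)) ∩ Q) :=
            measure_biUnion_finset_le _ _
        _ ≤ ∑ _i ∈ I, ENNReal.ofReal (2 * (θ ^ n * b)) := by
            refine Finset.sum_le_sum fun i _ => ?_
            rw [inter_comm]
            exact (hsP0 i).2
        _ = _ := by
            rw [Finset.sum_const, nsmul_eq_mul, ENNReal.ofReal_mul (Nat.cast_nonneg _),
              ENNReal.ofReal_natCast]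
            simp [I]
    refine (ENNReal.toReal_le_of_le_ofReal (by positivity) h1).trans ?_
    rw [le_div_iff₀ hEv]
    calc N * (2 * (θ ^ n * b)) * volume.real E = 2 * b * (N * a) := by rw [ha]; ring
      _ ≤ 2 * b * (1 - Real.log (p / 2)) := by
          gcongr
          linarith
  · obtain ⟨v, hv0, hv⟩ : ∃ v > 0, ∀ i ∈ I, v ≤ (θ * s i) ^ n := by
      by_cases hI : I.Nonempty
      · obtain ⟨i0, -, hi0⟩ := I.exists_min_image (fun i => (θ * s i) ^ n) hI
        exact ⟨(θ * s i0) ^ n, pow_pos (mul_pos hθ0 (hs i0)) n, hi0⟩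
      · rw [Finset.not_nonempty_iff_eq_empty] at hI
        exact ⟨1, one_pos, by simp [hI]⟩
    refine ⟨v, hv0, fun γ => ?_⟩
    have h1 := hcov γ 0 M (M + N) (Nat.zero_le _) (Nat.le_add_right _ _)
    have h2 : Real.exp (-∑ i ∈ Finset.Ico M (M + N), θ ^ n * volume.real E) ≤ p / 2 := by
      rw [← Real.le_log_iff_exp_le (by positivity), Finset.sum_const, Nat.card_Ico, nsmul_eq_mul,
        Nat.add_sub_cancel_left]
      linarith
    have h3 : volume (Q \ ⋃ i ∈ Ico M (M + N), stageSet (s i) θ γ E) ≤ ENNReal.ofReal p := by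
      refine (ENNReal.le_ofReal_iff_toReal_le ?_ hp.le).2 ?_
      · exact ((measure_mono sdiff_subset).trans_lt (by rw [hQ1]; simp)).ne
      · change volume.real _ ≤ p
        linarith
    refine (measure_mono ?_).trans h3
    rintro x ⟨hxQ, hx⟩
    refine ⟨hxQ, fun hxs => hx ?_⟩
    simp only [mem_iUnion, exists_prop] at hxs
    obtain ⟨i, hi, hxi⟩ := hxs
    have hiI : i ∈ I := by simpa [I] using hi
    obtain ⟨-, z, S, hS, hbS, hSx, hSm, hSv⟩ :=
      exists_rotated_interval hk hkn (hs i) hθ0.le hθρ.le γ hxi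
    have hr0 : 0 < θ * s i := mul_pos hθ0 (hs i)
    have hSv' : volume.real S = (θ * s i) ^ n *
        (2 ^ (n + (k - 1)) * 2 ^ ((n + 1 - k) * K)) := by
      rw [Measure.real, hSv, ENNReal.toReal_mul, ENNReal.toReal_pow, ENNReal.toReal_ofReal hr0.le,
        ENNReal.toReal_ofReal (by positivity)]
    refine ⟨S, hS, hSx.trans (Metric.ball_subset_ball (hsP0 i).1), hSm, ?_, ?_⟩
    · rw [hSv']
      refine (hv i hiI).trans (le_mul_of_one_le_right (by positivity) ?_)
      exact one_le_mul_of_one_le_of_one_le (one_le_pow₀ one_le_two) (one_le_pow₀ one_le_two)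
    · have h4 : (θ * s i) ^ n * b ≤ volume.real (W ∩ S) := by
        have h5 : volume.real (Metric.ball (latticePoint (s i) z) (θ * s i)) = (θ * s i) ^ n * b := by
          rw [Measure.real, volume_ball_eq hn _ hr0.le, ENNReal.toReal_mul, ENNReal.toReal_pow,
            ENNReal.toReal_ofReal hr0.le]
          rfl
        rw [← h5]
        refine measureReal_mono (fun y hy => ⟨?_, hbS hy⟩)
          ((measure_mono (inter_subset_right.trans hSx)).trans_lt measure_ball_lt_top).ne
        refine mem_biUnion (x := i) hiI ⟨z, ?_⟩
        rw [mem_ball_zero_iff, ← dist_eq_norm]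
        exact hy
      rw [hSv']
      calc b / 2 ^ (n + (k - 1)) * ((θ * s i) ^ n * (2 ^ (n + (k - 1)) * 2 ^ ((n + 1 - k) * K)))
          = 2 ^ ((n + 1 - k) * K) * ((θ * s i) ^ n * b) := by field_simp
        _ ≤ _ := by gcongr

/-! ### Genericity of divergence -/

/-- For every rotation, the points `x` at distance at least `1 / (l + 1)` from the complement of the
cube that have no rotated interval within that distance of `x` over which the mean of `f` is at
least `l` form a set of measure at most `2 ^ (-l)`. -/
def LargeMeans (n k l : ℕ) (f : RSpace n → ℝ) : Prop :=
  ∀ γ : RSpace n ≃ₗᵢ[ℝ] RSpace n,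
    volume {x | Metric.ball x (1 / (l + 1)) ⊆ unitCube n ∧
      ¬ ∃ S ∈ rotate (intervalBasis n k) γ x,
        S ⊆ Metric.ball x (1 / (l + 1)) ∧ (l : ℝ) ≤ ⨍ y in S, f y} ≤ ENNReal.ofReal ((1 / 2) ^ l)

/-- By the Borel–Cantelli lemma, applied for each rotation. -/
theorem mem_divergenceClass_of_largeMeans {n k : ℕ} {f : RSpace n → ℝ} (hf : f ∈ classL n)
    (h : ∀ l, LargeMeans n k l f) : f ∈ divergenceClass (rotatedFamily (intervalBasis n k)) := by
  refine ⟨hf, ?_⟩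
  rintro _ ⟨γ, -, rfl⟩
  have hsum : ∑' l : ℕ, ENNReal.ofReal ((1 / 2) ^ l) ≠ ∞ := by
    rw [← ENNReal.ofReal_tsum_of_nonneg (fun _ => by positivity) summable_geometric_two]
    exact ENNReal.ofReal_ne_top
  have hae := ae_eventually_notMem (ne_top_of_le_ne_top hsum (ENNReal.tsum_le_tsum fun l => h l γ))
  rw [ae_restrict_iff' (measurableSet_unitCube n)]
  filter_upwards [hae] with x hx hxQ
  refine upperDeriv_eq_top fun C ε hε => ?_
  obtain ⟨δ, hδ, hδQ⟩ := Metric.isOpen_iff.1 (isOpen_unitCube n) x hxQ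
  have hlim := tendsto_one_div_add_atTop_nhds_zero_nat (𝕜 := ℝ)
  obtain ⟨l, hl, hlδ, hlC⟩ := (hx.and ((hlim.eventually (gt_mem_nhds (lt_min hε hδ))).and
    (eventually_ge_atTop ⌈C⌉₊))).exists
  have hball : Metric.ball x (1 / ((l : ℝ) + 1)) ⊆ unitCube n :=
    (Metric.ball_subset_ball (hlδ.le.trans (min_le_right _ _))).trans hδQ
  have hl' : ∃ S ∈ rotate (intervalBasis n k) γ x,
      S ⊆ Metric.ball x (1 / ((l : ℝ) + 1)) ∧ (l : ℝ) ≤ ⨍ y in S, f y := by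
    by_contra hcon
    exact hl ⟨hball, hcon⟩
  obtain ⟨S, hS, hSx, hSl⟩ := hl'
  refine ⟨S, hS, hSx.trans (Metric.ball_subset_ball (hlδ.le.trans (min_le_left _ _))), ?_⟩
  have h1 : (⌈C⌉₊ : ℝ) ≤ l := by exact_mod_cast hlC
  linarith [Nat.le_ceil C]

/-- A bounded function plus a large multiple of the indicator of a well-spread set has large means,
and so has every function close to it in `L¹`. -/
theorem largeMeans_of_integral_sub_le {n k l K : ℕ} {W : Set (RSpace n)} (hW : MeasurableSet W)
    {f₁ f : RSpace n → ℝ} {T h κ v : ℝ} (hv : 0 < v) (hh : 0 ≤ h)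
    (hf₁ : Integrable f₁) (hT : ∀ x, |f₁ x| ≤ T) (hf : Integrable f)
    (hκ : (l + T + 1) * 2 ^ ((n + 1 - k) * K) ≤ h * κ)
    (hWγ : ∀ γ : RSpace n ≃ₗᵢ[ℝ] RSpace n,
        volume {x | x ∈ unitCube n ∧ ¬ ∃ S ∈ rotate (intervalBasis n k) γ x,
          S ⊆ Metric.ball x (1 / (l + 1)) ∧ MeasurableSet S ∧ v ≤ volume.real S ∧
          κ * volume.real S ≤ 2 ^ ((n + 1 - k) * K) * volume.real (W ∩ S)} ≤
            ENNReal.ofReal ((1 / 2) ^ l))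
    (hclose : ∫ x, |f x - (f₁ x + (W ∩ unitCube n).indicator (fun _ => h) x)| ≤ v) :
    LargeMeans n k l f := by
  intro γ
  refine (measure_mono ?_).trans (hWγ γ)
  rintro x ⟨hxQ, hx⟩
  have hl0 : (0 : ℝ) < 1 / (l + 1) := by positivity
  refine ⟨hxQ (Metric.mem_ball_self hl0), ?_⟩
  rintro ⟨S, hS, hSx, hSm, hSv, hSW⟩
  refine hx ⟨S, hS, hSx, ?_⟩
  set Q := unitCube n
  have hSf : volume S ≠ ∞ := ((measure_mono hSx).trans_lt measure_ball_lt_top).ne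
  have hS0 : 0 < volume.real S := hv.trans_le hSv
  have hWQm : MeasurableSet (W ∩ Q) := hW.inter (measurableSet_unitCube n)
  have hgi : Integrable ((W ∩ Q).indicator fun _ => h) :=
    (integrable_indicator_iff hWQm).2 (integrableOn_const
      ((measure_mono inter_subset_right).trans_lt (by rw [volume_unitCube]; simp)).ne)
  have hg : ∫ y in S, (W ∩ Q).indicator (fun _ => h) y = h * volume.real (W ∩ S) := by
    rw [setIntegral_indicator hWQm, setIntegral_const, smul_eq_mul, mul_comm]
    congr 2
    ext y
    exact ⟨fun hy => ⟨hy.2.1, hy.1⟩, fun hy => ⟨hy.2, hy.1, hxQ (hSx hy.2)⟩⟩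
  have h1 : -T * volume.real S ≤ ∫ y in S, f₁ y := by
    calc -T * volume.real S = ∫ _y in S, -T := by rw [setIntegral_const, smul_eq_mul, mul_comm]
      _ ≤ _ := setIntegral_mono (integrableOn_const hSf) hf₁.integrableOn
          fun y => (abs_le.1 (hT y)).1
  have h2 : -v ≤ ∫ y in S, (f y - (f₁ y + (W ∩ Q).indicator (fun _ => h) y)) := by
    have hi := hf.sub (hf₁.add hgi)
    have h3 : |∫ y in S, (f y - (f₁ y + (W ∩ Q).indicator (fun _ => h) y))| ≤ v :=
      (abs_integral_le_integral_abs).trans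
        ((setIntegral_le_integral hi.abs (Eventually.of_forall fun y => abs_nonneg _)).trans hclose)
    exact (abs_le.1 h3).1
  have hsub : ∫ y in S, (f y - (f₁ y + (W ∩ Q).indicator (fun _ => h) y)) =
      (∫ y in S, f y) - ((∫ y in S, f₁ y) + h * volume.real (W ∩ S)) := by
    have hs : Integrable fun y => f₁ y + (W ∩ Q).indicator (fun _ => h) y := hf₁.add hgi
    rw [integral_sub hf.integrableOn hs.integrableOn,
      integral_add hf₁.integrableOn hgi.integrableOn, hg]
  have h4 : (l + T + 1) * volume.real S ≤ h * volume.real (W ∩ S) := by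
    have hpow : (0 : ℝ) < 2 ^ ((n + 1 - k) * K) := by positivity
    refine le_of_mul_le_mul_left ?_ hpow
    calc 2 ^ ((n + 1 - k) * K) * ((l + T + 1) * volume.real S)
        = (l + T + 1) * 2 ^ ((n + 1 - k) * K) * volume.real S := by ring
      _ ≤ h * κ * volume.real S := by gcongr
      _ = h * (κ * volume.real S) := by ring
      _ ≤ h * (2 ^ ((n + 1 - k) * K) * volume.real (W ∩ S)) := by gcongr
      _ = _ := by ring
  rw [setAverage_eq, smul_eq_mul, inv_mul_eq_div, le_div_iff₀ hS0]
  linarith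

theorem mem_phiClass_of_bounded {n : ℕ} (ψ : YoungFunction) {f : RSpace n → ℝ} {T : ℝ}
    (hfm : AEMeasurable f volume) (hfQ : ∀ x ∉ unitCube n, f x = 0) (hT : ∀ x, |f x| ≤ T) :
    f ∈ phiClass ψ (unitCube n) := by
  have hsub : {x | f x ≠ 0} ⊆ unitCube n := fun x hx => by
    by_contra hxQ
    exact hx (hfQ x hxQ)
  refine ⟨hfm, hsub, ?_⟩
  calc ∫⁻ x in {x | f x ≠ 0}, ENNReal.ofReal (ψ |f x|)
      ≤ ∫⁻ _x in {x | f x ≠ 0}, ENNReal.ofReal (ψ T) :=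
        lintegral_mono fun x => ENNReal.ofReal_le_ofReal (ψ.monotoneOn (mem_Ici.2 (abs_nonneg _))
          (mem_Ici.2 ((abs_nonneg _).trans (hT x))) (hT x))
    _ = ENNReal.ofReal (ψ T) * volume {x | f x ≠ 0} := setLIntegral_const _ _
    _ < ∞ := ENNReal.mul_lt_top ENNReal.ofReal_lt_top
        ((measure_mono hsub).trans_lt (by rw [volume_unitCube]; simp))

/-- Functions with large means, together with a neighbourhood, are dense. -/
theorem dense_interior_largeMeans {n k : ℕ} (hk : 2 ≤ k) (hkn : k ≤ n) {ψ : YoungFunction}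
    (hΔ : DeltaTwo ψ)
    (hψ : Tendsto (fun h : ℝ => ψ h / (h * Real.log h ^ (k - 1))) atTop (𝓝 0)) (l : ℕ) :
    Dense (interior {f : OrliczSpace n ψ | LargeMeans n k l f.1}) := by
  intro f
  rw [EMetric.mem_closure_iff]
  intro ε hε
  obtain ⟨e, he0, heε⟩ : ∃ e : ℝ, 0 < e ∧ ENNReal.ofReal e + ENNReal.ofReal e < ε := by
    obtain ⟨e, he, heε⟩ := ENNReal.lt_iff_exists_nnreal_btwn.1 hε
    have he' : (0 : ℝ) < e := by exact_mod_cast he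
    refine ⟨e / 2, by positivity, ?_⟩
    rw [← ENNReal.ofReal_add (by positivity) (by positivity), add_halves, ENNReal.ofReal_coe_nnreal]
    exact heε
  obtain ⟨T, hT0, f₁, hf₁m, hf₁Q, hT, hdist⟩ := exists_bounded_approx hΔ f.2 he0
  set b : ℝ := volume.real (Metric.ball (0 : RSpace n) 1) with hb
  have hb0 : 0 < b := ballVolume_pos
  set κ : ℝ := b / 2 ^ (n + (k - 1)) with hκ
  have hκ0 : 0 < κ := by positivity
  -- `h = H 2 ^ (d K)` on a set of relative density `κ 2 ^ (-d K)` gives means `l + T + 1`: `T` makes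
  -- up for the bounded part and `1` for the perturbation. The index `K` is large enough for
  -- `h 1_W` to have small norm.
  set H : ℝ := (l + T + 1) / κ with hH
  have hH0 : 0 < H := by positivity
  set p : ℝ := (1 / 2) ^ l with hp
  have hp0 : 0 < p := by positivity
  have hp1 : p ≤ 1 := pow_le_one₀ (by norm_num) (by norm_num)
  have hlog : 0 < 1 - Real.log (p / 2) := by
    have : Real.log (p / 2) < 0 := Real.log_neg (by positivity) (by linarith)
    linarith
  obtain ⟨K, hK⟩ := exists_mul_le_volume_hyperbolicCross hk hkn hψ (H := H / e)
    (Λ := 2 * b * (1 - Real.log (p / 2))) (by positivity) (by positivity)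
  obtain ⟨W, hWo, hWv, v, hv0, hWγ⟩ := exists_spread_open hk hkn K (δ := 1 / (l + 1)) (p := p)
    (by positivity) hp0 hp1
  set h : ℝ := H * 2 ^ ((n + 1 - k) * K) with hh
  have hh0 : 0 < h := by positivity
  set Q := unitCube n with hQ
  have hWQm : MeasurableSet (W ∩ Q) := hWo.measurableSet.inter (measurableSet_unitCube n)
  set g : RSpace n → ℝ := (W ∩ Q).indicator fun _ => h with hg
  have hgm : Measurable g := measurable_const.indicator hWQm
  have hgQ : ∀ x ∉ Q, g x = 0 := fun x hx => indicator_of_notMem (fun hx' => hx hx'.2) _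
  have hgb : ∀ x, |g x| ≤ h := fun x => by
    by_cases hx : x ∈ W ∩ Q
    · rw [hg, indicator_of_mem hx, abs_of_pos hh0]
    · rw [hg, indicator_of_notMem hx, abs_zero]; exact hh0.le
  have hf₁c := mem_phiClass_of_bounded ψ hf₁m hf₁Q hT
  have hf₂c : (fun x => f₁ x + g x) ∈ phiClass ψ Q :=
    mem_phiClass_of_bounded ψ (hf₁m.add hgm.aemeasurable)
      (fun x hx => by rw [hf₁Q x hx, hgQ x hx, add_zero]) (T := T + h)
      (fun x => (abs_add_le _ _).trans (add_le_add (hT x) (hgb x)))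
  let F₁ : OrliczSpace n ψ := ⟨f₁, hf₁c⟩
  let F₂ : OrliczSpace n ψ := ⟨fun x => f₁ x + g x, hf₂c⟩
  have hd1 : edist f F₁ ≤ ENNReal.ofReal e := hdist
  have hd2 : edist F₁ F₂ ≤ ENNReal.ofReal e := by
    change luxemburgNorm ψ (fun x => f₁ x - (f₁ x + g x)) ≤ _
    refine luxemburgNorm_le he0 ?_
    have hpt : ∀ x, ENNReal.ofReal (ψ (|f₁ x - (f₁ x + g x)| / e)) =
        (W ∩ Q).indicator (fun _ => ENNReal.ofReal (ψ (h / e))) x := fun x => by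
      rw [sub_add_cancel_left, abs_neg]
      by_cases hx : x ∈ W ∩ Q
      · rw [indicator_of_mem hx, hg, indicator_of_mem hx, abs_of_pos hh0]
      · rw [indicator_of_notMem hx, hg, indicator_of_notMem hx]; simp [ψ.map_zero]
    simp_rw [hpt]
    have hWf : volume (W ∩ Q) ≠ ∞ :=
      ((measure_mono inter_subset_right).trans_lt (by rw [hQ, volume_unitCube]; simp)).ne
    have hψ0 : 0 ≤ ψ (h / e) := ψ.nonneg _ (by positivity)
    rw [lintegral_indicator_const hWQm, ← ofReal_measureReal hWf, ← ENNReal.ofReal_mul hψ0,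
      ← ENNReal.ofReal_one]
    refine ENNReal.ofReal_le_ofReal ?_
    have hE0 : 0 < volume.real (hyperbolicCross n k K) := by
      rw [volume_hyperbolicCross hk hkn]; positivity
    calc ψ (h / e) * volume.real (W ∩ Q)
        ≤ ψ (h / e) * (2 * b * (1 - Real.log (p / 2)) / volume.real (hyperbolicCross n k K)) := by
          gcongr
      _ = ψ (H / e * 2 ^ ((n + 1 - k) * K)) * (2 * b * (1 - Real.log (p / 2))) /
            volume.real (hyperbolicCross n k K) := by
          rw [show h / e = H / e * 2 ^ ((n + 1 - k) * K) by rw [hh]; ring]; ring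
      _ ≤ 1 := by rw [div_le_one hE0]; exact hK
  refine ⟨F₂, ?_, ?_⟩
  · rw [mem_interior_iff_mem_nhds, EMetric.mem_nhds_iff]
    obtain ⟨C, hC0, hC⟩ := exists_integral_abs_le_of_luxemburgNorm_lt (n := n) ψ
    refine ⟨ENNReal.ofReal (v / (C + 1)), ENNReal.ofReal_pos.2 (by positivity), fun φ hφ => ?_⟩
    have hφc := phiClass_subset_classL ψ φ.2
    have hφi := integrable_of_mem_classL hφc
    have hf₁i := integrable_of_mem_classL (phiClass_subset_classL ψ hf₁c)
    have hf₂i := integrable_of_mem_classL (phiClass_subset_classL ψ hf₂c)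
    have hclose := hC (fun x => φ.1 x - (f₁ x + g x)) (v / (C + 1)) (hφi.sub hf₂i)
      (fun x hx => by
        have : φ.1 x = 0 := by
          by_contra hne
          exact hx (φ.2.2.1 hne)
        rw [this, hf₁Q x hx, hgQ x hx]; simp) hφ
    refine largeMeans_of_integral_sub_le hWo.measurableSet hv0 hh0.le hf₁i hT hφi ?_ hWγ
      (hclose.trans ?_)
    · rw [hh, hH]
      refine le_of_eq ?_
      field_simp
      exact div_mul_cancel₀ b (by positivity)
    · rw [mul_div_assoc', div_le_iff₀ (by positivity)]
      nlinarith
  · exact (edist_triangle f F₁ F₂).trans_lt ((add_le_add hd1 hd2).trans_lt heε)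

theorem isMeagre_notMem_divergenceClass {n k : ℕ} (hk : 2 ≤ k) (hkn : k ≤ n) {ψ : YoungFunction}
    (hΔ : DeltaTwo ψ)
    (hψ : Tendsto (fun h : ℝ => ψ h / (h * Real.log h ^ (k - 1))) atTop (𝓝 0)) :
    IsMeagre {f : OrliczSpace n ψ |
      f.1 ∉ divergenceClass (rotatedFamily (intervalBasis n k))} := by
  have h : ⋂ l, interior {f : OrliczSpace n ψ | LargeMeans n k l f.1} ∈ residual (OrliczSpace n ψ) :=
    countable_iInter_mem.2 fun l =>
      residual_of_dense_open isOpen_interior (dense_interior_largeMeans hk hkn hΔ hψ l)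
  refine mem_of_superset h fun f hf hcon => hcon ?_
  exact mem_divergenceClass_of_largeMeans (phiClass_subset_classL ψ f.2)
    fun l => interior_subset (mem_iInter.1 hf l)

end DiffBases

theorem theorem4 (n k : ℕ) (hk : 2 ≤ k) (hkn : k ≤ n) :
    (∀ f : RSpace n → ℝ, f ∈ classL n → f ∉ classLLog n (k - 1) →
      ∃ ω : RSpace n ≃ᵐ RSpace n, MeasurePreserving ω volume volume ∧
        {x | ω x ≠ x} ⊆ unitCube n ∧
        (fun x => |f (ω x)|) ∈ divergenceClass (rotatedFamily (intervalBasis n k))) ∧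
    (∀ ψ : YoungFunction, DeltaTwo ψ →
      Tendsto (fun h : ℝ => ψ h / (h * Real.log h ^ (k - 1))) atTop (𝓝 0) →
      IsMeagre {f : OrliczSpace n ψ |
        f.1 ∉ divergenceClass (rotatedFamily (intervalBasis n k))}) :=
  ⟨fun _ hf hf' => exists_rearrangement_mem_divergenceClass hk hkn hf hf',
    fun _ hΔ hψ => isMeagre_notMem_divergenceClass hk hkn hΔ hψ⟩
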